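/- Let $m\ge 4$ be an integer. For $r>0$ put $Q(r)=\pi-2\arctan(r^m)$, $h(r)=\sin Q(r)$, and for $s>0$ put $Q^s(r)=Q(r/s)$, $h^s(r)=h(r/s)$ and $$H^s:=-\partial_r^2-\frac1r\partial_r+\frac{m^2}{r^2}\cos(2Q^s).$$ All Lebesgue norms and inner products in $r\in(0,\infty)$ are taken with respect to the measure $r\,dr$. Let $$\|u\|_{X^p}^p=\|u_r\|_{L^p}^p+m^p\|u/r\|_{L^p}^p\quad(1\le p<\infty),\qquad \|u\|_{X^\infty}=\|u_r\|_{L^\infty}+\|u/r\|_{L^\infty}.$$ Then there is a constant $C$ depending only on $m$ with the following property. Let $0\le T\le\infty$, let $s:[0,T)\to(0,\infty)$ be differentiable, and let $\xi\in C([0,T);X^2)$ be a (distributional) solution of $$\partial_t\xi+H^{s(t)}\xi=f\ \text{ on }(0,T)\times(0,\infty),\qquad \xi(\cdot,0)=\xi_0,$$ with $f\in L^1_{\mathrm{loc}}((0,T)\times(0,\infty))$, which satisfies the orthogonality condition $$(\xi(\cdot,t),h^{s(t)})_{L^2(r\,dr)}=\int_0^\infty \xi(r,t)\,h^{s(t)}(r)\,r\,dr=0\qquad\text{for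 all }t\in[0,T).$$ Then $$\|\xi\|_{L^\infty_tX^2}+\|\xi\|_{L^2_tX^\infty}\le C\left(\|\xi_0\|_{X^2}+\|f\|_{L^1_tX^2+L^2_tX^1}+\|\dot s\|_{L^2_t}\right),$$ where the time norms are over $[0,T)$, and $\|f\|_{L^1_tX^2+L^2_tX^1}$ is the infimum of $\|f_1\|_{L^1_tX^2}+\|f_2\|_{L^2_tX^1}$ over decompositions $f=f_1+f_2$ (the right-hand side being $+\infty$ if one of the norms is infinite). -/

import Mathlib

open MeasureTheory Set Filter Topology
open scoped ENNReal NNReal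

namespace HarmonicMapFlow

noncomputable section

/-- The measure `r dr` on the half-line `(0, ∞)`. -/
def rdr : Measure ℝ :=
  (volume.restrict (Ioi (0 : ℝ))).withDensity (fun r => ENNReal.ofReal r)

/-- `g` is the weak (distributional) derivative of `u` on the open half-line `(0, ∞)`. -/
structure HasWeakDeriv (u g : ℝ → ℝ) : Prop where
  locInt : LocallyIntegrableOn u (Ioi (0 : ℝ))
  locInt_deriv : LocallyIntegrableOn g (Ioi (0 : ℝ))
  byParts : ∀ φ : ℝ → ℝ, ContDiff ℝ (⊤ : ℕ∞) φ → HasCompactSupport φ → tsupport φ ⊆ Ioi (0 : ℝ) →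
    ∫ r in Ioi (0 : ℝ), u r * deriv φ r = -∫ r in Ioi (0 : ℝ), g r * φ r

/-- The norm of `X^p`: `‖u‖^p = ‖u_r‖_{L^p}^p + m^p ‖u / r‖_{L^p}^p` for finite `p`, and
`‖u‖ = ‖u_r‖_{L^∞} + ‖u / r‖_{L^∞}` for `p = ∞`, where the Lebesgue norms are taken with respect
to `r dr`.  The weak derivative `u_r` is unique almost everywhere, so that the infimum is over
equal numbers; it is `∞` when `u` has no weak derivative. -/
def xNorm (m : ℕ) (p : ℝ≥0∞) (u : ℝ → ℝ) : ℝ≥0∞ :=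
  ⨅ (g : ℝ → ℝ) (_ : HasWeakDeriv u g),
    if p = ∞ then eLpNorm g ∞ rdr + eLpNorm (fun r => u r / r) ∞ rdr
    else ((eLpNorm g p rdr) ^ p.toReal
      + (m : ℝ≥0∞) ^ p.toReal * (eLpNorm (fun r => u r / r) p rdr) ^ p.toReal) ^ (1 / p.toReal)

/-- The time interval `[0, T)`, where `T` may be infinite. -/
def timeInterval (T : ℝ≥0∞) : Set ℝ := {t | 0 ≤ t ∧ ENNReal.ofReal t < T}

/-- The open space-time domain `(0, T) × (0, ∞)`, with points `(t, r)`. -/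
def spaceTime (T : ℝ≥0∞) : Set (ℝ × ℝ) := {z | 0 < z.1 ∧ ENNReal.ofReal z.1 < T ∧ 0 < z.2}

/-- The norm of `L^q_t X^p` on the time interval `[0, T)`. -/
def mixedNorm (m : ℕ) (q p T : ℝ≥0∞) (u : ℝ → ℝ → ℝ) : ℝ≥0∞ :=
  eLpNorm (fun t => xNorm m p (u t)) q (volume.restrict (timeInterval T))

/-- The norm of `L^1_t X^2 + L^2_t X^1` on `[0, T)`: the infimum of
`‖f₁‖_{L^1_t X^2} + ‖f₂‖_{L^2_t X^1}` over all measurable decompositions `f = f₁ + f₂`. -/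
def forcingNorm (m : ℕ) (T : ℝ≥0∞) (f : ℝ → ℝ → ℝ) : ℝ≥0∞ :=
  ⨅ (f₁ : ℝ → ℝ → ℝ) (f₂ : ℝ → ℝ → ℝ)
    (_ : AEStronglyMeasurable (fun z : ℝ × ℝ => f₁ z.1 z.2) (volume.restrict (spaceTime T)))
    (_ : AEStronglyMeasurable (fun z : ℝ × ℝ => f₂ z.1 z.2) (volume.restrict (spaceTime T)))
    (_ : ∀ᵐ z : ℝ × ℝ ∂(volume.restrict (spaceTime T)), f z.1 z.2 = f₁ z.1 z.2 + f₂ z.1 z.2),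
    mixedNorm m 1 2 T f₁ + mixedNorm m 2 1 T f₂

/-- The harmonic map profile `Q(r) = π - 2 arctan (r^m)`. -/
def Q (m : ℕ) (r : ℝ) : ℝ := Real.pi - 2 * Real.arctan (r ^ m)

/-- `h = sin Q`. -/
def h (m : ℕ) (r : ℝ) : ℝ := Real.sin (Q m r)

/-- The linearized operator about `Q^s(r) = Q(r/s)`:
`H^s u = - u_rr - u_r / r + (m^2 / r^2) cos (2 Q^s) u`. -/
def linearizedOp (m : ℕ) (s : ℝ) (u : ℝ → ℝ) (r : ℝ) : ℝ :=
  -deriv (deriv u) r - (1 / r) * deriv u r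
    + ((m : ℝ) ^ 2 / r ^ 2) * Real.cos (2 * Q m (r / s)) * u r

/-- `ξ` belongs to `C([0, T); X^2)`, has `ξ(0) = ξ₀`, and solves `∂_t ξ + H^{s(t)} ξ = f` on
`(0, T) × (0, ∞)` in the sense of distributions.  The operator `H^s` is formally self-adjoint with
respect to `r dr`, so that it passes to the test function unchanged. -/
structure IsLinearizedSolution (m : ℕ) (T : ℝ≥0∞) (s : ℝ → ℝ) (f : ℝ → ℝ → ℝ) (ξ₀ : ℝ → ℝ)
    (ξ : ℝ → ℝ → ℝ) : Prop where
  memX : ∀ t ∈ timeInterval T, xNorm m 2 (ξ t) < ∞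
  continuousX : ∀ t₀ ∈ timeInterval T,
    Tendsto (fun t => xNorm m 2 (fun r => ξ t r - ξ t₀ r)) (𝓝[timeInterval T] t₀) (𝓝 0)
  initial : ∀ᵐ r ∂rdr, ξ 0 r = ξ₀ r
  locInt : LocallyIntegrableOn (fun z : ℝ × ℝ => ξ z.1 z.2) (spaceTime T)
  locInt_forcing : LocallyIntegrableOn (fun z : ℝ × ℝ => f z.1 z.2) (spaceTime T)
  equation : ∀ φ : ℝ × ℝ → ℝ, ContDiff ℝ (⊤ : ℕ∞) φ → HasCompactSupport φ → tsupport φ ⊆ spaceTime T →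
    ∫ z in spaceTime T, ξ z.1 z.2 * (-deriv (fun τ => φ (τ, z.2)) z.1
        + linearizedOp m (s z.1) (fun ρ => φ (z.1, ρ)) z.2) * z.2
      = ∫ z in spaceTime T, f z.1 z.2 * φ z * z.2

end

end HarmonicMapFlow

open HarmonicMapFlow

/-! Put r = e^x, σ = log s and u(x) = ξ(t, e^x). The square of the X² norm becomes ∫ u_x² + m² u²
dx, and r² H^s becomes the Pöschl–Teller operator -∂_x² + m² - 2m² sech²(m(x - σ)), whose kernel is
spanned by h^s = sech(m(x - σ)) (`h_exp_div`, `linearizedOp_expTest`). The energy is ∫ u_x² + κ² u²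
dx with κ² = m² + 56 m⁴. It is equivalent to the squared X² norm and does not depend on s, so its
time derivative contains no ṡ; the estimate is proved without the term in ṡ, which is added to the
right-hand side at the very end.

At a fixed time write v = f₁ - u_t, e = r f₂ and η = u / r. The equation reads -u'' + m² u = e^x w
with w = e^x v + e + 2m² sech² η, so ∫ w² dx is the squared L²(r dr) norm of (-∂_r² - ∂_r/r + m²/r²)
ξ. This is the dissipated quantity, and by a one-dimensional Sobolev inequality it controls the X^∞
norm (`weighted_identity`). Two multipliers are combined in `energy_estimate`. Pairing u with v in
X² gives at least half of ∫ w², up to ∫ e² and 4 m⁴ ∫ η². Pairing u with v in L²(dx) gives Φ - ∫ η²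
- ∫ e η, where Φ = ∫ (η' + m tanh(m(x - σ)) η)² is the quadratic form of the Pöschl–Teller operator
at η. The condition (ξ, h^s) = 0 says that η is orthogonal to e^{3x} sech(m(x - σ)), and on such η
one has Φ ≥ (8/7) ∫ η² (`coercivity`). Hence the second pairing is positive, and 56 m⁴ times it
absorbs the loss of the first.

For the coercivity, subtract from η the multiple of the ground state that agrees with it at σ. This
leaves Φ unchanged, and the remainder vanishes at σ. On each half-line a Riccati function bounds Φ
below by (4/5) m² times the squared L² norm of the remainder (`half_line_bound`). The orthogonality
bounds the subtracted multiple by the remainder. The constants just fit when m = 4.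

The curve ξ is only continuous in time, so the estimate is applied to Steklov averages over [t, t +
δ], which are differentiable in time (`IsLinearizedSolution.averaged_inequality`). The potential is
frozen at time t. The commutator and the defect of orthogonality are both of the order of the
oscillation of log s over the window, and they disappear as δ → 0, where Fatou's lemma gives the
bounds for ξ itself (`IsLinearizedSolution.interval_bound`). No measurability in time of the slice
norms is available. The averages of the forcing terms are therefore obtained from the Riesz theorem
instead of vector-valued integrals, and the integrals of the norms are handled as lower integrals.
-/

namespace HarmonicMapFlow

/-! ### Primitives, integration by parts and test functions on the line. -/

/-- `u` is an indefinite integral of `g` on `I`. -/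
def IsPrimitiveOn (I : Set ℝ) (u g : ℝ → ℝ) : Prop :=
  ∀ a ∈ I, ∀ b ∈ I, IntervalIntegrable g volume a b ∧ u b - u a = ∫ x in a..b, g x

namespace IsPrimitiveOn

variable {I : Set ℝ} {u g v k : ℝ → ℝ}

lemma mono {J : Set ℝ} (h : IsPrimitiveOn I u g) (hJ : J ⊆ I) : IsPrimitiveOn J u g :=
  fun a ha b hb => h a (hJ ha) b (hJ hb)

lemma const_mul (c : ℝ) (h : IsPrimitiveOn I u g) :
    IsPrimitiveOn I (fun x => c * u x) (fun x => c * g x) := by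
  intro a ha b hb
  obtain ⟨h1, h2⟩ := h a ha b hb
  refine ⟨h1.const_mul c, ?_⟩
  rw [intervalIntegral.integral_const_mul, ← h2]
  ring

lemma sub (h : IsPrimitiveOn I u g) (h' : IsPrimitiveOn I v k) :
    IsPrimitiveOn I (fun x => u x - v x) (fun x => g x - k x) := by
  intro a ha b hb
  obtain ⟨h1, h2⟩ := h a ha b hb
  obtain ⟨h3, h4⟩ := h' a ha b hb
  refine ⟨h1.sub h3, ?_⟩
  rw [intervalIntegral.integral_sub h1 h3]
  linarith

lemma congr_deriv (h : IsPrimitiveOn I u g) (hgk : ∀ x, g x = k x) : IsPrimitiveOn I u k := by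
  obtain rfl : g = k := funext hgk
  exact h

lemma congr_deriv_ae (h : IsPrimitiveOn I u g) (hgk : g =ᵐ[volume] k) : IsPrimitiveOn I u k := by
  intro a ha b hb
  obtain ⟨h1, h2⟩ := h a ha b hb
  refine ⟨h1.congr_ae (ae_restrict_of_ae hgk), ?_⟩
  rw [h2]
  exact intervalIntegral.integral_congr_ae (hgk.mono fun x hx _ => hx)

lemma of_hasDerivAt (hI : OrdConnected I) (h : ∀ x ∈ I, HasDerivAt u (g x) x)
    (hg : ContinuousOn g I) : IsPrimitiveOn I u g := by
  intro a ha b hb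
  have hs : uIcc a b ⊆ I := hI.uIcc_subset ha hb
  have hi : IntervalIntegrable g volume a b := (hg.mono hs).intervalIntegrable
  exact ⟨hi, (intervalIntegral.integral_eq_sub_of_hasDerivAt (fun x hx => h x (hs hx)) hi).symm⟩

lemma of_contDiff (h : ContDiff ℝ 1 u) : IsPrimitiveOn I u (deriv u) := by
  refine IsPrimitiveOn.mono (of_hasDerivAt ordConnected_univ (fun x _ => ?_) ?_) (subset_univ I)
  · exact (h.differentiable one_ne_zero x).hasDerivAt
  · exact (h.continuous_deriv le_rfl).continuousOn

lemma intervalIntegral_self {c : ℝ} (hg : ∀ a ∈ I, ∀ b ∈ I, IntervalIntegrable g volume a b)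
    (hc : c ∈ I) (C : ℝ) : IsPrimitiveOn I (fun x => C + ∫ t in c..x, g t) g := by
  intro a ha b hb
  refine ⟨hg a ha b hb, ?_⟩
  rw [← intervalIntegral.integral_interval_sub_left (hg c hc b hb) (hg c hc a ha)]
  ring

/-- Up to a constant `u` is the integral of `g`, so absolute continuity and Lebesgue differentiation
are inherited. This reduces the product rule for primitives to integration by parts for absolutely
continuous functions. -/
lemma absolutelyContinuousOnInterval (hI : OrdConnected I) (h : IsPrimitiveOn I u g) {a b : ℝ}
    (ha : a ∈ I) (hb : b ∈ I) : AbsolutelyContinuousOnInterval u a b ∧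
      ∀ᵐ x, x ∈ uIoc a b → deriv u x = g x := by
  have hs : uIcc a b ⊆ I := hI.uIcc_subset ha hb
  have hi := (h a ha b hb).1
  have hU : ∀ x ∈ uIcc a b, u x = u a + ∫ t in a..x, g t := fun x hx => by
    rw [← (h a ha x (hs hx)).2]; ring
  have hac := hi.absolutelyContinuousOnInterval_intervalIntegral (c := a) left_mem_uIcc
  constructor
  · rw [absolutelyContinuousOnInterval_iff] at hac ⊢
    intro ε hε
    obtain ⟨δ, hδ, H⟩ := hac ε hε
    refine ⟨δ, hδ, fun E hE hlt => ?_⟩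
    convert H E hE hlt using 1
    refine Finset.sum_congr rfl fun i hi => ?_
    have hm := hE.1 i hi
    rw [hU _ hm.1, hU _ hm.2, dist_add_left]
  · have hne : ∀ᵐ x : ℝ, x ≠ max a b := by simp [ae_iff]
    filter_upwards [hi.ae_hasDerivAt_integral, hne] with x hx hx' hxm
    have hd := hx (uIoc_subset_uIcc hxm) a left_mem_uIcc
    have heq : u =ᶠ[𝓝 x] fun x => u a + ∫ t in a..x, g t := by
      have hmem : Ioo (min a b) (max a b) ∈ 𝓝 x :=
        Ioo_mem_nhds hxm.1 (lt_of_le_of_ne hxm.2 hx')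
      filter_upwards [hmem] with y hy
      exact hU y (Ioo_subset_Icc_self hy)
    exact ((hd.const_add (u a)).congr_of_eventuallyEq heq).deriv

lemma continuousOn (hI : OrdConnected I) (h : IsPrimitiveOn I u g) {a b : ℝ}
    (ha : a ∈ I) (hb : b ∈ I) : ContinuousOn u (uIcc a b) :=
  (h.absolutelyContinuousOnInterval hI ha hb).1.continuousOn

lemma mul (hI : OrdConnected I) (h : IsPrimitiveOn I u g) (h' : IsPrimitiveOn I v k) :
    IsPrimitiveOn I (fun x => u x * v x) (fun x => g x * v x + u x * k x) := by
  intro a ha b hb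
  obtain ⟨h1, h2⟩ := h.absolutelyContinuousOnInterval hI ha hb
  obtain ⟨h3, h4⟩ := h'.absolutelyContinuousOnInterval hI ha hb
  refine ⟨((h a ha b hb).1.mul_continuousOn h3.continuousOn).add
    ((h' a ha b hb).1.continuousOn_mul h1.continuousOn), ?_⟩
  rw [← h1.integral_deriv_mul_eq_sub h3]
  refine intervalIntegral.integral_congr_ae ?_
  filter_upwards [h2, h4] with x hx hx' hm
  rw [hx hm, hx' hm]

lemma continuous (h : IsPrimitiveOn univ u g) : Continuous u := by
  refine continuous_iff_continuousAt.2 fun x => ?_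
  have := h.continuousOn ordConnected_univ (mem_univ (x - 1)) (mem_univ (x + 1))
  refine this.continuousAt ?_
  rw [uIcc_of_le (by linarith)]
  exact Icc_mem_nhds (by linarith) (by linarith)

/-- An integrable function with integrable derivative has a derivative of mean zero. -/
lemma integral_eq_zero (h : IsPrimitiveOn univ u g) (hu : Integrable u) (hg : Integrable g) :
    ∫ x, g x = 0 := by
  have h1 : Tendsto (fun x : ℝ => u x - u (-x)) atTop (𝓝 (∫ x, g x)) := by
    have := intervalIntegral_tendsto_integral hg tendsto_neg_atTop_atBot
      (tendsto_id : Tendsto (fun x : ℝ => x) atTop atTop)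
    refine this.congr fun x => ?_
    rw [(h (-x) (mem_univ _) x (mem_univ _)).2, id]
  have h2 : Integrable (fun x : ℝ => u x - u (-x)) := hu.sub hu.comp_neg
  -- The function u(x) - u(-x) is integrable and converges to ∫ g at infinity; an integrable
  -- function can only converge to 0 there.
  refine IntegrableAtFilter.eq_zero_of_tendsto (μ := volume) ⟨univ, univ_mem, h2.integrableOn⟩
    (fun s hs => ?_) h1
  obtain ⟨b, hb⟩ := mem_atTop_sets.1 hs
  rw [← top_le_iff, ← Real.volume_Ici (a := b)]
  exact measure_mono hb

end IsPrimitiveOn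

/-- Smooth compactly supported functions on the line. -/
structure IsTest (φ : ℝ → ℝ) : Prop where
  contDiff : ContDiff ℝ (⊤ : ℕ∞) φ
  compact : HasCompactSupport φ

namespace IsTest

variable {φ ψ : ℝ → ℝ}

lemma deriv (h : IsTest φ) : IsTest (deriv φ) :=
  ⟨(contDiff_infty_iff_deriv.1 h.contDiff).2, h.compact.deriv⟩

lemma continuous (h : IsTest φ) : Continuous φ := h.contDiff.continuous

lemma differentiable (h : IsTest φ) : Differentiable ℝ φ := h.contDiff.differentiable (by simp)

lemma hasDerivAt (h : IsTest φ) (x : ℝ) : HasDerivAt φ (_root_.deriv φ x) x :=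
  (h.differentiable x).hasDerivAt

lemma isPrimitiveOn (h : IsTest φ) (I : Set ℝ) : IsPrimitiveOn I φ (_root_.deriv φ) :=
  IsPrimitiveOn.of_contDiff (h.contDiff.of_le (by exact_mod_cast le_top))

lemma contDiff_mul (h : IsTest φ) {c : ℝ → ℝ} (hc : ContDiff ℝ (⊤ : ℕ∞) c) :
    IsTest (fun x => c x * φ x) :=
  ⟨hc.mul h.contDiff, h.compact.mul_left⟩

lemma memLp_mul (h : IsTest φ) {c : ℝ → ℝ} (hc : Continuous c) (p : ℝ≥0∞) :
    MemLp (fun x => c x * φ x) p volume :=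
  (hc.mul h.continuous).memLp_of_hasCompactSupport h.compact.mul_left

lemma memLp (h : IsTest φ) (p : ℝ≥0∞) : MemLp φ p volume :=
  h.continuous.memLp_of_hasCompactSupport h.compact

lemma integrable (h : IsTest φ) : Integrable φ := memLp_one_iff_integrable.1 (h.memLp 1)

lemma locallyIntegrable_mul (h : IsTest φ) {u : ℝ → ℝ} (hu : LocallyIntegrable u) :
    Integrable (fun x => u x * φ x) := by
  have := hu.integrable_smul_right_of_hasCompactSupport h.continuous h.compact
  simpa [smul_eq_mul] using this

/-- A compactly contained support fits into a compact interval of `I`. -/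
lemma exists_interval (h : IsTest φ) {I : Set ℝ} (hI : IsOpen I) (hφ : tsupport φ ⊆ I)
    {c : ℝ} (hc : c ∈ I) :
    ∃ a ∈ I, ∃ b ∈ I, a < b ∧ tsupport φ ⊆ Ioo a b := by
  have hK : IsCompact (insert c (tsupport φ)) := h.compact.isCompact.insert c
  have hKI : insert c (tsupport φ) ⊆ I := insert_subset hc hφ
  obtain ⟨α, hα, hαm⟩ := hK.exists_isLeast (insert_nonempty _ _)
  obtain ⟨β, hβ, hβm⟩ := hK.exists_isGreatest (insert_nonempty _ _)
  obtain ⟨ε, hε, hεI⟩ := Metric.isOpen_iff.1 hI α (hKI hα)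
  obtain ⟨ε', hε', hεI'⟩ := Metric.isOpen_iff.1 hI β (hKI hβ)
  refine ⟨α - ε / 2, hεI ?_, β + ε' / 2, hεI' ?_, ?_, ?_⟩
  · rw [Metric.mem_ball, Real.dist_eq, abs_lt]; constructor <;> linarith
  · rw [Metric.mem_ball, Real.dist_eq, abs_lt]; constructor <;> linarith
  · have := hαm hβ; linarith
  · intro x hx
    have h1 := hαm (mem_insert_of_mem c hx)
    have h2 := hβm (mem_insert_of_mem c hx)
    constructor <;> linarith

end IsTest

/-! ### The du Bois-Reymond lemma. -/

section DuBoisReymond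

variable {I : Set ℝ} {u g : ℝ → ℝ}

lemma setIntegral_eq_intervalIntegral_of_support {f : ℝ → ℝ} {a b : ℝ} (hab : a ≤ b)
    (hI : MeasurableSet I) (hs : Ioc a b ⊆ I) (hf : ∀ x ∉ Ioc a b, f x = 0) :
    ∫ x in I, f x = ∫ x in a..b, f x := by
  rw [intervalIntegral.integral_of_le hab]
  exact (setIntegral_eq_of_subset_of_forall_sdiff_eq_zero hI hs fun x hx => hf x hx.2)

lemma IsPrimitiveOn.setIntegral_mul_deriv (hI : IsOpen I) (hI' : OrdConnected I)
    (h : IsPrimitiveOn I u g) {φ : ℝ → ℝ} (hφ : IsTest φ) (hs : tsupport φ ⊆ I) {c : ℝ}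
    (hc : c ∈ I) : ∫ x in I, u x * deriv φ x = -∫ x in I, g x * φ x := by
  obtain ⟨a, ha, b, hb, hab, hsub⟩ := hφ.exists_interval hI hs hc
  have hsI : Ioc a b ⊆ I := Ioc_subset_Icc_self.trans (hI'.out ha hb)
  have hz : ∀ x ∉ Ioo a b, φ x = 0 := fun x hx =>
    image_eq_zero_of_notMem_tsupport fun hm => hx (hsub hm)
  have hz' : ∀ x ∉ Ioo a b, deriv φ x = 0 := fun x hx =>
    image_eq_zero_of_notMem_tsupport fun hm => hx (hsub (tsupport_deriv_subset hm))
  rw [setIntegral_eq_intervalIntegral_of_support hab.le hI.measurableSet hsI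
    (fun x hx => by rw [hz' x fun h => hx (Ioo_subset_Ioc_self h), mul_zero]),
    setIntegral_eq_intervalIntegral_of_support hab.le hI.measurableSet hsI
    (fun x hx => by rw [hz x fun h => hx (Ioo_subset_Ioc_self h), mul_zero])]
  obtain ⟨-, h2⟩ := h.mul hI' (hφ.isPrimitiveOn I) a ha b hb
  simp only at h2
  rw [hz a (by simp), hz b (by simp), intervalIntegral.integral_add] at h2
  · linarith
  · exact (h a ha b hb).1.mul_continuousOn hφ.continuous.continuousOn
  · exact hφ.deriv.continuous.continuousOn.intervalIntegrable.continuousOn_mul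
      (h.continuousOn hI' ha hb)

/-- The du Bois-Reymond lemma: weakly differentiable functions on an interval are primitives. -/
lemma exists_eq_add_integral_of_weak (hI : IsOpen I) (hI' : OrdConnected I) {c : ℝ} (hc : c ∈ I)
    (hu : LocallyIntegrableOn u I) (hg : LocallyIntegrableOn g I)
    (hw : ∀ φ : ℝ → ℝ, IsTest φ → tsupport φ ⊆ I →
      ∫ x in I, u x * deriv φ x = -∫ x in I, g x * φ x) :
    IsPrimitiveOn I (fun x => ∫ t in c..x, g t) g ∧
    ∃ C : ℝ, ∀ᵐ x ∂volume.restrict I, u x = C + ∫ t in c..x, g t := by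
  have hgi : ∀ a ∈ I, ∀ b ∈ I, IntervalIntegrable g volume a b := fun a ha b hb => by
    rw [intervalIntegrable_iff]
    exact (hg.integrableOn_compact_subset (hI'.uIcc_subset ha hb) isCompact_uIcc).mono_set
      uIoc_subset_uIcc
  have hU : IsPrimitiveOn I (fun x => ∫ t in c..x, g t) g := by
    simpa using IsPrimitiveOn.intervalIntegral_self hgi hc 0
  refine ⟨hU, ?_⟩
  set U : ℝ → ℝ := fun x => ∫ t in c..x, g t with hUdef
  have hUc : ContinuousOn U I := by
    intro x hx
    obtain ⟨ε, hε, hεI⟩ := Metric.isOpen_iff.1 hI x hx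
    have ha : x - ε / 2 ∈ I := hεI (by
      rw [Metric.mem_ball, Real.dist_eq, abs_lt]; constructor <;> linarith)
    have hb : x + ε / 2 ∈ I := hεI (by
      rw [Metric.mem_ball, Real.dist_eq, abs_lt]; constructor <;> linarith)
    refine ((hU.continuousOn hI' ha hb).continuousAt ?_).continuousWithinAt
    rw [uIcc_of_le (by linarith)]
    exact Icc_mem_nhds (by linarith) (by linarith)
  have hUl : LocallyIntegrableOn U I := hUc.locallyIntegrableOn hI.measurableSet
  have hW : LocallyIntegrableOn (fun x => u x - U x) I := hu.sub hUl
  have hint : ∀ {w φ : ℝ → ℝ}, LocallyIntegrableOn w I → IsTest φ → tsupport φ ⊆ I →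
      IntegrableOn (fun x => w x * φ x) I := by
    intro w φ hw hφ hs
    have hK : IntegrableOn (fun x => w x * φ x) (tsupport φ) :=
      (hw.integrableOn_compact_subset hs hφ.compact.isCompact).mul_continuousOn
        hφ.continuous.continuousOn hφ.compact.isCompact
    have : Integrable (fun x => w x * φ x) := by
      rw [← integrableOn_iff_integrable_of_support_subset (s := tsupport φ)]
      · exact hK
      · intro x hx
        exact subset_tsupport φ (right_ne_zero_of_mul hx)
    exact this.integrableOn
  have hWz : ∀ φ : ℝ → ℝ, IsTest φ → tsupport φ ⊆ I →
      ∫ x in I, (u x - U x) * deriv φ x = 0 := by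
    intro φ hφ hs
    have hs' : tsupport (deriv φ) ⊆ I := tsupport_deriv_subset.trans hs
    have h1 := hint hu hφ.deriv hs'
    have h2 := hint hUl hφ.deriv hs'
    simp only [sub_mul]
    rw [integral_sub h1 h2, hw φ hφ hs, hU.setIntegral_mul_deriv hI hI' hφ hs hc, sub_self]
  obtain ⟨ε, hε, hεI⟩ := Metric.isOpen_iff.1 hI c hc
  let χb : ContDiffBump c := ⟨ε / 4, ε / 2, by positivity, by linarith⟩
  set χ : ℝ → ℝ := χb.normed volume with hχ
  have hχt : IsTest χ := ⟨χb.contDiff_normed, χb.hasCompactSupport_normed⟩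
  have hχI : tsupport χ ⊆ I := by
    rw [hχ, χb.tsupport_normed_eq]
    exact (Metric.closedBall_subset_ball (by simp only [χb]; linarith)).trans hεI
  have hχ1 : ∫ x, χ x = 1 := χb.integral_normed
  refine ⟨∫ x in I, (u x - U x) * χ x, ?_⟩
  set C := ∫ x in I, (u x - U x) * χ x with hC
  -- A test function minus its integral times the bump χ has mean zero, hence is the derivative of a
  -- test function supported in `I`. So u - U integrates against φ like the constant C.
  have key : ∀ φ : ℝ → ℝ, IsTest φ → tsupport φ ⊆ I →
      ∫ x in I, (u x - U x) * φ x = C * ∫ x, φ x := by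
    intro φ hφ hs
    set ψ : ℝ → ℝ := fun x => φ x - (∫ y, φ y) * χ x with hψ
    have hψt : IsTest ψ :=
      ⟨hφ.contDiff.sub (contDiff_const.mul hχt.contDiff), hφ.compact.sub hχt.compact.mul_left⟩
    have hψI : tsupport ψ ⊆ I := by
      refine (tsupport_sub _ _).trans (union_subset hs ?_)
      exact (tsupport_mul_subset_right).trans hχI
    have hψ0 : ∫ x, ψ x = 0 := by
      rw [hψ, integral_sub hφ.integrable
        (hχt.integrable.const_mul _), integral_const_mul, hχ1]
      ring
    obtain ⟨a, ha, b, hb, hab, hsub⟩ := hψt.exists_interval hI hψI hc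
    have hz : ∀ x ∉ Ioo a b, ψ x = 0 := fun x hx =>
      image_eq_zero_of_notMem_tsupport fun hm => hx (hsub hm)
    set Φ : ℝ → ℝ := fun x => ∫ t in a..x, ψ t with hΦ
    have hΦd : ∀ x, HasDerivAt Φ (ψ x) x := fun x =>
      intervalIntegral.integral_hasDerivAt_right (hψt.continuous.intervalIntegrable _ _)
        (hψt.continuous.stronglyMeasurableAtFilter _ _) hψt.continuous.continuousAt
    have hΦz : ∀ x ∉ Icc a b, Φ x = 0 := by
      intro x hx
      rcases lt_or_ge x a with hxa | hxa
      · rw [hΦ]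
        refine intervalIntegral.integral_zero_ae (ae_of_all _ fun t ht => hz t fun hm => ?_)
        rw [uIoc_of_ge hxa.le] at ht
        exact absurd hm.1 (not_lt.2 ht.2)
      · have hbx : b < x := lt_of_not_ge fun h => hx ⟨hxa, h⟩
        have : ∫ t in a..x, ψ t = ∫ t, ψ t := by
          rw [intervalIntegral.integral_of_le hxa]
          refine setIntegral_eq_integral_of_forall_compl_eq_zero fun t ht => hz t fun hm => ht ?_
          exact ⟨hm.1, (hm.2.trans hbx).le⟩
        rw [hΦ]; simp only; rw [this, hψ0]
    have hΦsub : tsupport Φ ⊆ Icc a b :=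
      closure_minimal (fun x hx => by_contra fun h => hx (hΦz x h)) isClosed_Icc
    have hdΦ : deriv Φ = ψ := funext fun x => (hΦd x).deriv
    have hΦt : IsTest Φ := by
      refine ⟨contDiff_infty_iff_deriv.2 ⟨fun x => (hΦd x).differentiableAt, ?_⟩,
        HasCompactSupport.of_support_subset_isCompact isCompact_Icc
          ((subset_tsupport Φ).trans hΦsub)⟩
      rw [hdΦ]; exact hψt.contDiff
    have h0 := hWz Φ hΦt (hΦsub.trans (hI'.out ha hb))
    rw [hdΦ] at h0
    have e : ∀ x, (u x - U x) * ψ x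
        = (u x - U x) * φ x - (∫ y, φ y) * ((u x - U x) * χ x) := fun x => by
      simp only [hψ]; ring
    simp only [e] at h0
    rw [integral_sub (hint hW hφ hs) ((hint hW hχt hχI).const_mul _), integral_const_mul] at h0
    linarith
  have hfin : ∀ᵐ x ∂volume, x ∈ I → (u x - U x) - C = 0 := by
    refine hI.ae_eq_zero_of_integral_contDiff_smul_eq_zero
      (hW.sub (locallyIntegrableOn_const C)) ?_
    intro φ hφ hφc hs
    have ht : IsTest φ := ⟨hφ, hφc⟩
    have h1 := key φ ht hs
    have h2 : ∫ x, φ x • ((u x - U x) - C) = ∫ x in I, φ x • ((u x - U x) - C) := by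
      refine (setIntegral_eq_integral_of_forall_compl_eq_zero fun x hx => ?_).symm
      rw [image_eq_zero_of_notMem_tsupport fun hm => hx (hs hm), zero_smul]
    have h3 : ∫ x, φ x = ∫ x in I, φ x :=
      (setIntegral_eq_integral_of_forall_compl_eq_zero fun x hx =>
        image_eq_zero_of_notMem_tsupport fun hm => hx (hs hm)).symm
    rw [h2]
    have e : ∀ x, φ x • ((u x - U x) - C) = (u x - U x) * φ x - C * φ x := fun x => by
      simp only [smul_eq_mul]; ring
    simp only [e]
    rw [integral_sub (hint hW ht hs) (ht.integrable.integrableOn.const_mul _),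
      integral_const_mul, h1, h3, sub_self]
  rw [ae_restrict_iff' hI.measurableSet]
  filter_upwards [hfin] with x hx hxI
  have := hx hxI
  simp only [hUdef] at this
  linarith

end DuBoisReymond

end HarmonicMapFlow

/-! ### Hyperbolic functions and coercivity of the Pöschl–Teller form. -/

namespace HarmonicMapFlow

/-- `u ∈ H¹(ℝ)` is the primitive of `g`. -/
structure IsH1 (u g : ℝ → ℝ) : Prop where
  memLp : MemLp u 2 volume
  memLp_deriv : MemLp g 2 volume
  prim : IsPrimitiveOn univ u g

/-- The hyperbolic secant. -/
noncomputable def sech (x : ℝ) : ℝ := (Real.cosh x)⁻¹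

lemma sech_pos (x : ℝ) : 0 < sech x := inv_pos.2 (Real.cosh_pos x)

lemma sech_le_one (x : ℝ) : sech x ≤ 1 := inv_le_one_of_one_le₀ (Real.one_le_cosh x)

lemma sech_neg (x : ℝ) : sech (-x) = sech x := by simp [sech]

lemma sech_zero : sech 0 = 1 := by simp [sech]

@[fun_prop]
lemma continuous_sech : Continuous sech :=
  Real.continuous_cosh.inv₀ fun x => (Real.cosh_pos x).ne'

lemma sech_sq (x : ℝ) : sech x ^ 2 = 1 - Real.tanh x ^ 2 := by
  have h := Real.cosh_sq x
  have h' := (Real.cosh_pos x).ne'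
  rw [sech, Real.tanh_eq_sinh_div_cosh]
  field_simp
  linarith

@[fun_prop]
lemma continuous_tanh : Continuous Real.tanh := by
  have : Real.tanh = fun x => Real.sinh x / Real.cosh x := funext Real.tanh_eq_sinh_div_cosh
  rw [this]
  exact Real.continuous_sinh.div₀ Real.continuous_cosh fun x => (Real.cosh_pos x).ne'

lemma hasDerivAt_tanh (x : ℝ) : HasDerivAt Real.tanh (sech x ^ 2) x := by
  have : Real.tanh = fun x => Real.sinh x / Real.cosh x := funext Real.tanh_eq_sinh_div_cosh
  rw [this]
  convert! (Real.hasDerivAt_sinh x).div (Real.hasDerivAt_cosh x) (Real.cosh_pos x).ne' using 1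
  have h := Real.cosh_sq x
  have h' := (Real.cosh_pos x).ne'
  rw [sech]
  field_simp
  linarith

lemma hasDerivAt_sech (x : ℝ) : HasDerivAt sech (-(Real.tanh x * sech x)) x := by
  convert! (Real.hasDerivAt_cosh x).inv (Real.cosh_pos x).ne' using 1
  have h' := (Real.cosh_pos x).ne'
  rw [sech, Real.tanh_eq_sinh_div_cosh]
  field_simp

lemma sech_le_exp (x : ℝ) : sech x ≤ 2 * Real.exp (-x) := by
  rw [sech, Real.cosh_eq, inv_div, div_le_iff₀ (by positivity), mul_assoc, mul_add,
    ← Real.exp_add, ← Real.exp_add]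
  simp only [neg_add_cancel, Real.exp_zero]
  nlinarith [Real.exp_pos (-x + -x)]

lemma tanh_nonneg {x : ℝ} (hx : 0 ≤ x) : 0 ≤ Real.tanh x := by
  rw [Real.tanh_eq_sinh_div_cosh]
  exact div_nonneg (Real.sinh_nonneg_iff.2 hx) (Real.cosh_pos x).le

lemma tendsto_tanh_atTop : Tendsto Real.tanh atTop (𝓝 1) := by
  have h1 : Tendsto (fun x : ℝ => 1 - 2 * Real.exp (-x)) atTop (𝓝 (1 - 2 * 0)) :=
    (Real.tendsto_exp_neg_atTop_nhds_zero.const_mul 2).const_sub 1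
  rw [mul_zero, sub_zero] at h1
  refine tendsto_of_tendsto_of_tendsto_of_le_of_le' h1 tendsto_const_nhds ?_
    (Eventually.of_forall fun x => (Real.tanh_lt_one x).le)
  filter_upwards [eventually_ge_atTop (0 : ℝ)] with x hx
  have h2 := sech_sq x
  have h3 := sech_le_exp x
  have h4 := tanh_nonneg hx
  have h5 := Real.tanh_lt_one x
  have h6 := sech_pos x
  have h7 := sech_le_one x
  nlinarith

section Coercivity

variable {m : ℝ}

lemma hasDerivAt_tanh_mul (m x : ℝ) :
    HasDerivAt (fun x => Real.tanh (m * x)) (m * sech (m * x) ^ 2) x := by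
  convert! (hasDerivAt_tanh (m * x)).comp x ((hasDerivAt_id x).const_mul m) using 1
  simp; ring

lemma hasDerivAt_sech_mul (m x : ℝ) :
    HasDerivAt (fun x => sech (m * x)) (-(m * Real.tanh (m * x) * sech (m * x))) x := by
  convert! (hasDerivAt_sech (m * x)).comp x ((hasDerivAt_id x).const_mul m) using 1
  simp; ring

/-- With t = tanh(mx), the function a = 4m/(1 + 5t) satisfies the Riccati inequality 2amt - a² - a'
≥ (4/5) m², and the last summand is the excess. The bracket subtracted together with (4/5) m² w² is
the derivative of a w². -/
lemma completed_square_identity (m t w w₁ : ℝ) (ht : 1 + 5 * t ≠ 0) :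
    (w₁ + m * t * w) ^ 2 - (4 / 5 * m ^ 2 * w ^ 2 +
        (-(20 * m ^ 2 * (1 - t ^ 2)) / (1 + 5 * t) ^ 2 * (w * w)
          + 4 * m / (1 + 5 * t) * (w₁ * w + w * w₁)))
      = (w₁ + m * t * w - 4 * m / (1 + 5 * t) * w) ^ 2
          + 16 / 5 * m ^ 2 / (1 + 5 * t) ^ 2 * w ^ 2 := by
  obtain ⟨d, hd⟩ : ∃ d, d = 1 + 5 * t := ⟨_, rfl⟩
  rw [← hd] at ht ⊢
  obtain rfl : t = (d - 1) / 5 := by linarith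
  field_simp
  ring

/-- By `completed_square_identity` the integrands differ by (a w²)' plus nonnegative terms. The
boundary term vanishes at 0 because w does, and is nonnegative at N because a > 0 where tanh ≥ 0;
this is the reason for working on a half-line. -/
lemma half_line_bound (hm : 0 < m) {w w₁ : ℝ → ℝ} (hw : IsPrimitiveOn univ w w₁)
    (h0 : w 0 = 0) {N : ℝ} (hN : 0 ≤ N)
    (hi : IntervalIntegrable (fun x => (w₁ x + m * Real.tanh (m * x) * w x) ^ 2) volume 0 N) :
    4 / 5 * m ^ 2 * ∫ x in (0 : ℝ)..N, w x ^ 2 ≤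
      ∫ x in (0 : ℝ)..N, (w₁ x + m * Real.tanh (m * x) * w x) ^ 2 := by
  set a : ℝ → ℝ := fun x => 4 * m / (1 + 5 * Real.tanh (m * x)) with ha
  set a' : ℝ → ℝ := fun x => -(20 * m ^ 2 * sech (m * x) ^ 2) / (1 + 5 * Real.tanh (m * x)) ^ 2
    with ha'
  have hpos : ∀ x ∈ Icc 0 N, 0 < 1 + 5 * Real.tanh (m * x) := fun x hx => by
    have := tanh_nonneg (mul_nonneg hm.le hx.1)
    linarith
  have hct : Continuous fun x => Real.tanh (m * x) := continuous_tanh.comp (by fun_prop)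
  have hcs : Continuous fun x => sech (m * x) := continuous_sech.comp (by fun_prop)
  have hac : IsPrimitiveOn (Icc 0 N) a a' := by
    refine IsPrimitiveOn.of_hasDerivAt ordConnected_Icc (fun x hx => ?_) ?_
    · convert! (hasDerivAt_const x (4 * m)).div
        (((hasDerivAt_tanh_mul m x).const_mul 5).const_add 1) (hpos x hx).ne' using 1
      simp only [ha']; ring
    · refine ContinuousOn.div (Continuous.continuousOn (by fun_prop))
        (Continuous.continuousOn (by fun_prop)) fun x hx => ?_
      exact pow_ne_zero 2 (hpos x hx).ne'
  have hw' := hw.mono (subset_univ (Icc 0 N))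
  have hp := hac.mul ordConnected_Icc (hw'.mul ordConnected_Icc hw')
  obtain ⟨hi2, he⟩ := hp 0 ⟨le_rfl, hN⟩ N ⟨hN, le_rfl⟩
  simp only [h0, mul_zero, sub_zero] at he
  have hge : 0 ≤ a N * (w N * w N) :=
    mul_nonneg (div_nonneg (by positivity) (hpos N ⟨hN, le_rfl⟩).le) (mul_self_nonneg _)
  rw [he] at hge
  have hwc := hw.continuous
  have hi3 : IntervalIntegrable (fun x => 4 / 5 * m ^ 2 * w x ^ 2) volume 0 N :=
    Continuous.intervalIntegrable (by fun_prop) _ _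
  rw [← intervalIntegral.integral_const_mul]
  have hmono := intervalIntegral.integral_mono_on hN (hi3.add hi2) hi fun x hx => ?_
  · rw [intervalIntegral.integral_add hi3 hi2] at hmono
    linarith
  · have hp := (hpos x hx).ne'
    have ht := sech_sq (m * x)
    simp only [ha, ha']
    set t := Real.tanh (m * x)
    rw [ht]
    have key := completed_square_identity m t (w x) (w₁ x) hp
    have : 0 ≤ (w₁ x + m * t * w x - 4 * m / (1 + 5 * t) * w x) ^ 2
          + 16 / 5 * m ^ 2 / (1 + 5 * t) ^ 2 * w x ^ 2 := by positivity
    linarith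

lemma IsPrimitiveOn.comp_neg {u g : ℝ → ℝ} (h : IsPrimitiveOn univ u g) :
    IsPrimitiveOn univ (fun x => u (-x)) (fun x => -g (-x)) := by
  intro a _ b _
  obtain ⟨h1, h2⟩ := h (-a) (mem_univ _) (-b) (mem_univ _)
  refine ⟨by simpa using! ((IntervalIntegrable.iff_comp_neg (f := g)).1 h1).neg, ?_⟩
  rw [intervalIntegral.integral_neg, intervalIntegral.integral_comp_neg,
    intervalIntegral.integral_symm, neg_neg, h2]

lemma IsPrimitiveOn.comp_add_right {u g : ℝ → ℝ} (h : IsPrimitiveOn univ u g) (σ : ℝ) :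
    IsPrimitiveOn univ (fun x => u (x + σ)) (fun x => g (x + σ)) := by
  intro a _ b _
  obtain ⟨h1, h2⟩ := h (a + σ) (mem_univ _) (b + σ) (mem_univ _)
  refine ⟨by simpa using h1.comp_add_right σ, ?_⟩
  rw [intervalIntegral.integral_comp_add_right, h2]

namespace IsH1

variable {u g v k : ℝ → ℝ}

lemma continuous (h : IsH1 u g) : Continuous u := h.prim.continuous

lemma comp_add_right (h : IsH1 u g) (σ : ℝ) : IsH1 (fun x => u (x + σ)) (fun x => g (x + σ)) :=
  ⟨h.memLp.comp_measurePreserving (measurePreserving_add_right volume σ),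
    h.memLp_deriv.comp_measurePreserving (measurePreserving_add_right volume σ),
    h.prim.comp_add_right σ⟩

lemma const_mul (h : IsH1 u g) (c : ℝ) : IsH1 (fun x => c * u x) (fun x => c * g x) :=
  ⟨h.memLp.const_mul c, h.memLp_deriv.const_mul c, h.prim.const_mul c⟩

lemma sub (h : IsH1 u g) (h' : IsH1 v k) : IsH1 (fun x => u x - v x) (fun x => g x - k x) :=
  ⟨h.memLp.sub h'.memLp, h.memLp_deriv.sub h'.memLp_deriv, h.prim.sub h'.prim⟩

end IsH1

lemma MemLp.integrable_mul_two {f g : ℝ → ℝ} (hf : MemLp f 2 volume) (hg : MemLp g 2 volume) :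
    Integrable (fun x => f x * g x) := MemLp.integrable_mul hf hg

lemma memLp_tanh_mul {u : ℝ → ℝ} (hu : MemLp u 2 volume) (c d : ℝ) :
    MemLp (fun x => m * Real.tanh (c * (x - d)) * u x) 2 volume := by
  have hct : Continuous fun x => m * Real.tanh (c * (x - d)) :=
    continuous_const.mul (continuous_tanh.comp (by fun_prop))
  refine MemLp.of_le_mul (c := |m|) hu (hct.aestronglyMeasurable.mul hu.1) (ae_of_all _ fun x => ?_)
  simp only [Real.norm_eq_abs, abs_mul]
  gcongr
  have := (Real.abs_tanh_lt_one (c * (x - d))).le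
  nlinarith [abs_nonneg m]

/-- The square is invariant under the reflection x ↦ -x, since tanh and the derivative both change
sign. So the half-line bound applies on both sides of the zero of w. -/
lemma whole_line_bound (hm : 0 < m) {w w₁ : ℝ → ℝ} (hw : IsH1 w w₁) (h0 : w 0 = 0) :
    4 / 5 * m ^ 2 * ∫ x, w x ^ 2 ≤ ∫ x, (w₁ x + m * Real.tanh (m * x) * w x) ^ 2 := by
  have hL : MemLp (fun x => w₁ x + m * Real.tanh (m * x) * w x) 2 volume := by
    have := hw.memLp_deriv.add (memLp_tanh_mul (m := m) hw.memLp m 0)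
    simpa using! this
  have hi := hL.integrable_sq
  have hi' := hw.memLp.integrable_sq
  have t1 := intervalIntegral_tendsto_integral hi' tendsto_neg_atTop_atBot
      (tendsto_id : Tendsto (fun x : ℝ => x) atTop atTop)
  have t2 := intervalIntegral_tendsto_integral hi tendsto_neg_atTop_atBot
      (tendsto_id : Tendsto (fun x : ℝ => x) atTop atTop)
  refine le_of_tendsto_of_tendsto (t1.const_mul (4 / 5 * m ^ 2)) t2 ?_
  filter_upwards [eventually_ge_atTop (0 : ℝ)] with N hN
  simp only [id]
  have hn : ∀ {f : ℝ → ℝ}, Integrable f →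
      ∫ x in (-N)..N, f x = (∫ x in (0 : ℝ)..N, f (-x)) + ∫ x in (0 : ℝ)..N, f x := by
    intro f hf
    rw [intervalIntegral.integral_comp_neg, neg_zero,
      intervalIntegral.integral_add_adjacent_intervals hf.intervalIntegrable hf.intervalIntegrable]
  rw [hn hi, hn hi', mul_add]
  refine add_le_add ?_ (half_line_bound hm hw.prim h0 hN hi.intervalIntegrable)
  have e : ∀ x, (w₁ (-x) + m * Real.tanh (m * -x) * w (-x)) ^ 2
      = (-w₁ (-x) + m * Real.tanh (m * x) * w (-x)) ^ 2 := fun x => by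
    rw [mul_neg, Real.tanh_neg]; ring
  simp only [e]
  refine half_line_bound hm hw.prim.comp_neg (by simpa using h0) hN ?_
  have := hi.comp_neg.intervalIntegrable (a := 0) (b := N)
  simpa only [e] using this

lemma integrable_exp_mul_sech_sq (m : ℝ) {c : ℝ} (hc : |c| < 2 * m) :
    Integrable fun x => Real.exp (c * x) * sech (m * x) ^ 2 := by
  have hcs : Continuous fun x => sech (m * x) := continuous_sech.comp (by fun_prop)
  have hb : ∀ x, sech (m * x) ^ 2 ≤ 4 * Real.exp (-(2 * m) * x) := fun x => by
    have h1 := sech_le_exp (m * x)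
    have h2 := sech_pos (m * x)
    have : Real.exp (-(2 * m) * x) = Real.exp (-(m * x)) ^ 2 := by
      rw [← Real.exp_nat_mul]; congr 1; push_cast; ring
    rw [this]; nlinarith
  have hb' : ∀ x, sech (m * x) ^ 2 ≤ 4 * Real.exp ((2 * m) * x) := fun x => by
    have := hb (-x)
    rw [mul_neg, sech_neg] at this
    convert this using 3; ring
  obtain ⟨h2, h3⟩ := abs_lt.1 hc
  rw [← integrableOn_univ, ← Iic_union_Ioi (a := (0 : ℝ))]
  refine IntegrableOn.union ?_ ?_
  · refine Integrable.mono' ((integrableOn_exp_mul_Iic (a := c + 2 * m) (by linarith) 0).const_mul 4)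
      (Continuous.aestronglyMeasurable (by fun_prop)) (ae_of_all _ fun x => ?_)
    rw [Real.norm_of_nonneg (by positivity), add_mul, Real.exp_add]
    have := mul_le_mul_of_nonneg_left (hb' x) (Real.exp_pos (c * x)).le
    linarith
  · refine Integrable.mono' ((integrableOn_exp_mul_Ioi (a := c - 2 * m) (by linarith) 0).const_mul 4)
      (Continuous.aestronglyMeasurable (by fun_prop)) (ae_of_all _ fun x => ?_)
    rw [Real.norm_of_nonneg (by positivity), sub_eq_add_neg, add_mul, Real.exp_add]
    have := mul_le_mul_of_nonneg_left (hb x) (Real.exp_pos (c * x)).le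
    linarith

lemma integral_sech_sq (hm : 0 < m) : ∫ x, sech (m * x) ^ 2 = 2 / m := by
  have hi : Integrable fun x => sech (m * x) ^ 2 := by
    simpa using integrable_exp_mul_sech_sq m (c := 0) (by simpa using hm)
  have hd : ∀ x, HasDerivAt (fun x => Real.tanh (m * x) / m) (sech (m * x) ^ 2) x := fun x => by
    convert! (hasDerivAt_tanh_mul m x).div_const m using 1
    field_simp
  have ht : Tendsto (fun x => Real.tanh (m * x) / m) atTop (𝓝 (1 / m)) :=
    (tendsto_tanh_atTop.comp (tendsto_id.const_mul_atTop hm)).div_const m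
  have hb : Tendsto (fun x => Real.tanh (m * x) / m) atBot (𝓝 (-(1 / m))) := by
    have := (ht.comp tendsto_neg_atBot_atTop).neg
    refine this.congr fun x => ?_
    simp only [Function.comp, mul_neg, Real.tanh_neg]
    ring
  rw [integral_of_hasDerivAt_of_tendsto hd hi hb ht]
  ring

/-- Since sech² is even, e^{3x} may be replaced by cosh 3x ≥ 1. This bounds from below the overlap
of the ground state with the weight that appears in the orthogonality condition. -/
lemma integral_exp_three_sech_sq_ge (hm : 4 ≤ m) :
    2 / m ≤ ∫ x, Real.exp (3 * x) * sech (m * x) ^ 2 := by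
  have hm0 : 0 < m := by linarith
  have hi := integrable_exp_mul_sech_sq m (c := 3) (by rw [abs_of_pos] <;> linarith)
  have hi0 : Integrable fun x => sech (m * x) ^ 2 := by
    simpa using integrable_exp_mul_sech_sq m (c := 0) (by simpa using hm0)
  have h1 : ∫ x, Real.exp (3 * -x) * sech (m * -x) ^ 2
      = ∫ x, Real.exp (3 * x) * sech (m * x) ^ 2 :=
    integral_neg_eq_self (fun x => Real.exp (3 * x) * sech (m * x) ^ 2) volume
  have h2 : ∫ x, 2 * sech (m * x) ^ 2 ≤ ∫ x, (Real.exp (3 * x) * sech (m * x) ^ 2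
      + Real.exp (3 * -x) * sech (m * -x) ^ 2) := by
    refine integral_mono (hi0.const_mul 2) (hi.add hi.comp_neg) fun x => ?_
    simp only [mul_neg, sech_neg]
    have := Real.one_le_cosh (3 * x)
    rw [Real.cosh_eq] at this
    nlinarith [sq_nonneg (sech (m * x))]
  rw [integral_const_mul, integral_add hi hi.comp_neg, h1, integral_sech_sq hm0] at h2
  linarith

/-- Fold the integral onto x > 0, where sech²(mx) ≤ 4 e^{-2mx}, e^{-6x} ≤ 1 and e^{6x} ≤ e^{3mx/2}
because m ≥ 4. The two exponentials give 4(2/m + 1/(2m)) = 10/m. -/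
lemma integral_exp_six_sech_sq_le (hm : 4 ≤ m) :
    ∫ x, Real.exp (6 * x) * sech (m * x) ^ 2 ≤ 10 / m := by
  have hm0 : 0 < m := by linarith
  have hi := integrable_exp_mul_sech_sq m (c := 6) (by rw [abs_of_pos] <;> linarith)
  set F : ℝ → ℝ := fun x => Real.exp (6 * x) * sech (m * x) ^ 2 with hF
  have hsplit : ∫ x, F x = ∫ x in Ioi 0, (F (-x) + F x) := by
    have e : ∫ x in Ioi (0 : ℝ), F (-x) = ∫ x in Iic 0, F x := by
      have := integral_comp_neg_Ioi 0 F
      rwa [neg_zero] at this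
    rw [integral_add hi.comp_neg.integrableOn hi.integrableOn, e,
      ← setIntegral_union (Iic_disjoint_Ioi le_rfl) measurableSet_Ioi hi.integrableOn
      hi.integrableOn, Iic_union_Ioi, setIntegral_univ]
  have j1 := integrableOn_exp_mul_Ioi (a := -(m / 2)) (by linarith) 0
  have j2 := integrableOn_exp_mul_Ioi (a := -(2 * m)) (by linarith) 0
  rw [hsplit]
  have hle : ∫ x in Ioi 0, (F (-x) + F x) ≤
      ∫ x in Ioi (0 : ℝ), 4 * (Real.exp (-(m / 2) * x) + Real.exp (-(2 * m) * x)) := by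
    refine setIntegral_mono_on (hi.comp_neg.add hi).integrableOn ((j1.add j2).const_mul 4)
      measurableSet_Ioi fun x hx => ?_
    have hx : 0 < x := hx
    simp only [hF, mul_neg, sech_neg]
    have a1 : sech (m * x) ^ 2 ≤ 4 * Real.exp (-(2 * m) * x) := by
      have h1 := sech_le_exp (m * x)
      have h2 := sech_pos (m * x)
      have : Real.exp (-(2 * m) * x) = Real.exp (-(m * x)) ^ 2 := by
        rw [← Real.exp_nat_mul]; congr 1; push_cast; ring
      rw [this]; nlinarith
    have a2 : Real.exp (-(6 * x)) ≤ 1 := Real.exp_le_one_iff.2 (by linarith)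
    have a3 : Real.exp (6 * x) ≤ Real.exp (3 / 2 * m * x) :=
      Real.exp_le_exp.2 (by nlinarith)
    have a4 : Real.exp (-(m / 2) * x) = Real.exp (3 / 2 * m * x) * Real.exp (-(2 * m) * x) := by
      rw [← Real.exp_add]; congr 1; ring
    rw [a4]
    have a5 : Real.exp (-(6 * x)) + Real.exp (6 * x) ≤ 1 + Real.exp (3 / 2 * m * x) := by linarith
    have a6 := mul_le_mul a5 a1 (sq_nonneg _) (by positivity)
    linarith
  refine hle.trans ?_
  rw [integral_const_mul, integral_add j1 j2, integral_exp_mul_Ioi (by linarith),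
    integral_exp_mul_Ioi (by linarith)]
  simp only [mul_zero, Real.exp_zero]
  have : 4 * (-1 / -(m / 2) + -1 / -(2 * m)) = 10 / m := by field_simp; norm_num
  linarith

lemma sq_integral_mul_le {f g : ℝ → ℝ} (hf : MemLp f 2 volume) (hg : MemLp g 2 volume) :
    (∫ x, f x * g x) ^ 2 ≤ (∫ x, f x ^ 2) * ∫ x, g x ^ 2 := by
  have h1 := hf.integrable_sq
  have h2 := hg.integrable_sq
  have h3 := MemLp.integrable_mul_two hf hg
  have hq : ∀ t : ℝ, 0 ≤ (∫ x, f x ^ 2) * (t * t) + (2 * ∫ x, f x * g x) * t + ∫ x, g x ^ 2 := by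
    intro t
    have : ∫ x, (t * f x + g x) ^ 2 = (∫ x, f x ^ 2) * (t * t) + (2 * ∫ x, f x * g x) * t
        + ∫ x, g x ^ 2 := by
      have e : ∀ x, (t * f x + g x) ^ 2 = t * t * f x ^ 2 + 2 * t * (f x * g x) + g x ^ 2 :=
        fun x => by ring
      simp only [e]
      have h4 : Integrable fun x => t * t * f x ^ 2 + 2 * t * (f x * g x) :=
        (h1.const_mul _).add (h3.const_mul _)
      rw [integral_add h4 h2, integral_add (h1.const_mul _) (h3.const_mul _), integral_const_mul,
        integral_const_mul]
      ring
    rw [← this]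
    exact integral_nonneg fun x => sq_nonneg _
  have := discrim_le_zero hq
  rw [discrim] at this
  nlinarith

lemma isH1_sech (hm : 0 < m) :
    IsH1 (fun x => sech (m * x)) (fun x => -(m * Real.tanh (m * x) * sech (m * x))) := by
  have hcs : Continuous fun x => sech (m * x) := continuous_sech.comp (by fun_prop)
  have hct : Continuous fun x => Real.tanh (m * x) := continuous_tanh.comp (by fun_prop)
  have hk : MemLp (fun x => sech (m * x)) 2 volume := by
    rw [memLp_two_iff_integrable_sq hcs.aestronglyMeasurable]
    simpa using integrable_exp_mul_sech_sq m (c := 0) (by simpa using hm)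
  refine ⟨hk, ?_, ?_⟩
  · have := (memLp_tanh_mul (m := m) hk m 0).neg
    simpa using! this
  · exact IsPrimitiveOn.of_hasDerivAt ordConnected_univ (fun x _ => hasDerivAt_sech_mul m x)
      (Continuous.continuousOn (by fun_prop))

lemma memLp_exp_sech (hm : 4 ≤ m) :
    MemLp (fun x => Real.exp (3 * x) * sech (m * x)) 2 volume := by
  have hcs : Continuous fun x => sech (m * x) := continuous_sech.comp (by fun_prop)
  rw [memLp_two_iff_integrable_sq (Continuous.aestronglyMeasurable (by fun_prop))]
  refine (integrable_exp_mul_sech_sq m (c := 6)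
    (by rw [abs_of_pos] <;> linarith)).congr (ae_of_all _ fun x => ?_)
  simp only [mul_pow, ← Real.exp_nat_mul]
  congr 2; push_cast; ring

/-- Coercivity of the linearized energy on almost orthogonal functions. -/
lemma coercivity_centered (hm : 4 ≤ m) {η η₁ : ℝ → ℝ} (hη : IsH1 η η₁) :
    8 * ∫ x, η x ^ 2 ≤ 7 * (∫ x, (η₁ x + m * Real.tanh (m * x) * η x) ^ 2)
      + 64 * m * (∫ x, η x * (Real.exp (3 * x) * sech (m * x))) ^ 2 := by
  have hm0 : 0 < m := by linarith
  set c := η 0 with hc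
  set b := ∫ x, η x * (Real.exp (3 * x) * sech (m * x)) with hb
  have hk := isH1_sech hm0
  have hψ := memLp_exp_sech hm
  -- The function sech(mx) is annihilated by the first-order operator, so subtracting η(0) sech(mx)
  -- makes the function vanish at 0 without changing the form.
  have hw := hη.sub (hk.const_mul c)
  set w : ℝ → ℝ := fun x => η x - c * sech (m * x) with hwdef
  have e1 : ∀ x, (η₁ x - c * -(m * Real.tanh (m * x) * sech (m * x)) + m * Real.tanh (m * x) * w x)
      = η₁ x + m * Real.tanh (m * x) * η x := fun x => by simp only [hwdef]; ring
  have hw0 : 4 / 5 * m ^ 2 * ∫ x, w x ^ 2 ≤ ∫ x, (η₁ x + m * Real.tanh (m * x) * η x) ^ 2 := by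
    have := whole_line_bound hm0 hw (by simp [hwdef, sech_zero, hc])
    beta_reduce at this
    simpa only [e1] using this
  set W := ∫ x, w x ^ 2 with hW
  have hWnn : 0 ≤ W := integral_nonneg fun x => sq_nonneg _
  set P := ∫ x, Real.exp (3 * x) * sech (m * x) ^ 2 with hP
  set S := ∫ x, (Real.exp (3 * x) * sech (m * x)) ^ 2 with hS
  have hPge := integral_exp_three_sech_sq_ge hm
  rw [← hP] at hPge
  have hSle : S ≤ 10 / m := by
    refine le_trans (le_of_eq ?_) (integral_exp_six_sech_sq_le hm)
    rw [hS]
    refine integral_congr_ae (ae_of_all _ fun x => ?_)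
    simp only [mul_pow, ← Real.exp_nat_mul]
    congr 2; push_cast; ring
  have hint : ∫ x, w x * (Real.exp (3 * x) * sech (m * x)) = b - c * P := by
    have i1 := MemLp.integrable_mul_two hη.memLp hψ
    have i2 := (MemLp.integrable_mul_two hk.memLp hψ).const_mul c
    rw [hb, hP, ← integral_const_mul]
    rw [← integral_sub i1]
    · refine integral_congr_ae (ae_of_all _ fun x => ?_)
      simp only [hwdef]; ring
    · refine i2.congr (ae_of_all _ fun x => ?_)
      simp only; ring
  have hcs := sq_integral_mul_le hw.memLp hψ
  rw [hint] at hcs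
  have hcs' : (b - c * P) ^ 2 ≤ W * (10 / m) :=
    hcs.trans (mul_le_mul_of_nonneg_left hSle hWnn)
  -- Young's inequality with weight 10, which gives the factors 1 + 10 and 1 + 1/10. The
  -- Cauchy–Schwarz bound for (b - cP)² is inserted.
  have hcP : (c * P) ^ 2 ≤ 11 * b ^ 2 + 11 / 10 * (W * (10 / m)) := by
    nlinarith [sq_nonneg (10 * b + (b - c * P))]
  have hcm : c ^ 2 * (2 / m) ≤ 11 / 2 * m * b ^ 2 + 11 / 2 * W := by
    have h2 : (2 / m) ^ 2 ≤ P ^ 2 := by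
      have : 0 < 2 / m := by positivity
      nlinarith
    have h3 : c ^ 2 * (2 / m) ^ 2 ≤ 11 * b ^ 2 + 11 / 10 * (W * (10 / m)) := by
      refine le_trans ?_ hcP
      rw [mul_pow]
      exact mul_le_mul_of_nonneg_left h2 (sq_nonneg c)
    have h4 := mul_le_mul_of_nonneg_left h3 (by positivity : 0 ≤ m / 2)
    calc c ^ 2 * (2 / m) = m / 2 * (c ^ 2 * (2 / m) ^ 2) := by field_simp
      _ ≤ _ := h4
      _ = _ := by field_simp
  -- Young's inequality with weight 9/20, which gives the factors 1 + 9/20 and 1 + 20/9.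
  have hη2 : ∫ x, η x ^ 2 ≤ 29 / 20 * (c ^ 2 * (2 / m)) + 29 / 9 * W := by
    rw [← integral_sech_sq hm0, hW, ← integral_const_mul, ← integral_const_mul,
      ← integral_const_mul, ← integral_add]
    · refine integral_mono hη.memLp.integrable_sq
        (((hk.memLp.integrable_sq.const_mul _).const_mul _).add
          (hw.memLp.integrable_sq.const_mul _)) fun x => ?_
      simp only [hwdef]
      nlinarith [sq_nonneg (9 * (c * sech (m * x)) - 20 * (η x - c * sech (m * x)))]
    · exact (hk.memLp.integrable_sq.const_mul _).const_mul _
    · exact hw.memLp.integrable_sq.const_mul _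
  have hmm : 64 / 5 * W ≤ 4 / 5 * m ^ 2 * W := by
    have : (16 : ℝ) ≤ m ^ 2 := by nlinarith
    nlinarith
  -- The fit is tight at m = 4: the coefficient of W is 8(29/20 · 11/2 + 29/9) ≈ 89.58 against 7 ·
  -- 64/5 = 89.6, and that of m b² is 63.8 against 64.
  nlinarith [mul_nonneg hm0.le (sq_nonneg b)]

/-- Expand the square: the cross term is the derivative of m tanh η², up to -m² sech² η², and tanh²
= 1 - sech² gives the other half of the potential. -/
lemma IsH1.integral_sq_eq {η η₁ : ℝ → ℝ} (hη : IsH1 η η₁) (m σ : ℝ) :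
    ∫ x, (η₁ x + m * Real.tanh (m * (x - σ)) * η x) ^ 2
      = ∫ x, (η₁ x ^ 2 + m ^ 2 * η x ^ 2 - 2 * m ^ 2 * (sech (m * (x - σ)) ^ 2 * η x ^ 2)) := by
  have hcs : Continuous fun x => sech (m * (x - σ)) := continuous_sech.comp (by fun_prop)
  have hct : Continuous fun x => Real.tanh (m * (x - σ)) := continuous_tanh.comp (by fun_prop)
  set T : ℝ → ℝ := fun x => Real.tanh (m * (x - σ)) with hT
  have hTp : IsPrimitiveOn univ T (fun x => m * sech (m * (x - σ)) ^ 2) := by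
    refine IsPrimitiveOn.of_hasDerivAt ordConnected_univ (fun x _ => ?_)
      (Continuous.continuousOn (by fun_prop))
    convert! (hasDerivAt_tanh_mul m (x - σ)).comp_sub_const x σ using 1
  have hp := (hTp.mul ordConnected_univ (hη.prim.mul ordConnected_univ hη.prim)).const_mul m
  have hTb : ∀ x, |T x| ≤ 1 := fun x => (Real.abs_tanh_lt_one _).le
  have hTm : AEStronglyMeasurable T volume := hct.aestronglyMeasurable
  have i2 := hη.memLp.integrable_sq
  have i3 := hη.memLp_deriv.integrable_sq
  have i4 := MemLp.integrable_mul_two hη.memLp hη.memLp_deriv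
  have i5 : Integrable fun x => sech (m * (x - σ)) ^ 2 * η x ^ 2 := by
    refine i2.bdd_mul (c := 1) (Continuous.aestronglyMeasurable (by fun_prop))
      (ae_of_all _ fun x => ?_)
    rw [Real.norm_of_nonneg (by positivity)]
    exact pow_le_one₀ (sech_pos _).le (sech_le_one _)
  have j1 : Integrable fun x => m * (T x * (η x * η x)) := by
    refine Integrable.const_mul (i2.bdd_mul (c := 1) hTm (ae_of_all _ hTb) |>.congr
      (ae_of_all _ fun x => ?_)) m
    simp only; ring
  have j2 : Integrable fun x => T x * (η x * η₁ x) := i4.bdd_mul (c := 1) hTm (ae_of_all _ hTb)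
  have j3 : Integrable fun x => m * (m * sech (m * (x - σ)) ^ 2 * (η x * η x)
      + T x * (η₁ x * η x + η x * η₁ x)) := by
    refine ((i5.const_mul (m ^ 2)).add (j2.const_mul (2 * m))).congr (ae_of_all _ fun x => ?_)
    simp only [Pi.add_apply]; ring
  have h0 := hp.integral_eq_zero j1 j3
  rw [← sub_eq_zero, ← integral_sub]
  · rw [← h0]
    refine integral_congr_ae (ae_of_all _ fun x => ?_)
    have := sech_sq (m * (x - σ))
    simp only [hT]
    rw [this]
    ring
  · have := (hη.memLp_deriv.add (memLp_tanh_mul (m := m) hη.memLp m σ)).integrable_sq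
    simpa using this
  · exact (i3.add (i2.const_mul _)).sub (i5.const_mul _)

/-- Coercivity at the scale `exp σ`, with the defect of orthogonality to `h`. -/
lemma coercivity (hm : 4 ≤ m) {η η₁ : ℝ → ℝ} (hη : IsH1 η η₁) (σ : ℝ) :
    8 * ∫ x, η x ^ 2 ≤
      7 * (∫ x, (η₁ x ^ 2 + m ^ 2 * η x ^ 2 - 2 * m ^ 2 * (sech (m * (x - σ)) ^ 2 * η x ^ 2)))
      + 64 * m * (Real.exp (-3 * σ)
        * ∫ x, η x * (Real.exp (3 * x) * sech (m * (x - σ)))) ^ 2 := by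
  have h := coercivity_centered hm (hη.comp_add_right σ)
  rw [← hη.integral_sq_eq m σ]
  have e1 : ∫ x, η (x + σ) ^ 2 = ∫ x, η x ^ 2 := integral_add_right_eq_self (fun x => η x ^ 2) σ
  have e2 : ∫ x, (η₁ (x + σ) + m * Real.tanh (m * x) * η (x + σ)) ^ 2
      = ∫ x, (η₁ x + m * Real.tanh (m * (x - σ)) * η x) ^ 2 := by
    rw [← integral_add_right_eq_self
      (fun x => (η₁ x + m * Real.tanh (m * (x - σ)) * η x) ^ 2) σ]
    simp only [add_sub_cancel_right]
  have e3 : ∫ x, η (x + σ) * (Real.exp (3 * x) * sech (m * x))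
      = Real.exp (-3 * σ) * ∫ x, η x * (Real.exp (3 * x) * sech (m * (x - σ))) := by
    rw [← integral_add_right_eq_self
      (fun x => η x * (Real.exp (3 * x) * sech (m * (x - σ)))) σ, ← integral_const_mul]
    refine integral_congr_ae (ae_of_all _ fun x => ?_)
    simp only [add_sub_cancel_right]
    have : Real.exp (3 * x) = Real.exp (-3 * σ) * Real.exp (3 * (x + σ)) := by
      rw [← Real.exp_add]; congr 1; ring
    rw [this]; ring
  rwa [e1, e2, e3] at h

end Coercivity

end HarmonicMapFlow

/-! ### Weighted elliptic estimates on the line. -/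

namespace HarmonicMapFlow

/-- Fatou's lemma, in the form used to remove the cutoff parameter from weighted estimates. -/
lemma integrable_of_tendsto_of_integral_le {F : ℕ → ℝ → ℝ} {f : ℝ → ℝ} {K : ℝ}
    (hF : ∀ n, Integrable (F n)) (h0 : ∀ n x, 0 ≤ F n x)
    (ht : ∀ x, Tendsto (fun n => F n x) atTop (𝓝 (f x))) (hK : ∀ n, ∫ x, F n x ≤ K) :
    Integrable f ∧ ∫ x, f x ≤ K := by
  have hm : AEStronglyMeasurable f volume :=
    aestronglyMeasurable_of_tendsto_ae atTop (fun n => (hF n).1) (ae_of_all _ ht)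
  have hf0 : ∀ x, 0 ≤ f x := fun x => ge_of_tendsto' (ht x) fun n => h0 n x
  have hK0 : 0 ≤ K := (integral_nonneg (h0 0)).trans (hK 0)
  have hle : ∫⁻ x, ENNReal.ofReal (f x) ≤ ENNReal.ofReal K := by
    calc ∫⁻ x, ENNReal.ofReal (f x)
        = ∫⁻ x, liminf (fun n => ENNReal.ofReal (F n x)) atTop := by
          refine lintegral_congr fun x => ?_
          exact ((ENNReal.continuous_ofReal.tendsto _).comp (ht x)).liminf_eq.symm
      _ ≤ liminf (fun n => ∫⁻ x, ENNReal.ofReal (F n x)) atTop :=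
          lintegral_liminf_le' fun n => (hF n).1.aemeasurable.ennreal_ofReal
      _ ≤ ENNReal.ofReal K := by
          refine (liminf_le_liminf (v := fun _ => ENNReal.ofReal K)
            (Eventually.of_forall fun n => ?_)).trans (by simp)
          rw [← ofReal_integral_eq_lintegral_ofReal (hF n) (ae_of_all _ (h0 n))]
          exact ENNReal.ofReal_le_ofReal (hK n)
  have hi : Integrable f := by
    refine ⟨hm, ?_⟩
    rw [hasFiniteIntegral_iff_ofReal (ae_of_all _ hf0)]
    exact hle.trans_lt ENNReal.ofReal_lt_top
  refine ⟨hi, ?_⟩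
  rw [← ofReal_integral_eq_lintegral_ofReal hi (ae_of_all _ hf0)] at hle
  exact (ENNReal.ofReal_le_ofReal_iff hK0).1 hle

/-- Allows twice a tested equation, whose integral is zero, to be added to an integrand before a
pointwise comparison. -/
lemma integral_add_two_mul_of_eq_zero {f g : ℝ → ℝ} (h0 : ∫ x, g x = 0) (hf : Integrable f)
    (hg : Integrable g) : ∫ x, (f x + 2 * g x) = ∫ x, f x := by
  rw [integral_add hf (hg.const_mul 2), integral_const_mul, h0, mul_zero, add_zero]

lemma memLp_bdd_mul {f c : ℝ → ℝ} (hf : MemLp f 2 volume) (hc : Continuous c) {B : ℝ}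
    (hB : ∀ x, |c x| ≤ B) : MemLp (fun x => c x * f x) 2 volume := by
  refine MemLp.of_le_mul (c := B) hf (hc.aestronglyMeasurable.mul hf.1) (ae_of_all _ fun x => ?_)
  simp only [Real.norm_eq_abs, abs_mul]
  exact mul_le_mul_of_nonneg_right (hB x) (abs_nonneg _)

/-- Since 2|u u'| ≤ u² + u'², the oscillation of u² is at most K, the right-hand side. If u(x)²
exceeded K, then u² would be bounded below by a positive constant and could not be integrable. -/
lemma IsH1.sq_le {u g : ℝ → ℝ} (h : IsH1 u g) (x : ℝ) :
    u x ^ 2 ≤ (∫ y, u y ^ 2) + ∫ y, g y ^ 2 := by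
  by_contra hlt
  push Not at hlt
  set K := (∫ y, u y ^ 2) + ∫ y, g y ^ 2 with hK
  have i1 := h.memLp.integrable_sq
  have i2 := h.memLp_deriv.integrable_sq
  have i3 := MemLp.integrable_mul_two h.memLp h.memLp_deriv
  have hp := h.prim.mul ordConnected_univ h.prim
  have hlow : ∀ a, u x ^ 2 - K ≤ u a ^ 2 := by
    intro a
    obtain ⟨j1, j2⟩ := hp a (mem_univ _) x (mem_univ _)
    have : |∫ t in a..x, (g t * u t + u t * g t)| ≤ K := by
      rw [hK, ← integral_add i1 i2]
      rw [← Real.norm_eq_abs]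
      refine intervalIntegral.norm_integral_le_integral_norm_uIoc.trans ?_
      refine (setIntegral_mono_on (g := fun y => u y ^ 2 + g y ^ 2) j1.def'.norm
        (i1.add i2).integrableOn measurableSet_uIoc fun y _ => ?_).trans
        (setIntegral_le_integral (i1.add i2) (ae_of_all _ fun y => ?_))
      · rw [Real.norm_eq_abs, abs_le]
        constructor <;> nlinarith [sq_nonneg (u y - g y), sq_nonneg (u y + g y)]
      · simp only [Pi.zero_apply]; positivity
    have := (abs_le.1 this).2
    rw [← j2] at this
    nlinarith
  have : Integrable (fun _ : ℝ => u x ^ 2 - K) := by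
    refine i1.mono' aestronglyMeasurable_const (ae_of_all _ fun a => ?_)
    rw [Real.norm_of_nonneg (by linarith)]
    exact hlow a
  rw [integrable_const_iff] at this
  rcases this with h1 | h1
  · linarith
  · exact absurd h1.1 (by simp)

lemma IsPrimitiveOn.integral_parts {u₁ g φ φ₁ : ℝ → ℝ} (hu₁ : MemLp u₁ 2 volume)
    (hp : IsPrimitiveOn univ u₁ g) (hφ : IsH1 φ φ₁) (hi : Integrable fun x => g x * φ x) :
    ∫ x, u₁ x * φ₁ x = -∫ x, g x * φ x := by
  have h1 := MemLp.integrable_mul_two hu₁ hφ.memLp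
  have h2 := MemLp.integrable_mul_two hu₁ hφ.memLp_deriv
  have := (hp.mul ordConnected_univ hφ.prim).integral_eq_zero h1 (hi.add h2)
  rw [integral_add hi h2] at this
  linarith

section Spatial

variable {m : ℝ} {u u₁ v v₁ G w : ℝ → ℝ}

lemma IsH1.cutoff_mul (h : IsH1 u u₁) {c c' : ℝ → ℝ} (hc : ∀ x, HasDerivAt c (c' x) x)
    (hc' : Continuous c') {B : ℝ} (hB : ∀ x, |c x| ≤ B) (hB' : ∀ x, |c' x| ≤ B) :
    IsH1 (fun x => c x * u x) (fun x => c' x * u x + c x * u₁ x) := by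
  have hcc : Continuous c := continuous_iff_continuousAt.2 fun x => (hc x).continuousAt
  exact ⟨memLp_bdd_mul h.memLp hcc hB,
    (memLp_bdd_mul h.memLp hc' hB').add (memLp_bdd_mul h.memLp_deriv hcc hB),
    (IsPrimitiveOn.of_hasDerivAt ordConnected_univ (fun x _ => hc x) hc'.continuousOn).mul
      ordConnected_univ h.prim⟩

lemma hasDerivAt_exp_two (x : ℝ) : HasDerivAt (fun x => Real.exp (2 * x)) (2 * Real.exp (2 * x)) x := by
  convert! ((hasDerivAt_id x).const_mul 2).exp using 1
  simp; ring

lemma exp_two_mul (x : ℝ) : Real.exp (2 * x) = Real.exp x ^ 2 := by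
  rw [← Real.exp_nat_mul]; norm_num

/-- The forcing inherits the weighted square integrability from the weak equation. -/
lemma memLp_exp_mul_of_weak (hu : IsH1 u u₁) (hv : IsH1 v v₁) (hG : MemLp G 2 volume)
    (hp : IsPrimitiveOn univ u₁
      (fun x => m ^ 2 * u x - (Real.exp (2 * x) * v x + Real.exp x * G x))) :
    MemLp (fun x => Real.exp x * v x) 2 volume := by
  have iu := hu.memLp.integrable_sq
  have iv := hv.memLp.integrable_sq
  have iu₁ := hu.memLp_deriv.integrable_sq
  have iv₁ := hv.memLp_deriv.integrable_sq
  have iG := hG.integrable_sq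
  have hvc := hv.continuous
  set B := ∫ x, (2 * u₁ x ^ 2 + v₁ x ^ 2 + 4 * v x ^ 2 + m ^ 2 * (u x ^ 2 + v x ^ 2) + G x ^ 2)
    with hB
  have iB : Integrable fun x => 2 * u₁ x ^ 2 + v₁ x ^ 2 + 4 * v x ^ 2
      + m ^ 2 * (u x ^ 2 + v x ^ 2) + G x ^ 2 :=
    ((((iu₁.const_mul 2).add iv₁).add (iv.const_mul 4)).add ((iu.add iv).const_mul _)).add iG
  suffices H : Integrable fun x => (Real.exp x * v x) ^ 2 by
    rwa [memLp_two_iff_integrable_sq (Continuous.aestronglyMeasurable (by fun_prop))]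
  -- The cutoff makes θ e^{2x} bounded, so the equation may be tested with θ v, which lies in H¹.
  -- Both θ and θ' are bounded uniformly in ε, which makes the resulting bound B independent of ε.
  set θ : ℝ → ℝ → ℝ := fun ε x => (1 + ε * Real.exp (2 * x))⁻¹ with hθ
  have hstep : ∀ ε : ℝ, 0 < ε → Integrable (fun x => θ ε x * (Real.exp x * v x) ^ 2) ∧
      ∫ x, θ ε x * (Real.exp x * v x) ^ 2 ≤ B := by
    intro ε hε
    have hpos : ∀ x, 0 < 1 + ε * Real.exp (2 * x) := fun x => by positivity
    have hθ0 : ∀ x, 0 < θ ε x := fun x => inv_pos.2 (hpos x)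
    have hθ1 : ∀ x, θ ε x ≤ 1 := fun x => inv_le_one_of_one_le₀ (by
      have := Real.exp_pos (2 * x); nlinarith)
    have hθ2 : ∀ x, ε * Real.exp (2 * x) * θ ε x ≤ 1 := fun x => by
      rw [hθ]; simp only; rw [← div_eq_mul_inv, div_le_one (hpos x)]; linarith
    have hd : ∀ x, HasDerivAt (θ ε) (-(2 * (ε * Real.exp (2 * x)) * θ ε x ^ 2)) x := fun x => by
      convert! (((hasDerivAt_exp_two x).const_mul ε).const_add 1).inv (hpos x).ne' using 1
      simp only [hθ]; field_simp
    have hθc : Continuous (θ ε) := continuous_iff_continuousAt.2 fun x => (hd x).continuousAt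
    have hd' : ∀ x, |-(2 * (ε * Real.exp (2 * x)) * θ ε x ^ 2)| ≤ 2 := fun x => by
      rw [abs_neg, abs_of_nonneg (by have := hθ0 x; positivity)]
      nlinarith [hθ2 x, hθ1 x, hθ0 x, mul_pos (mul_pos hε (Real.exp_pos (2 * x))) (hθ0 x)]
    have hφ := hv.cutoff_mul hd (by fun_prop) (B := 2)
      (fun x => by rw [abs_of_pos (hθ0 x)]; linarith [hθ1 x]) hd'
    have i1 : Integrable fun x => θ ε x * (Real.exp x * v x) ^ 2 := by
      refine (iv.bdd_mul (c := ε⁻¹) (f := fun x => θ ε x * Real.exp (2 * x))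
        (Continuous.aestronglyMeasurable (by fun_prop)) (ae_of_all _ fun x => ?_)).congr
        (ae_of_all _ fun x => ?_)
      · rw [Real.norm_of_nonneg (by have := hθ0 x; positivity), le_inv_comm₀
          (by have := hθ0 x; positivity) hε, ← one_div, le_div_iff₀ (by have := hθ0 x; positivity)]
        linarith [hθ2 x]
      · simp only [mul_pow, exp_two_mul]; ring
    have i2 : Integrable fun x => θ ε x * (Real.exp x * v x) * G x := by
      have hb := memLp_bdd_mul (c := fun x => θ ε x * Real.exp x) (B := 1 + ε⁻¹) hv.memLp
        (by fun_prop) fun x => by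
          rw [abs_of_nonneg (by have := hθ0 x; positivity)]
          have e1 : Real.exp x ≤ 1 + Real.exp (2 * x) := by
            rw [exp_two_mul]; nlinarith [sq_nonneg (Real.exp x - 1)]
          have e2 : θ ε x * Real.exp (2 * x) ≤ ε⁻¹ := by
            rw [← one_div, le_div_iff₀ hε]; linarith [hθ2 x]
          have := mul_le_mul_of_nonneg_left e1 (hθ0 x).le
          linarith [hθ1 x]
      refine (MemLp.integrable_mul_two hb hG).congr (ae_of_all _ fun x => ?_)
      simp only; ring
    refine ⟨i1, ?_⟩
    have i3 : Integrable fun x => m ^ 2 * (u x * (θ ε x * v x)) :=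
      (MemLp.integrable_mul_two hu.memLp hφ.memLp).const_mul _
    have ig : Integrable fun x =>
        (m ^ 2 * u x - (Real.exp (2 * x) * v x + Real.exp x * G x)) * (θ ε x * v x) := by
      refine (i3.sub (i1.add i2)).congr (ae_of_all _ fun x => ?_)
      simp only [Pi.sub_apply, Pi.add_apply, exp_two_mul]; ring
    have hI := hp.integral_parts hu.memLp_deriv hφ ig
    have i4 := MemLp.integrable_mul_two hu.memLp_deriv hφ.memLp_deriv
    rw [← add_eq_zero_iff_eq_neg, ← integral_add i4 ig] at hI
    -- The added null term contributes -2θ (e^x v)². One half cancels the quantity to be bounded,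
    -- and the other absorbs the product of e^x v with G.
    have hle : ∫ x, (θ ε x * (Real.exp x * v x) ^ 2 + 2 * (u₁ x *
        (-(2 * (ε * Real.exp (2 * x)) * θ ε x ^ 2) * v x + θ ε x * v₁ x) +
        (m ^ 2 * u x - (Real.exp (2 * x) * v x + Real.exp x * G x)) * (θ ε x * v x))) ≤ B := by
      refine integral_mono (i1.add ((i4.add ig).const_mul 2)) iB fun x => ?_
      have t0 := hθ0 x
      have t1 := hθ1 x
      have t2 := hd' x
      simp only [exp_two_mul] at t2 ⊢
      set d := -(2 * (ε * Real.exp x ^ 2) * θ ε x ^ 2)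
      set t := θ ε x
      set E := Real.exp x
      have d2 : d ^ 2 ≤ 4 := by
        have := abs_le.1 t2; nlinarith
      have a1 : 2 * (u₁ x * (d * v x)) ≤ u₁ x ^ 2 + 4 * v x ^ 2 := by
        have := mul_le_mul_of_nonneg_right d2 (sq_nonneg (v x))
        nlinarith [sq_nonneg (u₁ x - d * v x)]
      have a2 : 2 * (u₁ x * (t * v₁ x)) ≤ t * (u₁ x ^ 2 + v₁ x ^ 2) := by
        nlinarith [sq_nonneg (u₁ x - v₁ x)]
      have a3 : 2 * (m ^ 2 * u x * (t * v x)) ≤ t * (m ^ 2 * (u x ^ 2 + v x ^ 2)) := by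
        nlinarith [mul_nonneg (mul_nonneg (sq_nonneg m) t0.le) (sq_nonneg (u x - v x))]
      have a4 : -(2 * (E * G x * (t * v x))) ≤ t * (E * v x) ^ 2 + t * G x ^ 2 := by
        nlinarith [mul_nonneg t0.le (sq_nonneg (E * v x + G x))]
      have b2 : t * (u₁ x ^ 2 + v₁ x ^ 2) ≤ u₁ x ^ 2 + v₁ x ^ 2 :=
        mul_le_of_le_one_left (by positivity) t1
      have b3 : t * (m ^ 2 * (u x ^ 2 + v x ^ 2)) ≤ m ^ 2 * (u x ^ 2 + v x ^ 2) :=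
        mul_le_of_le_one_left (by positivity) t1
      have b4 : t * G x ^ 2 ≤ G x ^ 2 := mul_le_of_le_one_left (by positivity) t1
      nlinarith
    rwa [integral_add_two_mul_of_eq_zero hI i1 (i4.add ig)] at hle
  refine (integrable_of_tendsto_of_integral_le (F := fun n x => θ (1 / ((n : ℝ) + 1)) x
    * (Real.exp x * v x) ^ 2) (K := B) (fun n => (hstep _ (by positivity)).1) (fun n x => ?_)
    (fun x => ?_) fun n => (hstep _ (by positivity)).2).1
  · simp only [hθ]; positivity
  · have h1 : Tendsto (fun n : ℕ => θ (1 / ((n : ℝ) + 1)) x) atTop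
        (𝓝 ((1 + 0 * Real.exp (2 * x))⁻¹)) :=
      (((tendsto_one_div_add_atTop_nhds_zero_nat (𝕜 := ℝ)).mul_const _).const_add 1).inv₀ (by simp)
    simpa using h1.mul_const ((Real.exp x * v x) ^ 2)

/-- Weighted bounds for the equation `-u'' + m² u = eˣ w`. -/
lemma weighted_bound (hm : 4 ≤ m) (hu : IsH1 u u₁) (hw : MemLp w 2 volume)
    (hp : IsPrimitiveOn univ u₁ (fun x => m ^ 2 * u x - Real.exp x * w x)) :
    MemLp (fun x => Real.exp (-x) * u x) 2 volume ∧
    MemLp (fun x => Real.exp (-x) * u₁ x) 2 volume ∧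
    ∫ x, ((Real.exp (-x) * u₁ x) ^ 2 + (Real.exp (-x) * u x) ^ 2) ≤ ∫ x, w x ^ 2 := by
  have iu := hu.memLp.integrable_sq
  have iu₁ := hu.memLp_deriv.integrable_sq
  have iw := hw.integrable_sq
  have hu₁c := hp.continuous
  have huc := hu.continuous
  -- A bounded regularization of e^{-2x} with |q'| ≤ 2q uniformly in ε. In the equation tested with
  -- q u, the term with q' costs at most q u₁² + 4 q u², which 2 q u₁² and 2m² q u² ≥ 32 q u² pay
  -- for.
  set q : ℝ → ℝ → ℝ := fun ε x => (Real.exp (2 * x) + ε)⁻¹ with hq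
  have hstep : ∀ ε : ℝ, 0 < ε → Integrable (fun x => q ε x * (u₁ x ^ 2 + u x ^ 2)) ∧
      ∫ x, q ε x * (u₁ x ^ 2 + u x ^ 2) ≤ ∫ x, w x ^ 2 := by
    intro ε hε
    have hpos : ∀ x, 0 < Real.exp (2 * x) + ε := fun x => by positivity
    have hq0 : ∀ x, 0 < q ε x := fun x => inv_pos.2 (hpos x)
    have hq1 : ∀ x, q ε x ≤ ε⁻¹ := fun x => inv_anti₀ hε (by
      have := Real.exp_pos (2 * x); linarith)
    have hq2 : ∀ x, Real.exp (2 * x) * q ε x ≤ 1 := fun x => by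
      rw [hq]; simp only; rw [← div_eq_mul_inv, div_le_one (hpos x)]; linarith
    have hd : ∀ x, HasDerivAt (q ε) (-(2 * Real.exp (2 * x) * q ε x ^ 2)) x := fun x => by
      convert! ((hasDerivAt_exp_two x).add_const ε).inv (hpos x).ne' using 1
      simp only [hq]; field_simp
    have hqc : Continuous (q ε) := continuous_iff_continuousAt.2 fun x => (hd x).continuousAt
    have hd' : ∀ x, |-(2 * Real.exp (2 * x) * q ε x ^ 2)| ≤ 2 * q ε x := fun x => by
      rw [abs_neg, abs_of_nonneg (by have := hq0 x; positivity)]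
      nlinarith [hq2 x, hq0 x]
    have hφ := hu.cutoff_mul hd (by fun_prop) (B := 2 * ε⁻¹)
      (fun x => by rw [abs_of_pos (hq0 x)]; linarith [hq1 x, hq0 x])
      fun x => (hd' x).trans (by linarith [hq1 x])
    have i1 : Integrable fun x => q ε x * (u₁ x ^ 2 + u x ^ 2) :=
      (iu₁.add iu).bdd_mul (c := ε⁻¹) hqc.aestronglyMeasurable (ae_of_all _ fun x => by
        rw [Real.norm_of_nonneg (hq0 x).le]; exact hq1 x)
    have i2 : Integrable fun x => w x * (q ε x * Real.exp x * u x) := by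
      refine MemLp.integrable_mul_two hw (memLp_bdd_mul (B := 1 + ε⁻¹) hu.memLp (by fun_prop)
        fun x => ?_)
      rw [abs_of_nonneg (by have := hq0 x; positivity)]
      have e1 : Real.exp x ≤ 1 + Real.exp (2 * x) := by
        rw [exp_two_mul]; nlinarith [sq_nonneg (Real.exp x - 1)]
      have := mul_le_mul_of_nonneg_left e1 (hq0 x).le
      linarith [hq1 x, hq2 x]
    have ig : Integrable fun x => (m ^ 2 * u x - Real.exp x * w x) * (q ε x * u x) := by
      refine (((MemLp.integrable_mul_two hu.memLp hφ.memLp).const_mul (m ^ 2)).sub i2).congr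
        (ae_of_all _ fun x => ?_)
      simp only [Pi.sub_apply]; ring
    have hI := hp.integral_parts hu.memLp_deriv hφ ig
    have i4 := MemLp.integrable_mul_two hu.memLp_deriv hφ.memLp_deriv
    rw [← add_eq_zero_iff_eq_neg, ← integral_add i4 ig] at hI
    refine ⟨i1, ?_⟩
    have hle : ∫ x, (q ε x * (u₁ x ^ 2 + u x ^ 2)) ≤ ∫ x, (w x ^ 2 + 2 * (u₁ x *
        (-(2 * Real.exp (2 * x) * q ε x ^ 2) * u x + q ε x * u₁ x) +
        (m ^ 2 * u x - Real.exp x * w x) * (q ε x * u x))) := by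
      refine integral_mono i1 (iw.add ((i4.add ig).const_mul 2)) fun x => ?_
      have t0 := hq0 x
      have t1 := hq2 x
      have t2 := abs_le.1 (hd' x)
      simp only [exp_two_mul] at t1 t2 ⊢
      set d := -(2 * Real.exp x ^ 2 * q ε x ^ 2)
      set t := q ε x
      set E := Real.exp x
      have a1 : -(t * u₁ x ^ 2) - 4 * (t * u x ^ 2) ≤ 2 * (u₁ x * (d * u x)) := by
        have d2 : d ^ 2 ≤ 4 * t ^ 2 := by nlinarith
        have h1 : 0 ≤ (t * u₁ x + d * u x) ^ 2 := sq_nonneg _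
        have h2 : d ^ 2 * u x ^ 2 ≤ 4 * t ^ 2 * u x ^ 2 :=
          mul_le_mul_of_nonneg_right d2 (sq_nonneg _)
        have h3 : 0 ≤ t * (t * u₁ x ^ 2 + 4 * (t * u x ^ 2) + 2 * (u₁ x * (d * u x))) := by
          nlinarith
        have := nonneg_of_mul_nonneg_right h3 t0
        linarith
      have a2 : 2 * (E * w x * (t * u x)) ≤ w x ^ 2 + t * u x ^ 2 := by
        have h2 : E ^ 2 * t * (t * u x ^ 2) ≤ t * u x ^ 2 :=
          mul_le_of_le_one_left (by positivity) t1
        nlinarith [sq_nonneg (w x - E * t * u x)]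
      have a3 : 16 * (t * u x ^ 2) ≤ m ^ 2 * (t * u x ^ 2) :=
        mul_le_mul_of_nonneg_right (by nlinarith) (by positivity)
      have a4 : 0 ≤ t * u x ^ 2 := by positivity
      nlinarith
    rwa [integral_add_two_mul_of_eq_zero hI iw (i4.add ig)] at hle
  have hlim := integrable_of_tendsto_of_integral_le (F := fun n x => q (1 / ((n : ℝ) + 1)) x
    * (u₁ x ^ 2 + u x ^ 2)) (f := fun x => (Real.exp (-x) * u₁ x) ^ 2 + (Real.exp (-x) * u x) ^ 2)
    (K := ∫ x, w x ^ 2) (fun n => (hstep _ (by positivity)).1) (fun n x => ?_)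
    (fun x => ?_) fun n => (hstep _ (by positivity)).2
  · refine ⟨?_, ?_, hlim.2⟩
    · rw [memLp_two_iff_integrable_sq (Continuous.aestronglyMeasurable (by fun_prop))]
      refine hlim.1.mono' (Continuous.aestronglyMeasurable (by fun_prop)) (ae_of_all _ fun x => ?_)
      rw [Real.norm_of_nonneg (sq_nonneg _)]
      linarith [sq_nonneg (Real.exp (-x) * u₁ x)]
    · rw [memLp_two_iff_integrable_sq (Continuous.aestronglyMeasurable (by fun_prop))]
      refine hlim.1.mono' (Continuous.aestronglyMeasurable (by fun_prop)) (ae_of_all _ fun x => ?_)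
      rw [Real.norm_of_nonneg (sq_nonneg _)]
      linarith [sq_nonneg (Real.exp (-x) * u x)]
  · simp only [hq]; positivity
  · have h1 : Tendsto (fun n : ℕ => q (1 / ((n : ℝ) + 1)) x) atTop
        (𝓝 ((Real.exp (2 * x) + 0)⁻¹)) :=
      ((tendsto_one_div_add_atTop_nhds_zero_nat (𝕜 := ℝ)).const_add _).inv₀ (by positivity)
    have h2 := h1.mul_const (u₁ x ^ 2 + u x ^ 2)
    convert h2 using 2
    rw [add_zero, exp_two_mul, Real.exp_neg]
    ring

end Spatial

end HarmonicMapFlow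

/-! ### The energy estimate at a fixed time. -/

namespace HarmonicMapFlow

section Spatial

variable {m : ℝ} {u u₁ v v₁ G w e : ℝ → ℝ}

lemma hasDerivAt_exp_neg (x : ℝ) : HasDerivAt (fun x => Real.exp (-x)) (-Real.exp (-x)) x := by
  convert! (hasDerivAt_neg x).exp using 1
  ring

/-- The unknown divided by `r` is in `H¹`, with the energy identity in the weight `r⁻²` and
pointwise bounds. -/
lemma weighted_identity (hm : 4 ≤ m) (hu : IsH1 u u₁) (hw : MemLp w 2 volume)
    (hp : IsPrimitiveOn univ u₁ (fun x => m ^ 2 * u x - Real.exp x * w x)) :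
    IsH1 (fun x => Real.exp (-x) * u x) (fun x => Real.exp (-x) * u₁ x - Real.exp (-x) * u x) ∧
    ∫ x, w x * (Real.exp (-x) * u x) = ∫ x, ((Real.exp (-x) * u₁ x - Real.exp (-x) * u x) ^ 2
      + (m ^ 2 - 1) * (Real.exp (-x) * u x) ^ 2) ∧
    (∀ x, (Real.exp (-x) * u x) ^ 2 ≤ (3 * m ^ 4 + 7) * ∫ y, w y ^ 2) ∧
    ∀ x, (Real.exp (-x) * u₁ x) ^ 2 ≤ (3 * m ^ 4 + 7) * ∫ y, w y ^ 2 := by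
  obtain ⟨hη, hζ, hle⟩ := weighted_bound hm hu hw hp
  have hec : Continuous fun x : ℝ => Real.exp (-x) := by fun_prop
  have hE : IsPrimitiveOn univ (fun x : ℝ => Real.exp (-x)) (fun x => -Real.exp (-x)) :=
    IsPrimitiveOn.of_hasDerivAt ordConnected_univ (fun x _ => hasDerivAt_exp_neg x)
      hec.neg.continuousOn
  have pη : IsPrimitiveOn univ (fun x => Real.exp (-x) * u x)
      (fun x => Real.exp (-x) * u₁ x - Real.exp (-x) * u x) :=
    (hE.mul ordConnected_univ hu.prim).congr_deriv fun x => by ring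
  have pζ : IsPrimitiveOn univ (fun x => Real.exp (-x) * u₁ x)
      (fun x => m ^ 2 * (Real.exp (-x) * u x) - w x - Real.exp (-x) * u₁ x) :=
    (hE.mul ordConnected_univ hp).congr_deriv fun x => by
      have : Real.exp (-x) * Real.exp x = 1 := by rw [← Real.exp_add]; simp
      linear_combination (-w x) * this
  have Hη : IsH1 (fun x => Real.exp (-x) * u x)
      (fun x => Real.exp (-x) * u₁ x - Real.exp (-x) * u x) := ⟨hη, hζ.sub hη, pη⟩
  have Hζ : IsH1 (fun x => Real.exp (-x) * u₁ x)
      (fun x => m ^ 2 * (Real.exp (-x) * u x) - w x - Real.exp (-x) * u₁ x) := ⟨hζ, ((hη.const_mul (m ^ 2)).sub hw).sub hζ, pζ⟩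
  have iη := hη.integrable_sq
  have iζ := hζ.integrable_sq
  have iw := hw.integrable_sq
  have hWη : ∫ x, (Real.exp (-x) * u x) ^ 2 ≤ ∫ y, w y ^ 2 := by
    refine le_trans (integral_mono iη (iζ.add iη) fun x => ?_) hle
    simp only [Pi.add_apply]
    linarith [sq_nonneg (Real.exp (-x) * u₁ x)]
  have hWζ : ∫ x, (Real.exp (-x) * u₁ x) ^ 2 ≤ ∫ y, w y ^ 2 := by
    refine le_trans (integral_mono iζ (iζ.add iη) fun x => ?_) hle
    simp only [Pi.add_apply]
    linarith [sq_nonneg (Real.exp (-x) * u x)]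
  have hW0 : 0 ≤ ∫ y, w y ^ 2 := integral_nonneg fun y => sq_nonneg _
  refine ⟨Hη, ?_, fun x => (Hη.sq_le x).trans ?_, fun x => (Hζ.sq_le x).trans ?_⟩
  · have j1 := MemLp.integrable_mul_two hw hη
    have j2 := MemLp.integrable_mul_two Hζ.memLp_deriv hη
    have j3 := MemLp.integrable_mul_two hζ Hη.memLp_deriv
    -- With ζ = e^{-x} u' one has η' = ζ - η and ζ' = m² η - w - ζ; the identity is the vanishing of
    -- the integral of (ζη)'.
    have h0 := (pζ.mul ordConnected_univ pη).integral_eq_zero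
      (MemLp.integrable_mul_two hζ hη) (j2.add j3)
    rw [eq_comm, ← sub_eq_zero, ← integral_sub _ j1, ← h0]
    · refine integral_congr_ae (ae_of_all _ fun x => ?_)
      simp only; ring
    · exact Hη.memLp_deriv.integrable_sq.add (iη.const_mul _)
  · have : ∫ x, (Real.exp (-x) * u₁ x - Real.exp (-x) * u x) ^ 2
        ≤ 2 * ∫ x, ((Real.exp (-x) * u₁ x) ^ 2 + (Real.exp (-x) * u x) ^ 2) := by
      rw [← integral_const_mul]
      refine integral_mono Hη.memLp_deriv.integrable_sq ((iζ.add iη).const_mul 2) fun x => ?_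
      nlinarith [sq_nonneg (Real.exp (-x) * u₁ x + Real.exp (-x) * u x)]
    nlinarith [pow_nonneg (by linarith : 0 ≤ m) 4]
  -- The square of three terms costs a factor 3. Together with ∫ ζ² this gives the constant 1 + 3m⁴
  -- + 3 + 3 = 3m⁴ + 7.
  · have : ∫ x, (m ^ 2 * (Real.exp (-x) * u x) - w x - Real.exp (-x) * u₁ x) ^ 2
        ≤ 3 * m ^ 4 * (∫ x, (Real.exp (-x) * u x) ^ 2) + 3 * (∫ x, w x ^ 2)
          + 3 * ∫ x, (Real.exp (-x) * u₁ x) ^ 2 := by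
      have k1 : Integrable fun x => 3 * m ^ 4 * (Real.exp (-x) * u x) ^ 2 + 3 * w x ^ 2 :=
        (iη.const_mul _).add (iw.const_mul _)
      rw [← integral_const_mul, ← integral_const_mul, ← integral_const_mul,
        ← integral_add (iη.const_mul _) (iw.const_mul _), ← integral_add k1 (iζ.const_mul _)]
      refine integral_mono Hζ.memLp_deriv.integrable_sq (k1.add (iζ.const_mul _)) fun x => ?_
      beta_reduce
      set a := Real.exp (-x) * u x
      set b := Real.exp (-x) * u₁ x
      have : m ^ 4 * a ^ 2 = (m ^ 2 * a) ^ 2 := by ring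
      nlinarith [sq_nonneg (m ^ 2 * a + w x), sq_nonneg (m ^ 2 * a + b), sq_nonneg (w x - b)]
    have h4 : 0 ≤ 3 * m ^ 4 := by have := pow_nonneg (by linarith : 0 ≤ m) 4; linarith
    have := mul_le_mul_of_nonneg_left hWη h4
    nlinarith

/-- For y < 0 the growth of e^{-y} is compensated by sech(my) ≤ 2e^{my} ≤ 2e^y. This is why the
potential term divided by r is a bounded multiple of u at a fixed scale. -/
lemma exp_neg_mul_sech_sq_le (hm : 1 ≤ m) (y : ℝ) : Real.exp (-y) * sech (m * y) ^ 2 ≤ 2 := by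
  have h0 := sech_pos (m * y)
  have h1 := sech_le_one (m * y)
  rcases le_or_gt 0 y with hy | hy
  · have : Real.exp (-y) ≤ 1 := Real.exp_le_one_iff.2 (by linarith)
    have := Real.exp_pos (-y)
    nlinarith [mul_pos this h0]
  · have h2 : sech (m * y) ≤ 2 * Real.exp y := by
      have := sech_le_exp (-(m * y))
      rw [sech_neg, neg_neg] at this
      exact this.trans (mul_le_mul_of_nonneg_left (Real.exp_le_exp.2 (by nlinarith)) zero_le_two)
    have h3 : Real.exp (-y) * Real.exp y = 1 := by rw [← Real.exp_add]; simp
    have h4 := Real.exp_pos (-y)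
    calc Real.exp (-y) * sech (m * y) ^ 2 ≤ Real.exp (-y) * (2 * Real.exp y) := by
          refine mul_le_mul_of_nonneg_left ?_ h4.le
          nlinarith
      _ = 2 := by linear_combination 2 * h3

lemma exp_neg_mul_sech_sq_sub_le (hm : 1 ≤ m) (σ x : ℝ) :
    Real.exp (-x) * sech (m * (x - σ)) ^ 2 ≤ 2 * Real.exp (-σ) := by
  have := mul_le_mul_of_nonneg_right (exp_neg_mul_sech_sq_le hm (x - σ)) (Real.exp_pos (-σ)).le
  have e : Real.exp (-x) = Real.exp (-(x - σ)) * Real.exp (-σ) := by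
    rw [← Real.exp_add]; congr 1; ring
  rw [e]
  linarith

lemma IsH1.congr_deriv (hu : IsH1 u u₁) {g : ℝ → ℝ} (h : u₁ =ᵐ[volume] g) : IsH1 u g :=
  ⟨hu.memLp, (memLp_congr_ae h).1 hu.memLp_deriv, hu.prim.congr_deriv_ae h⟩

/-- The energy estimate at a fixed time. -/
theorem energy_estimate (hm : 4 ≤ m) (σ : ℝ) (hu : IsH1 u u₁) (hv : IsH1 v v₁)
    (he : MemLp e 2 volume)
    (hweak : ∀ φ : ℝ → ℝ, IsTest φ → ∫ x, (u₁ x * deriv φ x + m ^ 2 * (u x * φ x)) =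
      ∫ x, (Real.exp (2 * x) * v x + Real.exp x * e x
        + 2 * m ^ 2 * sech (m * (x - σ)) ^ 2 * u x) * φ x) :
    ∃ W : ℝ, 0 ≤ W ∧ (∀ᵐ x, (Real.exp (-x) * u x) ^ 2 ≤ (3 * m ^ 4 + 7) * W) ∧
      (∀ᵐ x, (Real.exp (-x) * u₁ x) ^ 2 ≤ (3 * m ^ 4 + 7) * W) ∧
      W / 2 ≤ (∫ x, (u₁ x * v₁ x + m ^ 2 * (u x * v x))) + 56 * m ^ 4 * (∫ x, v x * u x)
        + (1 + 196 * m ^ 4) * (∫ x, e x ^ 2) + 512 * m ^ 5 * (Real.exp (-3 * σ)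
          * ∫ x, u x * (Real.exp (2 * x) * sech (m * (x - σ)))) ^ 2 := by
  have hsc : Continuous fun x => sech (m * (x - σ)) := continuous_sech.comp (by fun_prop)
  have hm0 : 0 < m := by linarith
  set k : ℝ → ℝ := fun x => sech (m * (x - σ)) with hk
  -- Moving the potential to the right-hand side leaves the constant coefficient equation -u'' + m²
  -- u = e^x (e^x v + G).
  set G : ℝ → ℝ := fun x => e x + 2 * m ^ 2 * ((Real.exp (-x) * k x ^ 2) * u x) with hGdef
  have hG : MemLp G 2 volume := by
    refine he.add ((memLp_bdd_mul (c := fun x => Real.exp (-x) * k x ^ 2) (B := 2 * Real.exp (-σ))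
      hu.memLp (by fun_prop) fun x => ?_).const_mul _)
    rw [abs_of_nonneg (by positivity)]
    exact exp_neg_mul_sech_sq_sub_le (by linarith) σ x
  have hexp : ∀ x : ℝ, Real.exp x * Real.exp (-x) = 1 := fun x => by rw [← Real.exp_add]; simp
  have hloc : ∀ {c f : ℝ → ℝ}, Continuous c → MemLp f 2 volume →
      LocallyIntegrable (fun x => c x * f x) := fun hc hf => by
    simpa [smul_eq_mul] using (hf.locallyIntegrable (by norm_num)).continuous_mul hc
  set g : ℝ → ℝ := fun x => m ^ 2 * u x - (Real.exp (2 * x) * v x + Real.exp x * G x) with hg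
  have hgl : LocallyIntegrable g :=
    (hloc continuous_const hu.memLp).sub ((hloc (by fun_prop) hv.memLp).add
      (hloc (by fun_prop) hG))
  have hul : LocallyIntegrable u₁ := hu.memLp_deriv.locallyIntegrable (by norm_num)
  -- Regularity: the weak equation makes u₁ agree almost everywhere with a primitive, so the
  -- equation can be integrated by parts against H¹ functions and not only against test functions.
  obtain ⟨hprim, C, hC⟩ := exists_eq_add_integral_of_weak (I := univ) (c := 0) isOpen_univ
    ordConnected_univ (mem_univ _) (hul.locallyIntegrableOn univ) (hgl.locallyIntegrableOn univ)
    fun φ hφ _ => by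
      have h1 := hweak φ hφ
      have i1 : Integrable fun x => u₁ x * deriv φ x := hφ.deriv.locallyIntegrable_mul hul
      have i2 : Integrable fun x => m ^ 2 * (u x * φ x) :=
        (hφ.locallyIntegrable_mul (hu.memLp.locallyIntegrable (by norm_num))).const_mul _
      have i3 : Integrable fun x => g x * φ x := hφ.locallyIntegrable_mul hgl
      rw [setIntegral_univ, setIntegral_univ]
      have h2 : ∫ x, g x * φ x = (∫ x, m ^ 2 * (u x * φ x)) - ∫ x, (Real.exp (2 * x) * v x
          + Real.exp x * e x + 2 * m ^ 2 * sech (m * (x - σ)) ^ 2 * u x) * φ x := by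
        rw [← integral_sub i2]
        · refine integral_congr_ae (ae_of_all _ fun x => ?_)
          simp only [hg, hGdef, hk]
          linear_combination (-2 * m ^ 2 * sech (m * (x - σ)) ^ 2 * u x * φ x) * hexp x
        · refine (i2.sub i3).congr (ae_of_all _ fun x => ?_)
          simp only [Pi.sub_apply, hg, hGdef, hk]
          linear_combination (2 * m ^ 2 * sech (m * (x - σ)) ^ 2 * u x * φ x) * hexp x
      rw [integral_add i1 i2] at h1
      rw [h2, ← h1]
      ring
  rw [Measure.restrict_univ] at hC
  set ub : ℝ → ℝ := fun x => C + ∫ t in (0 : ℝ)..x, g t with hub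
  have hubp : IsPrimitiveOn univ ub g :=
    IsPrimitiveOn.intervalIntegral_self (fun a ha b hb => (hprim a ha b hb).1) (mem_univ 0) C
  have hu' : IsH1 u ub := hu.congr_deriv hC
  have hev := memLp_exp_mul_of_weak hu' hv hG hubp
  set w : ℝ → ℝ := fun x => Real.exp x * v x + G x with hwdef
  have hw : MemLp w 2 volume := hev.add hG
  have hubw : IsPrimitiveOn univ ub (fun x => m ^ 2 * u x - Real.exp x * w x) :=
    hubp.congr_deriv fun x => by simp only [hg, hwdef, exp_two_mul]; ring
  obtain ⟨hη, hid, hs1, hs2⟩ := weighted_identity hm hu' hw hubw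
  set η : ℝ → ℝ := fun x => Real.exp (-x) * u x with hηdef
  set η₁ : ℝ → ℝ := fun x => Real.exp (-x) * ub x - Real.exp (-x) * u x with hη₁def
  have huη : ∀ x, u x = Real.exp x * η x := fun x => by
    simp only [hηdef]; linear_combination (-u x) * hexp x
  have iw := hw.integrable_sq
  have ie := he.integrable_sq
  have iη := hη.memLp.integrable_sq
  have iη₁ := hη.memLp_deriv.integrable_sq
  have iwG := MemLp.integrable_mul_two hw hG
  have iGG := hG.integrable_sq
  refine ⟨∫ x, w x ^ 2, integral_nonneg fun x => sq_nonneg _, ae_of_all _ hs1, ?_, ?_⟩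
  · filter_upwards [hC] with x hx
    rw [hx]; exact hs2 x
  -- First multiplier: pairing with v in X², where e^x v = w - G.
  have hI : ∫ x, (u₁ x * v₁ x + m ^ 2 * (u x * v x)) = ∫ x, w x * (w x - G x) := by
    have i1 : Integrable fun x => (m ^ 2 * u x - Real.exp x * w x) * v x := by
      refine (((MemLp.integrable_mul_two hu.memLp hv.memLp).const_mul (m ^ 2)).sub
        (MemLp.integrable_mul_two hw hev)).congr (ae_of_all _ fun x => ?_)
      simp only [Pi.sub_apply]; ring
    have h1 := hubw.integral_parts hu'.memLp_deriv hv i1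
    have i2 := MemLp.integrable_mul_two hu'.memLp_deriv hv.memLp_deriv
    have i3 : Integrable fun x => m ^ 2 * (u x * v x) :=
      (MemLp.integrable_mul_two hu.memLp hv.memLp).const_mul (m ^ 2)
    have h2 : ∫ x, (u₁ x * v₁ x + m ^ 2 * (u x * v x))
        = ∫ x, (ub x * v₁ x + m ^ 2 * (u x * v x)) := by
      refine integral_congr_ae ?_
      filter_upwards [hC] with x hx
      rw [hx]
    have i4 : Integrable fun x => -((m ^ 2 * u x - Real.exp x * w x) * v x) := i1.neg
    rw [h2, integral_add i2 i3, h1, ← integral_neg, ← integral_add i4 i3]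
    refine integral_congr_ae (ae_of_all _ fun x => ?_)
    simp only [hwdef]; ring
  -- Pointwise w(w - G) ≥ w²/2 - G²/2 and G² ≤ 2e² + 8m⁴η², because the potential factor sech² is at
  -- most 1.
  have hIge : (∫ x, w x ^ 2) / 2 - (∫ x, e x ^ 2) - 4 * m ^ 4 * ∫ x, η x ^ 2
      ≤ ∫ x, (u₁ x * v₁ x + m ^ 2 * (u x * v x)) := by
    have j1 : Integrable fun x => w x ^ 2 / 2 := iw.div_const 2
    have j2 : Integrable fun x => w x ^ 2 / 2 - e x ^ 2 := j1.sub ie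
    have j3 : Integrable fun x => 4 * m ^ 4 * η x ^ 2 := iη.const_mul _
    rw [hI, ← integral_div, ← integral_sub j1 ie, ← integral_const_mul, ← integral_sub j2 j3]
    refine integral_mono (j2.sub j3) (MemLp.integrable_mul_two hw (hw.sub hG)) fun x => ?_
    beta_reduce
    have hGx : G x = e x + 2 * m ^ 2 * (k x ^ 2 * η x) := by simp only [hGdef, hηdef]; ring
    have hkx : (k x ^ 2 * η x) ^ 2 ≤ η x ^ 2 := by
      have h1 : k x ^ 2 ≤ 1 := pow_le_one₀ (sech_pos _).le (sech_le_one _)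
      have h2 : (k x ^ 2) ^ 2 ≤ 1 := pow_le_one₀ (sq_nonneg _) h1
      rw [mul_pow]
      exact mul_le_of_le_one_left (sq_nonneg _) h2
    have hG2 : G x ^ 2 ≤ 2 * e x ^ 2 + 8 * m ^ 4 * η x ^ 2 := by
      have h3 := mul_le_mul_of_nonneg_left hkx (by positivity : 0 ≤ 8 * m ^ 4)
      rw [hGx]
      nlinarith [sq_nonneg (e x - 2 * m ^ 2 * (k x ^ 2 * η x))]
    nlinarith [sq_nonneg (w x - G x)]
  -- Second multiplier: v u = (w - G) η, and `weighted_identity` evaluates ∫ w η. The potential part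
  -- of G completes the Pöschl–Teller form; the weight leaves the loss -∫ η².
  have hII : ∫ x, v x * u x = (∫ x, (η₁ x ^ 2 + m ^ 2 * η x ^ 2
      - 2 * m ^ 2 * (k x ^ 2 * η x ^ 2))) - (∫ x, η x ^ 2) - ∫ x, e x * η x := by
    have ik : Integrable fun x => k x ^ 2 * η x ^ 2 := by
      refine iη.bdd_mul (c := 1) (Continuous.aestronglyMeasurable (by fun_prop))
        (ae_of_all _ fun x => ?_)
      rw [Real.norm_of_nonneg (by positivity)]
      exact pow_le_one₀ (sech_pos _).le (sech_le_one _)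
    have j1 : Integrable fun x => η₁ x ^ 2 + m ^ 2 * η x ^ 2
      - 2 * m ^ 2 * (k x ^ 2 * η x ^ 2) := (iη₁.add (iη.const_mul _)).sub (ik.const_mul _)
    have j2 : Integrable fun x => η₁ x ^ 2 + m ^ 2 * η x ^ 2
      - 2 * m ^ 2 * (k x ^ 2 * η x ^ 2) - η x ^ 2 := j1.sub iη
    have j3 := MemLp.integrable_mul_two hw hη.memLp
    have j4 := MemLp.integrable_mul_two hG hη.memLp
    rw [← integral_sub j1 iη, ← integral_sub j2 (MemLp.integrable_mul_two he hη.memLp)]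
    have h1 : ∫ x, v x * u x = (∫ x, w x * η x) - ∫ x, G x * η x := by
      rw [← integral_sub j3 j4]
      refine integral_congr_ae (ae_of_all _ fun x => ?_)
      simp only [hwdef, huη x]; ring
    have j5 : Integrable fun x => η₁ x ^ 2 + (m ^ 2 - 1) * η x ^ 2 := iη₁.add (iη.const_mul _)
    rw [h1, hid, ← integral_sub j5 j4]
    refine integral_congr_ae (ae_of_all _ fun x => ?_)
    have hGx : G x = e x + 2 * m ^ 2 * (k x ^ 2 * η x) := by simp only [hGdef, hηdef]; ring
    simp only [hGx]; ring
  have hco := coercivity hm hη σ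
  have hb : ∫ x, η x * (Real.exp (3 * x) * sech (m * (x - σ)))
      = ∫ x, u x * (Real.exp (2 * x) * sech (m * (x - σ))) := by
    refine integral_congr_ae (ae_of_all _ fun x => ?_)
    simp only [huη x]
    have : Real.exp (3 * x) = Real.exp x * Real.exp (2 * x) := by rw [← Real.exp_add]; ring_nf
    rw [this]; ring
  rw [hb] at hco
  have heη : ∫ x, e x * η x ≤ (∫ x, η x ^ 2) / 14 + 7 / 2 * ∫ x, e x ^ 2 := by
    rw [← integral_div, ← integral_const_mul, ← integral_add (iη.div_const _) (ie.const_mul _)]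
    refine integral_mono (MemLp.integrable_mul_two he hη.memLp)
      ((iη.div_const _).add (ie.const_mul _)) fun x => ?_
    beta_reduce
    nlinarith [sq_nonneg (η x - 7 * e x)]
  set H := ∫ x, η x ^ 2
  set E := ∫ x, e x ^ 2
  set Φ := ∫ x, (η₁ x ^ 2 + m ^ 2 * η x ^ 2 - 2 * m ^ 2 * (k x ^ 2 * η x ^ 2))
  set b := Real.exp (-3 * σ) * ∫ x, u x * (Real.exp (2 * x) * sech (m * (x - σ)))
  -- Coercivity with constant 8/7 leaves H/7 after the loss of H; half of that is spent on ∫ e η.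
  have h2 : H / 14 - 7 / 2 * E - 64 / 7 * m * b ^ 2 ≤ ∫ x, v x * u x := by
    rw [hII]
    have : 8 * H ≤ 7 * Φ + 64 * m * b ^ 2 := hco
    linarith
  -- The factor 56 m⁴ turns H/14 into 4 m⁴ H, exactly the loss of the first multiplier.
  have h3 := mul_le_mul_of_nonneg_left h2 (by positivity : 0 ≤ 56 * m ^ 4)
  have e1 : 56 * m ^ 4 * (H / 14 - 7 / 2 * E - 64 / 7 * m * b ^ 2)
      = 4 * m ^ 4 * H - 196 * m ^ 4 * E - 512 * m ^ 5 * b ^ 2 := by ring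
  linarith

end Spatial

end HarmonicMapFlow

/-! ### Logarithmic coordinates and the norms of X^p. -/

namespace HarmonicMapFlow

section LogCoordinates

lemma range_exp_eq : Real.exp '' univ = Ioi 0 := by rw [image_univ, Real.range_exp]

lemma lintegral_Ioi_eq (F : ℝ → ℝ≥0∞) :
    ∫⁻ r in Ioi (0 : ℝ), F r = ∫⁻ x, ENNReal.ofReal (Real.exp x) * F (Real.exp x) := by
  rw [← range_exp_eq, lintegral_image_eq_lintegral_abs_deriv_mul MeasurableSet.univ
    (fun x _ => (Real.hasDerivAt_exp x).hasDerivWithinAt) Real.exp_injective.injOn,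
    Measure.restrict_univ]
  simp only [Real.abs_exp]

lemma integral_Ioi_eq (F : ℝ → ℝ) :
    ∫ r in Ioi (0 : ℝ), F r = ∫ x, Real.exp x * F (Real.exp x) := by
  rw [← range_exp_eq, integral_image_eq_integral_abs_deriv_smul MeasurableSet.univ
    (fun x _ => (Real.hasDerivAt_exp x).hasDerivWithinAt) Real.exp_injective.injOn,
    Measure.restrict_univ]
  simp only [Real.abs_exp, smul_eq_mul]

lemma lintegral_rdr (F : ℝ → ℝ≥0∞) :
    ∫⁻ r, F r ∂rdr = ∫⁻ x, ENNReal.ofReal (Real.exp (2 * x)) * F (Real.exp x) := by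
  rw [rdr, lintegral_withDensity_eq_lintegral_mul_non_measurable _ (by fun_prop)
    (ae_of_all _ fun r => ENNReal.ofReal_lt_top), lintegral_Ioi_eq]
  refine lintegral_congr fun x => ?_
  rw [Pi.mul_apply, ← mul_assoc, ← ENNReal.ofReal_mul (Real.exp_pos x).le, exp_two_mul, sq]

lemma integral_rdr (F : ℝ → ℝ) :
    ∫ r, F r ∂rdr = ∫ x, Real.exp (2 * x) * F (Real.exp x) := by
  rw [rdr, integral_withDensity_eq_integral_toReal_smul (by fun_prop)
    (ae_of_all _ fun r => ENNReal.ofReal_lt_top), integral_Ioi_eq]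
  refine integral_congr_ae (ae_of_all _ fun x => ?_)
  simp only [ENNReal.toReal_ofReal (Real.exp_pos x).le, smul_eq_mul, exp_two_mul]
  ring

lemma rdr_eq_map : rdr = (volume.withDensity
    (fun x => ENNReal.ofReal (Real.exp (2 * x)))).map Real.exp := by
  refine Measure.ext fun s hs => ?_
  rw [Measure.map_apply Real.measurable_exp hs, withDensity_apply _ (Real.measurable_exp hs),
    ← lintegral_indicator_one hs, lintegral_rdr, ← lintegral_indicator (Real.measurable_exp hs)]
  refine lintegral_congr fun x => ?_
  by_cases hx : Real.exp x ∈ s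
  · rw [indicator_of_mem hx, indicator_of_mem (by exact hx), Pi.one_apply, mul_one]
  · rw [indicator_of_notMem hx, indicator_of_notMem (by exact hx), mul_zero]

lemma ae_rdr_iff {P : ℝ → Prop} : (∀ᵐ r ∂rdr, P r) ↔ ∀ᵐ x, P (Real.exp x) := by
  rw [rdr_eq_map, Real.isOpenEmbedding_exp.measurableEmbedding.ae_map_iff,
    ae_withDensity_iff (by fun_prop)]
  simp [Real.exp_pos]

lemma eLpNorm_two_rdr (F : ℝ → ℝ) :
    eLpNorm F 2 rdr = eLpNorm (fun x => Real.exp x * F (Real.exp x)) 2 volume := by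
  rw [eLpNorm_eq_lintegral_rpow_enorm_toReal (by norm_num) (by norm_num),
    eLpNorm_eq_lintegral_rpow_enorm_toReal (by norm_num) (by norm_num), lintegral_rdr]
  congr 1
  refine lintegral_congr fun x => ?_
  rw [enorm_mul, ENNReal.mul_rpow_of_nonneg _ _ (by norm_num), exp_two_mul,
    ENNReal.ofReal_pow (Real.exp_pos x).le, Real.enorm_of_nonneg (Real.exp_pos x).le]
  congr 1
  norm_num

lemma eLpNorm_one_rdr (F : ℝ → ℝ) :
    eLpNorm F 1 rdr = ∫⁻ x, ENNReal.ofReal (Real.exp (2 * x)) * ‖F (Real.exp x)‖ₑ := by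
  rw [eLpNorm_one_eq_lintegral_enorm, lintegral_rdr]

lemma eLpNorm_top_rdr_le {F : ℝ → ℝ} {B : ℝ} (h : ∀ᵐ x, |F (Real.exp x)| ≤ B) :
    eLpNorm F ∞ rdr ≤ ENNReal.ofReal B := by
  rw [eLpNorm_exponent_top]
  exact eLpNormEssSup_le_of_ae_bound (ae_rdr_iff.2 h)

/-- The test function `φ (log r)` on the half-line, extended by zero. -/
noncomputable def expTest (φ : ℝ → ℝ) (r : ℝ) : ℝ := if 0 < r then φ (Real.log r) else 0

lemma expTest_exp (φ : ℝ → ℝ) (x : ℝ) : expTest φ (Real.exp x) = φ x := by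
  simp [expTest, Real.exp_pos]

lemma expTest_eventuallyEq (φ : ℝ → ℝ) {r : ℝ} (hr : 0 < r) :
    expTest φ =ᶠ[𝓝 r] fun ρ => φ (Real.log ρ) := by
  filter_upwards [Ioi_mem_nhds hr] with ρ hρ
  simp only [expTest, if_pos (show (0 : ℝ) < ρ from hρ)]

lemma IsTest.expTest {φ : ℝ → ℝ} (hφ : IsTest φ) :
    IsTest (expTest φ) ∧ tsupport (HarmonicMapFlow.expTest φ) ⊆ Ioi 0 := by
  obtain ⟨a, -, b, -, hab, hsub⟩ := hφ.exists_interval isOpen_univ (subset_univ _) (mem_univ 0)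
  have hz : ∀ x ∉ Ioo a b, φ x = 0 := fun x hx =>
    image_eq_zero_of_notMem_tsupport fun hm => hx (hsub hm)
  have hz' : ∀ r ∉ Icc (Real.exp a) (Real.exp b), HarmonicMapFlow.expTest φ r = 0 := by
    intro r hr
    by_cases h0 : 0 < r
    · rw [HarmonicMapFlow.expTest, if_pos h0]
      refine hz _ fun hm => hr ⟨?_, ?_⟩
      · rw [← Real.le_log_iff_exp_le h0]; exact hm.1.le
      · rw [← Real.log_le_iff_le_exp h0]; exact hm.2.le
    · rw [HarmonicMapFlow.expTest, if_neg h0]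
  have hts : tsupport (HarmonicMapFlow.expTest φ) ⊆ Icc (Real.exp a) (Real.exp b) :=
    closure_minimal (fun x hx => by_contra fun h => hx (hz' x h)) isClosed_Icc
  refine ⟨⟨?_, HasCompactSupport.of_support_subset_isCompact isCompact_Icc
    ((subset_tsupport _).trans hts)⟩, hts.trans fun r hr => (Real.exp_pos a).trans_le hr.1⟩
  rw [contDiff_iff_contDiffAt]
  intro r
  by_cases h0 : 0 < r
  · refine ContDiffAt.congr_of_eventuallyEq ?_ (expTest_eventuallyEq φ h0)
    exact hφ.contDiff.contDiffAt.comp r (Real.contDiffAt_log.2 h0.ne')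
  · refine (contDiffAt_const (c := (0 : ℝ))).congr_of_eventuallyEq ?_
    filter_upwards [Iio_mem_nhds (show r < Real.exp a by linarith [Real.exp_pos a])] with ρ hρ
    exact hz' ρ fun h => absurd h.1 (not_le.2 hρ)

lemma deriv_expTest {φ : ℝ → ℝ} (hφ : IsTest φ) {r : ℝ} (hr : 0 < r) :
    deriv (expTest φ) r = deriv φ (Real.log r) / r := by
  rw [(expTest_eventuallyEq φ hr).deriv_eq, div_eq_mul_inv]
  exact ((hφ.hasDerivAt _).comp r (Real.hasDerivAt_log hr.ne')).deriv

lemma locallyIntegrable_comp_exp {u : ℝ → ℝ} (hu : LocallyIntegrableOn u (Ioi (0 : ℝ)))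
    {c : ℝ → ℝ} (hc : Continuous c) : LocallyIntegrable fun x => c x * u (Real.exp x) := by
  rw [locallyIntegrable_iff]
  intro K hK
  have h1 : IntegrableOn u (Real.exp '' K) := hu.integrableOn_compact_subset
    (by rintro _ ⟨x, -, rfl⟩; exact Real.exp_pos x) (hK.image Real.continuous_exp)
  rw [integrableOn_image_iff_integrableOn_abs_deriv_smul hK.measurableSet
    (fun x _ => (Real.hasDerivAt_exp x).hasDerivWithinAt) Real.exp_injective.injOn] at h1
  have h2 := h1.continuousOn_mul (g := fun x => c x * Real.exp (-x))
    (Continuous.continuousOn (by fun_prop)) hK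
  refine h2.congr_fun (fun x _ => ?_) hK.measurableSet
  simp only [Real.abs_exp, smul_eq_mul]
  have : Real.exp (-x) * Real.exp x = 1 := by rw [← Real.exp_add]; simp
  linear_combination (c x * u (Real.exp x)) * this

/-- The chain rule for r = e^x in weak form: the Jacobian e^x cancels the factor 1/r of the
derivative of φ(log r) and remains on the other side. -/
lemma HasWeakDeriv.weak_log {u g : ℝ → ℝ} (h : HasWeakDeriv u g) {φ : ℝ → ℝ} (hφ : IsTest φ) :
    ∫ x, u (Real.exp x) * deriv φ x = -∫ x, Real.exp x * g (Real.exp x) * φ x := by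
  obtain ⟨h1, h2⟩ := hφ.expTest
  have := h.byParts _ h1.contDiff h1.compact h2
  rw [integral_Ioi_eq, integral_Ioi_eq] at this
  simp only [deriv_expTest hφ (Real.exp_pos _), Real.log_exp, expTest_exp] at this
  have e1 : ∀ x, Real.exp x * (u (Real.exp x) * (deriv φ x / Real.exp x))
      = u (Real.exp x) * deriv φ x := fun x => by
    have := (Real.exp_pos x).ne'
    field_simp
  have e2 : ∀ x, Real.exp x * (g (Real.exp x) * φ x) = Real.exp x * g (Real.exp x) * φ x :=
    fun x => by ring
  simpa only [e1, e2] using this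

lemma HasWeakDeriv.locallyIntegrable_log {u g : ℝ → ℝ} (h : HasWeakDeriv u g) :
    LocallyIntegrable (fun x => u (Real.exp x)) ∧
    LocallyIntegrable (fun x => Real.exp x * g (Real.exp x)) :=
  ⟨by simpa using locallyIntegrable_comp_exp h.locInt (continuous_const (y := (1 : ℝ))),
    locallyIntegrable_comp_exp h.locInt_deriv Real.continuous_exp⟩

lemma HasWeakDeriv.ae_eq {u g u' g' : ℝ → ℝ} (h : HasWeakDeriv u g) (h' : HasWeakDeriv u' g')
    (he : ∀ᵐ x, u (Real.exp x) = u' (Real.exp x)) :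
    ∀ᵐ x, g (Real.exp x) = g' (Real.exp x) := by
  have hint : ∀ φ : ℝ → ℝ, ContDiff ℝ (⊤ : ℕ∞) φ → HasCompactSupport φ →
      ∫ x, φ x • (Real.exp x * g (Real.exp x)) = ∫ x, φ x • (Real.exp x * g' (Real.exp x)) := by
    intro φ hφ hφc
    have hφt : IsTest φ := ⟨hφ, hφc⟩
    have e1 := h.weak_log hφt
    have e2 := h'.weak_log hφt
    have e3 : ∫ x, u (Real.exp x) * deriv φ x = ∫ x, u' (Real.exp x) * deriv φ x := by
      refine integral_congr_ae ?_
      filter_upwards [he] with x hx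
      rw [hx]
    simp only [smul_eq_mul, mul_comm (φ _)]
    linarith
  filter_upwards [ae_eq_of_integral_contDiff_smul_eq h.locallyIntegrable_log.2
    h'.locallyIntegrable_log.2 hint] with x hx
  exact mul_left_cancel₀ (Real.exp_pos x).ne' hx

lemma HasWeakDeriv.sub {u g u' g' : ℝ → ℝ} (h : HasWeakDeriv u g) (h' : HasWeakDeriv u' g') :
    HasWeakDeriv (fun r => u r - u' r) (fun r => g r - g' r) := by
  refine ⟨h.locInt.sub h'.locInt, h.locInt_deriv.sub h'.locInt_deriv, fun φ hφ hc hs => ?_⟩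
  have ht : IsTest φ := ⟨hφ, hc⟩
  have hint : ∀ {w ψ : ℝ → ℝ}, LocallyIntegrableOn w (Ioi 0) → IsTest ψ → tsupport ψ ⊆ Ioi 0 →
      IntegrableOn (fun x => w x * ψ x) (Ioi 0) := by
    intro w ψ hw hψ hs
    have hK : IntegrableOn (fun x => w x * ψ x) (tsupport ψ) :=
      (hw.integrableOn_compact_subset hs hψ.compact.isCompact).mul_continuousOn
        hψ.continuous.continuousOn hψ.compact.isCompact
    have : Integrable (fun x => w x * ψ x) := by
      rw [← integrableOn_iff_integrable_of_support_subset (s := tsupport ψ)]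
      · exact hK
      · intro x hx
        exact subset_tsupport ψ (right_ne_zero_of_mul hx)
    exact this.integrableOn
  have hs' : tsupport (deriv φ) ⊆ Ioi 0 := tsupport_deriv_subset.trans hs
  simp only [sub_mul]
  rw [integral_sub (hint h.locInt ht.deriv hs') (hint h'.locInt ht.deriv hs'),
    integral_sub (hint h.locInt_deriv ht hs) (hint h'.locInt_deriv ht hs),
    h.byParts φ hφ hc hs, h'.byParts φ hφ hc hs]
  ring

/-- The `X²` norm in logarithmic coordinates. -/
lemma xNorm_two_eq (m : ℕ) {u g : ℝ → ℝ} (h : HasWeakDeriv u g) :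
    xNorm m 2 u = ((eLpNorm (fun x => Real.exp x * g (Real.exp x)) 2 volume) ^ (2 : ℝ)
      + (m : ℝ≥0∞) ^ (2 : ℝ) * (eLpNorm (fun x => u (Real.exp x)) 2 volume) ^ (2 : ℝ))
      ^ (1 / 2 : ℝ) := by
  have key : ∀ g', HasWeakDeriv u g' → (((eLpNorm g' 2 rdr) ^ (2 : ℝ≥0∞).toReal
      + (m : ℝ≥0∞) ^ (2 : ℝ≥0∞).toReal * (eLpNorm (fun r => u r / r) 2 rdr) ^ (2 : ℝ≥0∞).toReal)
      ^ (1 / (2 : ℝ≥0∞).toReal)) = ((eLpNorm (fun x => Real.exp x * g (Real.exp x)) 2 volume) ^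
      (2 : ℝ) + (m : ℝ≥0∞) ^ (2 : ℝ) * (eLpNorm (fun x => u (Real.exp x)) 2 volume) ^ (2 : ℝ))
      ^ (1 / 2 : ℝ) := by
    intro g' hg'
    rw [ENNReal.toReal_ofNat, eLpNorm_two_rdr, eLpNorm_two_rdr]
    have e1 : eLpNorm (fun x => Real.exp x * g' (Real.exp x)) 2 volume
        = eLpNorm (fun x => Real.exp x * g (Real.exp x)) 2 volume := by
      refine eLpNorm_congr_ae ?_
      filter_upwards [hg'.ae_eq h (ae_of_all _ fun _ => rfl)] with x hx
      rw [hx]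
    have e2 : (fun x => Real.exp x * (u (Real.exp x) / Real.exp x))
        = fun x => u (Real.exp x) := by
      funext x
      have := (Real.exp_pos x).ne'
      field_simp
    rw [e1, e2]
  refine le_antisymm ?_ ?_
  · refine (iInf₂_le g h).trans ?_
    rw [if_neg (by norm_num), key g h]
  · refine le_iInf₂ fun g' hg' => ?_
    rw [if_neg (by norm_num), key g' hg']

lemma exists_hasWeakDeriv_of_xNorm_lt_top {m : ℕ} {p : ℝ≥0∞} {u : ℝ → ℝ} (h : xNorm m p u < ∞) :
    ∃ g, HasWeakDeriv u g := by
  by_contra hn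
  push Not at hn
  rw [xNorm] at h
  simp [hn] at h

lemma xNorm_top_le (m : ℕ) {u g : ℝ → ℝ} (h : HasWeakDeriv u g) {B : ℝ}
    (h1 : ∀ᵐ x, |Real.exp (-x) * u (Real.exp x)| ≤ B)
    (h2 : ∀ᵐ x, |Real.exp (-x) * (Real.exp x * g (Real.exp x))| ≤ B) :
    xNorm m ∞ u ≤ 2 * ENNReal.ofReal B := by
  refine (iInf₂_le g h).trans ?_
  rw [if_pos rfl, two_mul]
  refine add_le_add (eLpNorm_top_rdr_le ?_) (eLpNorm_top_rdr_le ?_)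
  · filter_upwards [h2] with x hx
    rwa [← mul_assoc, ← Real.exp_add, neg_add_cancel, Real.exp_zero, one_mul] at hx
  · filter_upwards [h1] with x hx
    rwa [div_eq_mul_inv, ← Real.exp_neg, mul_comm]

lemma HasWeakDeriv.exists_isPrimitiveOn {u g : ℝ → ℝ} (h : HasWeakDeriv u g) :
    ∃ w : ℝ → ℝ, IsPrimitiveOn univ w (fun x => Real.exp x * g (Real.exp x)) ∧
      ∀ᵐ x, u (Real.exp x) = w x := by
  obtain ⟨h1, h2⟩ := h.locallyIntegrable_log
  obtain ⟨h3, C, h4⟩ := exists_eq_add_integral_of_weak (I := univ) (c := 0) isOpen_univ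
    ordConnected_univ (mem_univ _) (h1.locallyIntegrableOn univ) (h2.locallyIntegrableOn univ)
    fun φ hφ _ => by simpa only [Measure.restrict_univ] using h.weak_log hφ
  rw [Measure.restrict_univ] at h4
  exact ⟨_, IsPrimitiveOn.intervalIntegral_self (fun a ha b hb => (h3 a ha b hb).1)
    (mem_univ 0) C, h4⟩

/-- Same argument as for `IsH1.sq_le`: otherwise |u| would stay above a positive constant and not be
integrable. -/
lemma IsPrimitiveOn.abs_le_integral {u g : ℝ → ℝ} (h : IsPrimitiveOn univ u g)
    (hu : Integrable u) (hg : Integrable g) (x : ℝ) : |u x| ≤ ∫ y, |g y| := by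
  by_contra hlt
  push Not at hlt
  have hlow : ∀ a, |u x| - ∫ y, |g y| ≤ |u a| := by
    intro a
    obtain ⟨j1, j2⟩ := h a (mem_univ _) x (mem_univ _)
    have h1 : |∫ t in a..x, g t| ≤ ∫ y, |g y| := by
      rw [← Real.norm_eq_abs]
      exact intervalIntegral.norm_integral_le_integral_norm_uIoc.trans
        (setIntegral_le_integral hg.norm (ae_of_all _ fun y => norm_nonneg _))
    rw [← j2] at h1
    have := abs_sub_abs_le_abs_sub (u x) (u a)
    linarith
  have : Integrable (fun _ : ℝ => |u x| - ∫ y, |g y|) := by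
    refine hu.norm.mono' aestronglyMeasurable_const (ae_of_all _ fun a => ?_)
    rw [Real.norm_of_nonneg (by linarith)]
    exact hlow a
  rw [integrable_const_iff] at this
  rcases this with h1 | h1
  · linarith
  · exact absurd h1.1 (by simp)

/-- `X¹` embeds into `L²(r dr)`. -/
lemma eLpNorm_exp_mul_le_xNorm_one {m : ℕ} (hm : 1 ≤ m) (u : ℝ → ℝ) :
    eLpNorm (fun x => Real.exp x * u (Real.exp x)) 2 volume ≤ xNorm m 1 u := by
  refine le_iInf₂ fun g h => ?_
  rw [if_neg (by norm_num)]
  simp only [ENNReal.toReal_one, ENNReal.rpow_one, div_one]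
  rw [eLpNorm_one_rdr, eLpNorm_one_rdr]
  set A := ∫⁻ x, ENNReal.ofReal (Real.exp (2 * x)) * ‖g (Real.exp x)‖ₑ with hA
  set B := ∫⁻ x, ENNReal.ofReal (Real.exp (2 * x)) * ‖u (Real.exp x) / Real.exp x‖ₑ with hB
  have hm' : A + B ≤ A + (m : ℝ≥0∞) * B := by
    gcongr
    exact le_mul_of_one_le_left' (by exact_mod_cast hm)
  refine le_trans ?_ hm'
  rcases eq_or_ne (A + B) ∞ with htop | htop
  · rw [htop]; exact le_top
  obtain ⟨hA', hB'⟩ := ENNReal.add_ne_top.1 htop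
  obtain ⟨w, hw, hwe⟩ := h.exists_isPrimitiveOn
  have eA : A = ∫⁻ x, ‖Real.exp x * (Real.exp x * g (Real.exp x))‖ₑ := by
    refine lintegral_congr fun x => ?_
    rw [← mul_assoc, enorm_mul, Real.enorm_of_nonneg (mul_pos (Real.exp_pos x) (Real.exp_pos x)).le,
      exp_two_mul, sq]
  have eB : B = ∫⁻ x, ‖Real.exp x * w x‖ₑ := by
    refine lintegral_congr_ae ?_
    filter_upwards [hwe] with x hx
    rw [hx, div_eq_mul_inv, ← Real.exp_neg, enorm_mul, enorm_mul, mul_comm ‖w x‖ₑ, ← mul_assoc,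
      Real.enorm_of_nonneg (Real.exp_pos _).le, ← ENNReal.ofReal_mul (Real.exp_pos _).le,
      ← Real.exp_add, Real.enorm_of_nonneg (Real.exp_pos _).le]
    ring_nf
  have hwc := hw.continuous
  have hWi : Integrable fun x => Real.exp x * w x := by
    refine ⟨Continuous.aestronglyMeasurable (by fun_prop), ?_⟩
    rw [HasFiniteIntegral, ← eB]
    exact lt_top_iff_ne_top.2 hB'
  have hGi : Integrable fun x => Real.exp x * (Real.exp x * g (Real.exp x)) := by
    refine ⟨(Real.continuous_exp.aestronglyMeasurable).mul
      h.locallyIntegrable_log.2.aestronglyMeasurable, ?_⟩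
    rw [HasFiniteIntegral, ← eA]
    exact lt_top_iff_ne_top.2 hA'
  have hp : IsPrimitiveOn univ (fun x => Real.exp x * w x)
      (fun x => Real.exp x * w x + Real.exp x * (Real.exp x * g (Real.exp x))) :=
    (IsPrimitiveOn.of_hasDerivAt ordConnected_univ (fun x _ => Real.hasDerivAt_exp x)
      Real.continuous_exp.continuousOn).mul ordConnected_univ hw
  -- The derivative of r u in x is r u + r² u_r, whose L¹(dx) norm is at most A + B. So r u is
  -- bounded by A + B, and ∫ (r u)² dx ≤ (A + B) ∫ |r u| dx.
  have hsup : ∀ x, ‖Real.exp x * w x‖ₑ ≤ A + B := by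
    intro x
    have hi : Integrable fun y => Real.exp y * w y + Real.exp y * (Real.exp y * g (Real.exp y)) :=
      hWi.add hGi
    have h1 := hp.abs_le_integral hWi hi x
    rw [Real.enorm_eq_ofReal_abs]
    refine (ENNReal.ofReal_le_ofReal h1).trans ?_
    rw [ofReal_integral_eq_lintegral_ofReal hi.abs (ae_of_all _ fun y => abs_nonneg _),
      eA, eB, add_comm, ← lintegral_add_left' hWi.1.enorm]
    refine lintegral_mono fun y => ?_
    rw [← Real.enorm_eq_ofReal_abs]
    exact enorm_add_le _ _
  rw [eLpNorm_eq_lintegral_rpow_enorm_toReal (by norm_num) (by norm_num)]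
  simp only [ENNReal.toReal_ofNat]
  have hsq : ∫⁻ x, ‖Real.exp x * u (Real.exp x)‖ₑ ^ (2 : ℝ) ≤ (A + B) ^ (2 : ℝ) := by
    calc ∫⁻ x, ‖Real.exp x * u (Real.exp x)‖ₑ ^ (2 : ℝ)
        = ∫⁻ x, ‖Real.exp x * w x‖ₑ ^ (2 : ℝ) := by
          refine lintegral_congr_ae ?_
          filter_upwards [hwe] with x hx
          rw [hx]
      _ ≤ ∫⁻ x, (A + B) * ‖Real.exp x * w x‖ₑ := by
          refine lintegral_mono fun x => ?_
          rw [ENNReal.rpow_two, sq]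
          gcongr
          exact hsup x
      _ = (A + B) * B := by rw [lintegral_const_mul' _ _ htop, ← eB]
      _ ≤ (A + B) ^ (2 : ℝ) := by
          rw [ENNReal.rpow_two, sq]
          gcongr
          exact le_add_self
  calc (∫⁻ x, ‖Real.exp x * u (Real.exp x)‖ₑ ^ (2 : ℝ)) ^ (1 / 2 : ℝ)
      ≤ ((A + B) ^ (2 : ℝ)) ^ (1 / 2 : ℝ) := ENNReal.rpow_le_rpow hsq (by norm_num)
    _ = A + B := by rw [← ENNReal.rpow_mul]; norm_num

end LogCoordinates

end HarmonicMapFlow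

/-! ### The profile in logarithmic coordinates and the equation as a primitive in time. -/

namespace HarmonicMapFlow

section Profile

/-- With y = e^{m(x - log s)} this is sin(π - 2 arctan y) = 2y/(1 + y²) = 1/cosh(log y). -/
lemma h_exp_div (m : ℕ) {s : ℝ} (hs : 0 < s) (x : ℝ) :
    h m (Real.exp x / s) = sech (m * (x - Real.log s)) := by
  have hy : (Real.exp x / s) ^ m = Real.exp (m * (x - Real.log s)) := by
    rw [← Real.exp_log hs, ← Real.exp_sub, ← Real.exp_nat_mul, Real.log_exp]
  rw [h, Q, hy, Real.sin_pi_sub, Real.sin_two_mul, Real.sin_arctan, Real.cos_arctan, sech,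
    Real.cosh_eq]
  set y := Real.exp (m * (x - Real.log s)) with hyd
  have hy0 : 0 < y := Real.exp_pos _
  rw [Real.exp_neg, ← hyd]
  have h1 : √(1 + y ^ 2) * √(1 + y ^ 2) = 1 + y ^ 2 := Real.mul_self_sqrt (by positivity)
  have h2 : 2 * (y / √(1 + y ^ 2)) * (1 / √(1 + y ^ 2)) = 2 * y / (1 + y ^ 2) := by
    rw [mul_one_div, ← mul_div_assoc, div_div, h1]
  rw [h2]
  field_simp
  ring

lemma cos_two_Q_exp_div (m : ℕ) {s : ℝ} (hs : 0 < s) (x : ℝ) :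
    Real.cos (2 * Q m (Real.exp x / s)) = 1 - 2 * sech (m * (x - Real.log s)) ^ 2 := by
  rw [← h_exp_div m hs, h, Real.cos_two_mul, ← Real.sin_sq_add_cos_sq (Q m (Real.exp x / s))]
  ring

/-- The first-order terms cancel after multiplication by r², and cos 2Q = 1 - 2 sin² Q produces the
Pöschl–Teller potential. -/
lemma linearizedOp_expTest (m : ℕ) {s : ℝ} (hs : 0 < s) {φ : ℝ → ℝ} (hφ : IsTest φ) (x : ℝ) :
    Real.exp (2 * x) * linearizedOp m s (expTest φ) (Real.exp x)
      = -deriv (deriv φ) x + m ^ 2 * φ x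
        - 2 * m ^ 2 * sech (m * (x - Real.log s)) ^ 2 * φ x := by
  have hx := Real.exp_pos x
  have h1 : deriv (deriv (expTest φ)) (Real.exp x)
      = (deriv (deriv φ) x - deriv φ x) / Real.exp x ^ 2 := by
    have he : deriv (expTest φ) =ᶠ[𝓝 (Real.exp x)] fun r => deriv φ (Real.log r) / r := by
      filter_upwards [Ioi_mem_nhds hx] with r hr
      exact deriv_expTest hφ hr
    rw [he.deriv_eq]
    have h2 := (hφ.deriv.hasDerivAt (Real.log (Real.exp x))).comp (Real.exp x)
      (Real.hasDerivAt_log hx.ne')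
    have h3 := (h2.div (hasDerivAt_id (Real.exp x)) hx.ne').deriv
    simp only [Function.comp_def, Real.log_exp, id] at h3
    refine Eq.trans ?_ (h3.trans ?_)
    · rfl
    · field_simp
  rw [linearizedOp, h1, deriv_expTest hφ hx, expTest_exp, Real.log_exp, cos_two_Q_exp_div m hs,
    exp_two_mul]
  field_simp
  ring

end Profile

section TimeEquation

/-- The open time interval `(0, T)`. -/
def openTime (T : ℝ≥0∞) : Set ℝ := {t | 0 < t ∧ ENNReal.ofReal t < T}

lemma isOpen_openTime (T : ℝ≥0∞) : IsOpen (openTime T) :=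
  (isOpen_lt continuous_const continuous_id).inter
    (isOpen_lt ENNReal.continuous_ofReal continuous_const)

lemma ordConnected_openTime (T : ℝ≥0∞) : OrdConnected (openTime T) :=
  ⟨fun _ hx _ hy _ hz => ⟨hx.1.trans_le hz.1, (ENNReal.ofReal_le_ofReal hz.2).trans_lt hy.2⟩⟩

lemma openTime_subset (T : ℝ≥0∞) : openTime T ⊆ timeInterval T := fun _ ht => ⟨ht.1.le, ht.2⟩

lemma spaceTime_eq (T : ℝ≥0∞) : spaceTime T = openTime T ×ˢ Ioi (0 : ℝ) := by
  ext z
  simp only [spaceTime, openTime, mem_prod, mem_ofPred_eq, mem_Ioi, and_assoc]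

lemma integrableOn_mul_of_compact {S K : Set (ℝ × ℝ)} {w M : ℝ × ℝ → ℝ}
    (hw : LocallyIntegrableOn w S) (hK : IsCompact K) (hKS : K ⊆ S) (hM : ContinuousOn M K)
    (h0 : ∀ z ∉ K, M z = 0) : Integrable fun z => w z * M z := by
  have h1 : IntegrableOn (fun z => w z * M z) K :=
    (hw.integrableOn_compact_subset hKS hK).mul_continuousOn hM hK
  rw [← integrableOn_iff_integrable_of_support_subset (s := K)]
  · exact h1
  · intro z hz
    by_contra hn
    exact hz (by simp [h0 z hn])

/-- Integrating a locally integrable function of space-time against a function of space. -/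
lemma locallyIntegrableOn_integral {I : Set ℝ} (hI : IsOpen I) {w M : ℝ × ℝ → ℝ}
    (hw : LocallyIntegrableOn w (I ×ˢ Ioi (0 : ℝ))) {K : Set ℝ} (hK : IsCompact K)
    (hK0 : K ⊆ Ioi 0) (hM : ContinuousOn M (I ×ˢ K)) (h0 : ∀ t, ∀ r ∉ K, M (t, r) = 0) :
    LocallyIntegrableOn (fun t => ∫ r in Ioi (0 : ℝ), w (t, r) * M (t, r)) I := by
  rw [locallyIntegrableOn_iff (hI.isLocallyClosed)]
  intro k hk hkc
  have h1 : IntegrableOn (fun z => w z * M z) (k ×ˢ K) :=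
    (hw.integrableOn_compact_subset (prod_mono hk hK0) (hkc.prod hK)).mul_continuousOn
      (hM.mono (prod_mono hk Subset.rfl)) (hkc.prod hK)
  have h2 : IntegrableOn (fun z => w z * M z) (k ×ˢ Ioi 0) := by
    refine h1.of_forall_sdiff_eq_zero (hkc.measurableSet.prod measurableSet_Ioi) fun z hz => ?_
    have : z.2 ∉ K := fun h => hz.2 ⟨hz.1.1, h⟩
    rw [show z = (z.1, z.2) from rfl, h0 _ _ this, mul_zero]
  rw [IntegrableOn, Measure.volume_eq_prod, ← Measure.prod_restrict] at h2
  exact h2.integral_prod_left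

variable {m : ℕ} {T : ℝ≥0∞} {s : ℝ → ℝ} {f : ℝ → ℝ → ℝ} {ξ₀ : ℝ → ℝ} {ξ : ℝ → ℝ → ℝ}

lemma continuous_Q (m : ℕ) : Continuous (Q m) := by
  unfold Q
  exact continuous_const.sub (continuous_const.mul (Real.continuous_arctan.comp (continuous_pow m)))

lemma linearizedOp_const_mul (m : ℕ) (s c : ℝ) (u : ℝ → ℝ) (r : ℝ) :
    linearizedOp m s (fun ρ => c * u ρ) r = c * linearizedOp m s u r := by
  have h1 : deriv (fun ρ => c * u ρ) = fun ρ => c * deriv u ρ := by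
    funext ρ; exact deriv_const_mul_field c
  rw [linearizedOp, linearizedOp, h1, deriv_const_mul_field]
  ring

/-- The equation tested against a function of `r` alone, in radial coordinates. -/
lemma IsLinearizedSolution.weak_radial (hsol : IsLinearizedSolution m T s f ξ₀ ξ)
    (hs : ∀ t ∈ timeInterval T, 0 < s t) (hsc : ContinuousOn s (timeInterval T))
    {ψ : ℝ → ℝ} (hψ : IsTest ψ) (hψ0 : tsupport ψ ⊆ Ioi 0) :
    LocallyIntegrableOn (fun t => (∫ r in Ioi (0 : ℝ), f t r * (ψ r * r))
      - ∫ r in Ioi (0 : ℝ), ξ t r * (linearizedOp m (s t) ψ r * r)) (openTime T) ∧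
    ∀ a : ℝ → ℝ, IsTest a → tsupport a ⊆ openTime T →
      ∫ t in openTime T, (∫ r in Ioi (0 : ℝ), ξ t r * (ψ r * r)) * deriv a t
        = -∫ t in openTime T, ((∫ r in Ioi (0 : ℝ), f t r * (ψ r * r))
          - ∫ r in Ioi (0 : ℝ), ξ t r * (linearizedOp m (s t) ψ r * r)) * a t := by
  set K := tsupport ψ with hK
  have hKc : IsCompact K := hψ.compact.isCompact
  have hψz : ∀ r ∉ K, ψ r = 0 := fun r hr => image_eq_zero_of_notMem_tsupport hr
  have hψ'z : ∀ r ∉ K, deriv ψ r = 0 := fun r hr =>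
    image_eq_zero_of_notMem_tsupport fun h => hr (tsupport_deriv_subset h)
  have hψ''z : ∀ r ∉ K, deriv (deriv ψ) r = 0 := fun r hr =>
    image_eq_zero_of_notMem_tsupport fun h =>
      hr (tsupport_deriv_subset (tsupport_deriv_subset h))
  have hξl : LocallyIntegrableOn (fun z : ℝ × ℝ => ξ z.1 z.2) (openTime T ×ˢ Ioi 0) :=
    spaceTime_eq T ▸ hsol.locInt
  have hfl : LocallyIntegrableOn (fun z : ℝ × ℝ => f z.1 z.2) (openTime T ×ˢ Ioi 0) :=
    spaceTime_eq T ▸ hsol.locInt_forcing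
  have hc1 : Continuous fun z : ℝ × ℝ => ψ z.2 * z.2 :=
    (hψ.continuous.comp continuous_snd).mul continuous_snd
  have hc2 : ContinuousOn (fun z : ℝ × ℝ => linearizedOp m (s z.1) ψ z.2 * z.2)
      (openTime T ×ˢ K) := by
    have hs1 : ContinuousOn (fun z : ℝ × ℝ => s z.1) (openTime T ×ˢ K) :=
      (hsc.mono (openTime_subset T)).comp continuousOn_fst fun z hz => hz.1
    have hr0 : ∀ z ∈ openTime T ×ˢ K, z.2 ≠ 0 := fun z hz => (hψ0 hz.2 : 0 < z.2).ne'
    have e1 : ContinuousOn (fun z : ℝ × ℝ => deriv (deriv ψ) z.2) (openTime T ×ˢ K) :=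
      (hψ.deriv.deriv.continuous.comp continuous_snd).continuousOn
    have e2 : ContinuousOn (fun z : ℝ × ℝ => deriv ψ z.2) (openTime T ×ˢ K) :=
      (hψ.deriv.continuous.comp continuous_snd).continuousOn
    have e3 : ContinuousOn (fun z : ℝ × ℝ => ψ z.2) (openTime T ×ˢ K) :=
      (hψ.continuous.comp continuous_snd).continuousOn
    have e4 : ContinuousOn (fun z : ℝ × ℝ => Real.cos (2 * Q m (z.2 / s z.1)))
        (openTime T ×ˢ K) := by
      refine Real.continuous_cos.comp_continuousOn (continuousOn_const.mul
        ((continuous_Q m).comp_continuousOn (continuousOn_snd.div hs1 fun z hz => ?_)))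
      exact (hs _ (openTime_subset T hz.1)).ne'
    unfold linearizedOp
    refine ContinuousOn.mul (ContinuousOn.add (ContinuousOn.sub e1.neg (ContinuousOn.mul ?_ e2))
      (ContinuousOn.mul (ContinuousOn.mul ?_ e4) e3)) continuousOn_snd
    · exact continuousOn_const.div continuousOn_snd hr0
    · exact continuousOn_const.div (continuousOn_snd.pow 2) fun z hz => pow_ne_zero 2 (hr0 z hz)
  have hz2 : ∀ t, ∀ r ∉ K, linearizedOp m (s t) ψ r * r = 0 := fun t r hr => by
    simp [linearizedOp, hψz r hr, hψ'z r hr, hψ''z r hr]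
  refine ⟨(locallyIntegrableOn_integral (isOpen_openTime T) hfl hKc hψ0 hc1.continuousOn
      fun t r hr => by simp [hψz r hr]).sub
    (locallyIntegrableOn_integral (isOpen_openTime T) hξl hKc hψ0 hc2 hz2), ?_⟩
  intro a ha ha0
  set A := tsupport a with hA
  have haz : ∀ t ∉ A, a t = 0 := fun t ht => image_eq_zero_of_notMem_tsupport ht
  have ha'z : ∀ t ∉ A, deriv a t = 0 := fun t ht =>
    image_eq_zero_of_notMem_tsupport fun h => ht (tsupport_deriv_subset h)
  have hAK : IsCompact (A ×ˢ K) := ha.compact.isCompact.prod hKc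
  have hAKS : A ×ˢ K ⊆ openTime T ×ˢ Ioi 0 := prod_mono ha0 hψ0
  have hzAK : ∀ {p q : ℝ → ℝ → ℝ}, (∀ t ∉ A, ∀ r, p t r = 0) → (∀ t, ∀ r ∉ K, q t r = 0) →
      ∀ z ∉ A ×ˢ K, p z.1 z.2 * q z.1 z.2 = 0 := by
    intro p q hp hq z hz
    by_cases h1 : z.1 ∈ A
    · have : z.2 ∉ K := fun h2 => hz ⟨h1, h2⟩
      rw [hq _ _ this, mul_zero]
    · rw [hp _ h1, zero_mul]
  have i1 : Integrable fun z : ℝ × ℝ => ξ z.1 z.2 * (deriv a z.1 * (ψ z.2 * z.2)) :=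
    integrableOn_mul_of_compact hξl hAK hAKS
      ((ha.deriv.continuous.comp continuous_fst).mul hc1).continuousOn
      (hzAK (p := fun t _ => deriv a t) (q := fun _ r => ψ r * r) (fun t ht _ => ha'z t ht)
        fun t r hr => by simp [hψz r hr])
  have i2 : Integrable fun z : ℝ × ℝ =>
      ξ z.1 z.2 * (a z.1 * (linearizedOp m (s z.1) ψ z.2 * z.2)) :=
    integrableOn_mul_of_compact hξl hAK hAKS
      ((ha.continuous.comp continuous_fst).continuousOn.mul
        (hc2.mono (prod_mono ha0 Subset.rfl)))
      (hzAK (p := fun t _ => a t) (q := fun t r => linearizedOp m (s t) ψ r * r)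
        (fun t ht _ => haz t ht) hz2)
  have i3 : Integrable fun z : ℝ × ℝ => f z.1 z.2 * (a z.1 * (ψ z.2 * z.2)) :=
    integrableOn_mul_of_compact hfl hAK hAKS
      ((ha.continuous.comp continuous_fst).mul hc1).continuousOn
      (hzAK (p := fun t _ => a t) (q := fun _ r => ψ r * r) (fun t ht _ => haz t ht)
        fun t r hr => by simp [hψz r hr])
  have hsupp : tsupport (fun z : ℝ × ℝ => a z.1 * ψ z.2) ⊆ A ×ˢ K :=
    closure_minimal (fun z hz => by_contra fun hn => hz
      (hzAK (p := fun t _ => a t) (q := fun _ r => ψ r) (fun t ht _ => haz t ht)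
        (fun t r hr => hψz r hr) z hn)) hAK.isClosed
  -- A product test function turns the space-time equation, by Fubini, into a weak equation in t for
  -- the pairing of ξ with ψ.
  have heq := hsol.equation (fun z => a z.1 * ψ z.2)
    ((ha.contDiff.comp contDiff_fst).mul (hψ.contDiff.comp contDiff_snd))
    (HasCompactSupport.of_support_subset_isCompact hAK ((subset_tsupport _).trans hsupp))
    (hsupp.trans (spaceTime_eq T ▸ hAKS))
  have hd : ∀ z : ℝ × ℝ, deriv (fun τ => a τ * ψ z.2) z.1 = deriv a z.1 * ψ z.2 := fun z =>
    deriv_mul_const_field _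
  simp only [hd, linearizedOp_const_mul] at heq
  have hfub : ∀ {F : ℝ × ℝ → ℝ}, Integrable F → ∫ z in spaceTime T, F z
      = ∫ t in openTime T, ∫ r in Ioi (0 : ℝ), F (t, r) := by
    intro F hF
    rw [spaceTime_eq, Measure.volume_eq_prod, setIntegral_prod]
    rw [← Measure.volume_eq_prod]
    exact hF.integrableOn
  have hinner : ∀ {F : ℝ × ℝ → ℝ}, Integrable F →
      IntegrableOn (fun t => ∫ r in Ioi (0 : ℝ), F (t, r)) (openTime T) := by
    intro F hF
    have h2 := hF.integrableOn (s := openTime T ×ˢ Ioi 0)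
    rw [IntegrableOn, Measure.volume_eq_prod, ← Measure.prod_restrict] at h2
    exact h2.integral_prod_left
  have e1 : ∀ z : ℝ × ℝ, ξ z.1 z.2 * (-(deriv a z.1 * ψ z.2)
      + a z.1 * linearizedOp m (s z.1) ψ z.2) * z.2
      = ξ z.1 z.2 * (a z.1 * (linearizedOp m (s z.1) ψ z.2 * z.2))
        - ξ z.1 z.2 * (deriv a z.1 * (ψ z.2 * z.2)) := fun z => by ring
  have e2 : ∀ z : ℝ × ℝ, f z.1 z.2 * (a z.1 * ψ z.2) * z.2
      = f z.1 z.2 * (a z.1 * (ψ z.2 * z.2)) := fun z => by ring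
  simp only [e1, e2] at heq
  rw [integral_sub i2.integrableOn i1.integrableOn, hfub i1, hfub i2, hfub i3] at heq
  have j2 := hinner i2
  have j3 := hinner i3
  have p1 : ∀ (w q : ℝ → ℝ) (c : ℝ), ∫ r in Ioi (0 : ℝ), w r * (c * q r)
      = (∫ r in Ioi (0 : ℝ), w r * q r) * c := fun w q c => by
    rw [← integral_mul_const]
    refine integral_congr_ae (ae_of_all _ fun r => ?_)
    simp only; ring
  simp only [p1 (fun r => ξ _ r) (fun r => ψ r * r), p1 (fun r => f _ r) (fun r => ψ r * r),
    p1 (fun r => ξ _ r) (fun r => linearizedOp m (s _) ψ r * r)] at heq j2 j3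
  simp only [sub_mul]
  rw [integral_sub j3 j2]
  linarith

/-- The equation tested against a function of the logarithmic variable. -/
theorem IsLinearizedSolution.time_equation (hsol : IsLinearizedSolution m T s f ξ₀ ξ)
    (hs : ∀ t ∈ timeInterval T, 0 < s t) (hsc : ContinuousOn s (timeInterval T))
    {φ : ℝ → ℝ} (hφ : IsTest φ)
    (hF : ContinuousOn (fun t => ∫ x, ξ t (Real.exp x) * (Real.exp (2 * x) * φ x)) (openTime T)) :
    IsPrimitiveOn (openTime T) (fun t => ∫ x, ξ t (Real.exp x) * (Real.exp (2 * x) * φ x))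
      (fun t => (∫ x, f t (Real.exp x) * (Real.exp (2 * x) * φ x))
        - ∫ x, ξ t (Real.exp x) * (-deriv (deriv φ) x + m ^ 2 * φ x
          - 2 * m ^ 2 * sech (m * (x - Real.log (s t))) ^ 2 * φ x)) := by
  rcases (openTime T).eq_empty_or_nonempty with hem | ⟨c, hc⟩
  · rw [hem]; intro a ha; exact absurd ha (notMem_empty a)
  obtain ⟨hψ, hψ0⟩ := hφ.expTest
  obtain ⟨hl, hw⟩ := hsol.weak_radial hs hsc hψ hψ0
  have e1 : ∀ w : ℝ → ℝ, ∫ r in Ioi (0 : ℝ), w r * (expTest φ r * r)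
      = ∫ x, w (Real.exp x) * (Real.exp (2 * x) * φ x) := fun w => by
    rw [integral_Ioi_eq]
    refine integral_congr_ae (ae_of_all _ fun x => ?_)
    simp only [expTest_exp, exp_two_mul]; ring
  have e2 : ∀ t ∈ openTime T, ∫ r in Ioi (0 : ℝ), ξ t r * (linearizedOp m (s t) (expTest φ) r * r)
      = ∫ x, ξ t (Real.exp x) * (-deriv (deriv φ) x + m ^ 2 * φ x
          - 2 * m ^ 2 * sech (m * (x - Real.log (s t))) ^ 2 * φ x) := fun t ht => by
    rw [integral_Ioi_eq]
    refine integral_congr_ae (ae_of_all _ fun x => ?_)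
    simp only [← linearizedOp_expTest m (hs t (openTime_subset T ht)) hφ, exp_two_mul]; ring
  simp only [e1] at hl hw
  obtain ⟨h1, C, h2⟩ := exists_eq_add_integral_of_weak (isOpen_openTime T)
    (ordConnected_openTime T) hc (hF.locallyIntegrableOn (isOpen_openTime T).measurableSet) hl hw
  have h3 := IsPrimitiveOn.intervalIntegral_self (fun a ha b hb => (h1 a ha b hb).1) hc C
  have hcont : ContinuousOn (fun t => C + ∫ τ in c..t, ((∫ x, f τ (Real.exp x) *
      (Real.exp (2 * x) * φ x)) - ∫ r in Ioi (0 : ℝ), ξ τ r *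
      (linearizedOp m (s τ) (expTest φ) r * r))) (openTime T) := by
    intro t ht
    obtain ⟨ε, hε, hεI⟩ := Metric.isOpen_iff.1 (isOpen_openTime T) t ht
    have ha : t - ε / 2 ∈ openTime T := hεI (by
      rw [Metric.mem_ball, Real.dist_eq, abs_lt]; constructor <;> linarith)
    have hb : t + ε / 2 ∈ openTime T := hεI (by
      rw [Metric.mem_ball, Real.dist_eq, abs_lt]; constructor <;> linarith)
    refine ((h3.continuousOn (ordConnected_openTime T) ha hb).continuousAt ?_).continuousWithinAt
    rw [uIcc_of_le (by linarith)]
    exact Icc_mem_nhds (by linarith) (by linarith)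
  -- The pairing is continuous in time, so its almost everywhere equality with a primitive holds at
  -- every time.
  have heq := Measure.eqOn_open_of_ae_eq h2 (isOpen_openTime T) hF hcont
  intro a ha b hb
  obtain ⟨h4, h5⟩ := h3 a ha b hb
  have hsub : uIoc a b ⊆ openTime T :=
    uIoc_subset_uIcc.trans ((ordConnected_openTime T).uIcc_subset ha hb)
  refine ⟨h4.congr fun t ht => ?_, ?_⟩
  · simp only [e2 t (hsub ht)]
  · have ea := heq ha
    have eb := heq hb
    simp only at ea eb h5 ⊢
    rw [ea, eb, h5]
    refine intervalIntegral.integral_congr_ae (ae_of_all _ fun t ht => ?_)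
    simp only [e2 t (hsub ht)]

end TimeEquation

end HarmonicMapFlow

/-! ### Riesz representation of time averages; pairs in L² × L². -/

namespace HarmonicMapFlow

section Riesz

variable {V E : Type*} [AddCommGroup V] [Module ℝ V] [NormedAddCommGroup E] [InnerProductSpace ℝ E]
  [CompleteSpace E]

/-- Riesz representation of a functional which is bounded with respect to a linear map. -/
lemma exists_inner_eq_of_abs_le (ι : V →ₗ[ℝ] E) (Λ : V →ₗ[ℝ] ℝ) {C : ℝ}
    (hC : 0 ≤ C) (h : ∀ v, |Λ v| ≤ C * ‖ι v‖) : ∃ e : E, ‖e‖ ≤ C ∧ ∀ v, inner ℝ e (ι v) = Λ v := by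
  have hker : LinearMap.ker ι ≤ LinearMap.ker Λ := fun v hv => by
    rw [LinearMap.mem_ker] at hv ⊢
    have := h v
    rw [hv, norm_zero, mul_zero] at this
    exact abs_nonpos_iff.1 this
  let g : LinearMap.range ι →ₗ[ℝ] ℝ :=
    ((LinearMap.ker ι).liftQ Λ hker) ∘ₗ (ι.quotKerEquivRange.symm : _ →ₗ[ℝ] _)
  have hg : ∀ v, g ⟨ι v, LinearMap.mem_range_self ι v⟩ = Λ v := fun v => by
    simp only [g, LinearMap.comp_apply, LinearEquiv.coe_coe]
    rw [show (⟨ι v, LinearMap.mem_range_self ι v⟩ : LinearMap.range ι)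
      = ι.quotKerEquivRange ((LinearMap.ker ι).mkQ v) from rfl, LinearEquiv.symm_apply_apply]
    rfl
  have hb : ∀ x : LinearMap.range ι, ‖g x‖ ≤ C * ‖x‖ := by
    rintro ⟨_, v, rfl⟩
    rw [hg]
    exact h v
  -- The bound makes Λ factor through the range of ι, on which it is continuous; Hahn–Banach extends
  -- it to all of E with the same norm.
  obtain ⟨G, hG1, hG2⟩ := exists_extension_norm_eq (LinearMap.range ι) (g.mkContinuous C hb)
  refine ⟨(InnerProductSpace.toDual ℝ E).symm G, ?_, fun v => ?_⟩
  · rw [LinearIsometryEquiv.norm_map, hG2]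
    exact g.mkContinuous_norm_le hC hb
  · rw [InnerProductSpace.toDual_symm_apply, ← hg v]
    exact hG1 ⟨ι v, LinearMap.mem_range_self ι v⟩

/-- The time average of a family of functionals, bounded by a possibly non-measurable function, is
represented by a vector. -/
lemma exists_inner_eq_average (ι : V →ₗ[ℝ] E) (L : ℝ → V → ℝ) (N : ℝ → ℝ≥0∞) {a b : ℝ}
    (hab : a < b) (hL : ∀ v, IntegrableOn (fun τ => L τ v) (Ioc a b))
    (hadd : ∀ v w, ∀ᵐ τ ∂volume.restrict (Ioc a b), L τ (v + w) = L τ v + L τ w)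
    (hsmul : ∀ (c : ℝ) v, ∀ᵐ τ ∂volume.restrict (Ioc a b), L τ (c • v) = c * L τ v)
    (hN : ∀ τ ∈ Ioc a b, ∀ v, ‖L τ v‖ₑ ≤ N τ * ‖ι v‖ₑ) (hfin : ∫⁻ τ in Ioc a b, N τ ≠ ∞) :
    ∃ e : E, ‖e‖ ≤ (b - a)⁻¹ * (∫⁻ τ in Ioc a b, N τ).toReal ∧
      ∀ v, inner ℝ e (ι v) = (b - a)⁻¹ * ∫ τ in Ioc a b, L τ v := by
  have hba : 0 < (b - a)⁻¹ := inv_pos.2 (sub_pos.2 hab)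
  let Λ : V →ₗ[ℝ] ℝ :=
    { toFun := fun v => (b - a)⁻¹ * ∫ τ in Ioc a b, L τ v
      map_add' := fun v w => by
        rw [← mul_add, ← integral_add (hL v) (hL w), integral_congr_ae (hadd v w)]
      map_smul' := fun c v => by
        rw [integral_congr_ae (hsmul c v), integral_const_mul, RingHom.id_apply, smul_eq_mul]
        ring }
  refine exists_inner_eq_of_abs_le ι Λ (mul_nonneg hba.le ENNReal.toReal_nonneg) fun v => ?_
  show |(b - a)⁻¹ * ∫ τ in Ioc a b, L τ v| ≤ _
  rw [abs_mul, abs_of_pos hba, mul_assoc]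
  refine mul_le_mul_of_nonneg_left ?_ hba.le
  have h1 : ‖∫ τ in Ioc a b, L τ v‖ₑ ≤ (∫⁻ τ in Ioc a b, N τ) * ‖ι v‖ₑ := by
    refine (enorm_integral_le_lintegral_enorm _).trans ?_
    rw [← lintegral_mul_const' _ _ enorm_ne_top]
    exact setLIntegral_mono' measurableSet_Ioc fun τ hτ => hN τ hτ v
  have h2 := ENNReal.toReal_mono (ENNReal.mul_ne_top hfin enorm_ne_top) h1
  rwa [ENNReal.toReal_mul, toReal_enorm, toReal_enorm, Real.norm_eq_abs] at h2

/-- The Cauchy–Schwarz inequality for lower integrals. -/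
lemma sq_lintegral_le (N : ℝ → ℝ≥0∞) {a b : ℝ} :
    (∫⁻ τ in Ioc a b, N τ) ^ 2 ≤ ENNReal.ofReal (b - a) * ∫⁻ τ in Ioc a b, N τ ^ 2 := by
  -- Hölder's inequality requires measurability, so N is replaced by a measurable minorant with the
  -- same lower integral.
  obtain ⟨g, hg, hgN, he⟩ := exists_measurable_le_lintegral_eq (μ := volume.restrict (Ioc a b)) N
  rw [he]
  have h1 := ENNReal.lintegral_mul_le_Lp_mul_Lq (volume.restrict (Ioc a b))
    Real.HolderConjugate.two_two (f := fun _ => 1) (g := g) aemeasurable_const hg.aemeasurable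
  simp only [Pi.mul_def, one_mul, ENNReal.one_rpow, lintegral_const, Measure.restrict_apply_univ,
    Real.volume_Ioc] at h1
  have hsq : ∀ x : ℝ≥0∞, (x ^ (1 / 2 : ℝ)) ^ 2 = x := fun x => by
    rw [← ENNReal.rpow_natCast, ← ENNReal.rpow_mul]; norm_num
  refine (pow_le_pow_left₀ zero_le h1 2).trans ?_
  rw [mul_pow, hsq, hsq]
  gcongr with τ
  simp only [ENNReal.rpow_ofNat]
  gcongr
  exact hgN τ

end Riesz

section Pairs

/-- Square integrable functions of the logarithmic variable. -/
abbrev L2 : Type := Lp ℝ 2 (volume : Measure ℝ)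

/-- Pairs of square integrable functions, for a function and its derivative. -/
abbrev L2Pair : Type := WithLp 2 (L2 × L2)

open Classical in
/-- The class of a square integrable function, and `0` for all other functions. -/
noncomputable def toL2 (ψ : ℝ → ℝ) : L2 := if h : MemLp ψ 2 volume then h.toLp ψ else 0

lemma coeFn_toL2 {ψ : ℝ → ℝ} (h : MemLp ψ 2 volume) : toL2 ψ =ᵐ[volume] ψ := by
  rw [toL2, dif_pos h]
  exact h.coeFn_toLp

lemma toL2_add {ψ χ : ℝ → ℝ} (h : MemLp ψ 2 volume) (h' : MemLp χ 2 volume) :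
    toL2 (fun x => ψ x + χ x) = toL2 ψ + toL2 χ := by
  have h2 : MemLp (fun x => ψ x + χ x) 2 volume := h.add h'
  rw [toL2, toL2, toL2, dif_pos h, dif_pos h', dif_pos h2]
  rfl

lemma toL2_const_mul {ψ : ℝ → ℝ} (h : MemLp ψ 2 volume) (c : ℝ) :
    toL2 (fun x => c * ψ x) = c • toL2 ψ := by
  have h2 : MemLp (fun x => c * ψ x) 2 volume := h.const_mul c
  rw [toL2, toL2, dif_pos h, dif_pos h2]
  rfl

lemma toL2_sub {ψ χ : ℝ → ℝ} (h : MemLp ψ 2 volume) (h' : MemLp χ 2 volume) :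
    toL2 (fun x => ψ x - χ x) = toL2 ψ - toL2 χ := by
  have h2 : MemLp (fun x => ψ x - χ x) 2 volume := h.sub h'
  rw [toL2, toL2, toL2, dif_pos h, dif_pos h', dif_pos h2]
  rfl

lemma enorm_toL2 {ψ : ℝ → ℝ} (h : MemLp ψ 2 volume) : ‖toL2 ψ‖ₑ = eLpNorm ψ 2 volume := by
  rw [toL2, dif_pos h, Lp.enorm_toLp]

lemma inner_L2 (F G : L2) : inner ℝ F G = ∫ x, F x * G x := by
  rw [L2.inner_def]
  refine integral_congr_ae (ae_of_all _ fun x => ?_)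
  simp [mul_comm]

lemma inner_toL2 (F : L2) {ψ : ℝ → ℝ} (h : MemLp ψ 2 volume) :
    inner ℝ F (toL2 ψ) = ∫ x, F x * ψ x := by
  rw [inner_L2]
  refine integral_congr_ae ?_
  filter_upwards [coeFn_toL2 h] with x hx
  rw [hx]

lemma L2_norm_sq (F : L2) : ‖F‖ ^ 2 = ∫ x, F x ^ 2 := by
  rw [← real_inner_self_eq_norm_sq, inner_L2]
  simp only [sq]

/-- The pair of classes of two functions. -/
noncomputable def toPair (a b : ℝ → ℝ) : L2Pair := WithLp.toLp 2 (toL2 a, toL2 b)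

lemma inner_toPair (P : L2Pair) {a b : ℝ → ℝ} (ha : MemLp a 2 volume) (hb : MemLp b 2 volume) :
    inner ℝ P (toPair a b) = (∫ x, P.fst x * a x) + ∫ x, P.snd x * b x := by
  rw [WithLp.prod_inner_apply]
  exact congrArg₂ (· + ·) (inner_toL2 _ ha) (inner_toL2 _ hb)

/-- The first component is the derivative of `κ⁻¹` times the second one. -/
def IsWeakPair (κ : ℝ) (P : L2Pair) : Prop :=
  ∀ φ, IsTest φ → inner ℝ P (toPair (fun x => κ * φ x) (deriv φ)) = 0

lemma IsTest.const_mul {φ : ℝ → ℝ} (h : IsTest φ) (c : ℝ) : IsTest (fun x => c * φ x) :=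
  h.contDiff_mul contDiff_const

lemma IsTest.add {φ ψ : ℝ → ℝ} (h : IsTest φ) (h' : IsTest ψ) : IsTest (fun x => φ x + ψ x) :=
  ⟨h.contDiff.add h'.contDiff, h.compact.add h'.compact⟩

/-- A pair stands for (u', κ u), so that its squared norm is the energy ∫ u'² + κ² u². The du
Bois-Reymond lemma recovers u from the weak relation, which is closed under linear combinations and
time averages. -/
lemma IsWeakPair.exists_isH1 {κ : ℝ} (hκ : κ ≠ 0) {P : L2Pair} (h : IsWeakPair κ P) :
    ∃ u u₁ : ℝ → ℝ, IsH1 u u₁ ∧ P.fst =ᵐ[volume] u₁ ∧ P.snd =ᵐ[volume] fun x => κ * u x := by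
  have h0 : MemLp P.snd 2 volume := Lp.memLp _
  have h1 : MemLp P.fst 2 volume := Lp.memLp _
  have l0 := h0.locallyIntegrable one_le_two
  have l1 := h1.locallyIntegrable one_le_two
  obtain ⟨h3, C, h4⟩ := exists_eq_add_integral_of_weak (I := univ) (c := 0)
    (u := fun x => κ⁻¹ * P.snd x) (g := P.fst) isOpen_univ
    ordConnected_univ (mem_univ _) ((l0.smul κ⁻¹).locallyIntegrableOn univ)
    (l1.locallyIntegrableOn univ) fun φ hφ _ => by
      have := h φ hφ
      rw [inner_toPair P ((hφ.memLp 2).const_mul κ) (hφ.deriv.memLp 2)] at this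
      have e1 : ∫ x, P.fst x * (κ * φ x) = κ * ∫ x, P.fst x * φ x := by
        rw [← integral_const_mul]
        exact integral_congr_ae (ae_of_all _ fun x => by simp only; ring)
      have e2 : ∫ x, κ⁻¹ * P.snd x * deriv φ x = κ⁻¹ * ∫ x, P.snd x * deriv φ x := by
        rw [← integral_const_mul]
        exact integral_congr_ae (ae_of_all _ fun x => by simp only; ring)
      rw [e1] at this
      simp only [Measure.restrict_univ]
      rw [e2]
      field_simp
      linarith
  rw [Measure.restrict_univ] at h4
  refine ⟨_, _, ⟨?_, h1, IsPrimitiveOn.intervalIntegral_self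
    (fun a ha b hb => (h3 a ha b hb).1) (mem_univ 0) C⟩, ae_eq_refl _, ?_⟩
  · exact (h0.const_mul κ⁻¹).ae_eq h4
  · filter_upwards [h4] with x hx
    rw [← hx]
    field_simp

lemma IsWeakPair.sub {κ : ℝ} {P P' : L2Pair} (h : IsWeakPair κ P) (h' : IsWeakPair κ P') :
    IsWeakPair κ (P - P') := fun φ hφ => by
  rw [inner_sub_left, h φ hφ, h' φ hφ, sub_zero]

lemma IsWeakPair.smul {κ : ℝ} {P : L2Pair} (h : IsWeakPair κ P) (c : ℝ) :
    IsWeakPair κ (c • P) := fun φ hφ => by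
  rw [real_inner_smul_left, h φ hφ, mul_zero]

lemma isWeakPair_toPair {κ : ℝ} {u u₁ : ℝ → ℝ} (hu : MemLp u 2 volume) (hu₁ : MemLp u₁ 2 volume)
    (h : ∀ φ, IsTest φ → ∫ x, u x * deriv φ x = -∫ x, u₁ x * φ x) :
    IsWeakPair κ (toPair u₁ (fun x => κ * u x)) := fun φ hφ => by
  rw [inner_toPair _ ((hφ.memLp 2).const_mul κ) (hφ.deriv.memLp 2)]
  have e1 : ∫ x, (toPair u₁ fun x => κ * u x).fst x * (κ * φ x) = κ * ∫ x, u₁ x * φ x := by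
    rw [← integral_const_mul]
    refine integral_congr_ae ?_
    filter_upwards [coeFn_toL2 hu₁] with x hx
    simp only [toPair, WithLp.toLp_fst, hx]; ring
  have e2 : ∫ x, (toPair u₁ fun x => κ * u x).snd x * deriv φ x = κ * ∫ x, u x * deriv φ x := by
    rw [← integral_const_mul]
    refine integral_congr_ae ?_
    filter_upwards [coeFn_toL2 (hu.const_mul κ)] with x hx
    simp only [toPair, WithLp.toLp_snd, hx]; ring
  rw [e1, e2, h φ hφ]
  ring

end Pairs

end HarmonicMapFlow

/-! ### Local integrability in space-time. -/

namespace HarmonicMapFlow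

section LocalIntegrability

variable {m : ℕ} {T : ℝ≥0∞}

/-- Integrals of a locally integrable function of space-time along the logarithmic variable. -/
lemma integrable_pairing {f : ℝ → ℝ → ℝ}
    (hf : LocallyIntegrableOn (fun z : ℝ × ℝ => f z.1 z.2) (spaceTime T)) {M : ℝ → ℝ → ℝ}
    {a b : ℝ} (hM : ContinuousOn (fun z : ℝ × ℝ => M z.1 z.2) (Icc a b ×ˢ univ)) {K : Set ℝ}
    (hK : IsCompact K) (h0 : ∀ t, ∀ x ∉ K, M t x = 0) (hab : Icc a b ⊆ openTime T) :
    IntegrableOn (fun τ => ∫ x, f τ (Real.exp x) * M τ x) (Ioc a b) ∧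
      ∀ᵐ τ ∂volume.restrict (Ioc a b), Integrable fun x => f τ (Real.exp x) * M τ x := by
  set K' := Real.exp '' K with hK'
  have hK'c : IsCompact K' := hK.image Real.continuous_exp
  have hK'0 : K' ⊆ Ioi 0 := by rintro _ ⟨x, -, rfl⟩; exact Real.exp_pos x
  set N : ℝ × ℝ → ℝ := fun z => if 0 < z.2 then M z.1 (Real.log z.2) / z.2 else 0 with hN
  have hNexp : ∀ τ x, N (τ, Real.exp x) = M τ x / Real.exp x := fun τ x => by
    simp [hN, Real.exp_pos]
  have hNc : ContinuousOn N (Icc a b ×ˢ K') := by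
    have h1 : ContinuousOn (fun z : ℝ × ℝ => M z.1 (Real.log z.2) / z.2) (Icc a b ×ˢ K') := by
      have hne : ∀ z ∈ Icc a b ×ˢ K', z.2 ≠ 0 := fun z hz => (hK'0 hz.2 : 0 < z.2).ne'
      refine ContinuousOn.div ?_ continuousOn_snd hne
      have h2 : ContinuousOn (fun z : ℝ × ℝ => (z.1, Real.log z.2)) (Icc a b ×ˢ K') :=
        continuousOn_fst.prodMk (continuousOn_snd.log hne)
      exact hM.comp h2 fun z hz => ⟨hz.1, mem_univ _⟩
    exact h1.congr fun z hz => by simp only [hN, if_pos (show 0 < z.2 from hK'0 hz.2)]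
  have hN0 : ∀ z : ℝ × ℝ, z.2 ∈ Ioi (0 : ℝ) → z.2 ∉ K' → N z = 0 := fun z hz hzK => by
    have : Real.log z.2 ∉ K := fun h => hzK ⟨_, h, Real.exp_log hz⟩
    simp [hN, h0 _ _ this]
  have h1 : IntegrableOn (fun z : ℝ × ℝ => f z.1 z.2 * N z) (Icc a b ×ˢ K') :=
    (hf.integrableOn_compact_subset (spaceTime_eq T ▸ prod_mono hab hK'0)
      (isCompact_Icc.prod hK'c)).mul_continuousOn hNc (isCompact_Icc.prod hK'c)
  have h2 : IntegrableOn (fun z : ℝ × ℝ => f z.1 z.2 * N z) (Icc a b ×ˢ Ioi 0) := by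
    refine h1.of_forall_sdiff_eq_zero (measurableSet_Icc.prod measurableSet_Ioi) fun z hz => ?_
    have : z.2 ∉ K' := fun h => hz.2 ⟨hz.1.1, h⟩
    rw [hN0 z hz.1.2 this, mul_zero]
  have h3 := h2.mono_set (prod_mono_left (t := Ioi (0 : ℝ)) (Ioc_subset_Icc_self (a := a) (b := b)))
  rw [IntegrableOn, Measure.volume_eq_prod, ← Measure.prod_restrict] at h3
  have e1 : ∀ τ x, Real.exp x * (f τ (Real.exp x) * N (τ, Real.exp x))
      = f τ (Real.exp x) * M τ x := fun τ x => by
    rw [hNexp]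
    have := (Real.exp_pos x).ne'
    field_simp
  constructor
  · have h4 := h3.integral_prod_left
    simp only [integral_Ioi_eq, e1] at h4
    exact h4
  · filter_upwards [h3.prod_right_ae] with τ hτ
    have h5 : IntegrableOn (fun r => f τ r * N (τ, r)) (Real.exp '' univ) := by
      rw [range_exp_eq]; exact hτ
    rw [integrableOn_image_iff_integrableOn_abs_deriv_smul MeasurableSet.univ
      (fun x _ => (Real.hasDerivAt_exp x).hasDerivWithinAt) Real.exp_injective.injOn,
      integrableOn_univ] at h5
    simpa only [Real.abs_exp, smul_eq_mul, e1] using h5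

lemma lintegral_image_exp_le {u : ℝ → ℝ} {R : ℝ}
    (hu : AEStronglyMeasurable (fun x => Real.exp x * u (Real.exp x)) volume) :
    ∫⁻ r in Real.exp '' Icc (-R) R, ‖u r‖ₑ ≤ ENNReal.ofReal (2 * R) ^ (1 / 2 : ℝ)
      * eLpNorm (fun x => Real.exp x * u (Real.exp x)) 2 (volume.restrict (Icc (-R) R)) := by
  rw [lintegral_image_eq_lintegral_abs_deriv_mul measurableSet_Icc
    (fun x _ => (Real.hasDerivAt_exp x).hasDerivWithinAt) Real.exp_injective.injOn]
  have h1 := ENNReal.lintegral_mul_le_Lp_mul_Lq (volume.restrict (Icc (-R) R))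
    Real.HolderConjugate.two_two (f := fun _ => 1)
    (g := fun x => ‖Real.exp x * u (Real.exp x)‖ₑ) aemeasurable_const hu.restrict.enorm
  simp only [Pi.mul_def, one_mul, ENNReal.one_rpow, lintegral_const, Measure.restrict_apply_univ,
    Real.volume_Icc] at h1
  rw [eLpNorm_eq_lintegral_rpow_enorm_toReal (by norm_num) (by norm_num)]
  refine (le_of_eq (lintegral_congr fun x => ?_)).trans (h1.trans (le_of_eq ?_))
  · rw [enorm_mul, Real.abs_exp, Real.enorm_of_nonneg (Real.exp_pos x).le]
  · rw [show R - -R = 2 * R by ring]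
    simp

/-- Cauchy–Schwarz on a bounded window of x. It shows that a part of the forcing with finite mixed
norm is locally integrable, so that each part can be tested separately. The summand 1 keeps the
constant positive, so the right-hand side is ∞ whenever the norm is. -/
lemma exists_lintegral_le_xNorm_two (hm : 1 ≤ m) (R : ℝ) : ∃ C : ℝ≥0, C ≠ 0 ∧ ∀ u : ℝ → ℝ,
    ∫⁻ r in Real.exp '' Icc (-R) R, ‖u r‖ₑ ≤ C * xNorm m 2 u := by
  refine ⟨(2 * R).toNNReal ^ (1 / 2 : ℝ) * (Real.exp R).toNNReal + 1, by positivity, fun u => ?_⟩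
  by_cases hx : xNorm m 2 u = ∞
  · rw [hx, ENNReal.mul_top (by positivity)]; exact le_top
  obtain ⟨g, hg⟩ := exists_hasWeakDeriv_of_xNorm_lt_top (lt_top_iff_ne_top.2 hx)
  have hme := (locallyIntegrable_comp_exp hg.locInt Real.continuous_exp).aestronglyMeasurable
  refine (lintegral_image_exp_le hme).trans ?_
  have h1 : eLpNorm (fun x => Real.exp x * u (Real.exp x)) 2 (volume.restrict (Icc (-R) R))
      ≤ ENNReal.ofReal (Real.exp R) * eLpNorm (fun x => u (Real.exp x)) 2 volume := by
    refine (eLpNorm_le_mul_eLpNorm_of_ae_le_mul (c := Real.exp R) (g := fun x => u (Real.exp x))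
      ?_ 2).trans (by gcongr; exact Measure.restrict_le_self)
    filter_upwards [ae_restrict_mem measurableSet_Icc] with x hx
    rw [norm_mul, Real.norm_of_nonneg (Real.exp_pos x).le]
    gcongr
    exact hx.2
  have h2 : eLpNorm (fun x => u (Real.exp x)) 2 volume ≤ xNorm m 2 u := by
    rw [xNorm_two_eq m hg]
    set B := eLpNorm (fun x => u (Real.exp x)) 2 volume
    calc B = (B ^ (2 : ℝ)) ^ (1 / 2 : ℝ) := by rw [← ENNReal.rpow_mul]; norm_num
      _ ≤ _ := by
        gcongr
        refine le_add_left ?_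
        refine le_mul_of_one_le_left' ?_
        refine ENNReal.one_le_rpow ?_ (by norm_num)
        exact_mod_cast hm
  calc _ ≤ ENNReal.ofReal (2 * R) ^ (1 / 2 : ℝ) * (ENNReal.ofReal (Real.exp R) * xNorm m 2 u) := by
        gcongr; exact h1.trans (by gcongr)
    _ = ↑((2 * R).toNNReal ^ (1 / 2 : ℝ) * (Real.exp R).toNNReal) * xNorm m 2 u := by
        rw [← mul_assoc, ENNReal.coe_mul, ENNReal.coe_rpow_of_nonneg _ (by norm_num)]; rfl
    _ ≤ _ := by gcongr; exact le_self_add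

lemma exists_lintegral_le_xNorm_one (hm : 1 ≤ m) (R : ℝ) : ∃ C : ℝ≥0, C ≠ 0 ∧ ∀ u : ℝ → ℝ,
    ∫⁻ r in Real.exp '' Icc (-R) R, ‖u r‖ₑ ≤ C * xNorm m 1 u := by
  refine ⟨(2 * R).toNNReal ^ (1 / 2 : ℝ) + 1, by positivity, fun u => ?_⟩
  by_cases hx : xNorm m 1 u = ∞
  · rw [hx, ENNReal.mul_top (by positivity)]; exact le_top
  obtain ⟨g, hg⟩ := exists_hasWeakDeriv_of_xNorm_lt_top (lt_top_iff_ne_top.2 hx)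
  have hme := (locallyIntegrable_comp_exp hg.locInt Real.continuous_exp).aestronglyMeasurable
  refine (lintegral_image_exp_le hme).trans ?_
  calc _ ≤ ENNReal.ofReal (2 * R) ^ (1 / 2 : ℝ) * xNorm m 1 u := by
        gcongr
        exact (eLpNorm_mono_measure _ Measure.restrict_le_self).trans
          (eLpNorm_exp_mul_le_xNorm_one hm u)
    _ = ↑((2 * R).toNNReal ^ (1 / 2 : ℝ)) * xNorm m 1 u := by
        rw [ENNReal.coe_rpow_of_nonneg _ (by norm_num)]; rfl
    _ ≤ _ := by gcongr; exact le_self_add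

/-- A measurable function of space-time is locally integrable when its local integrals in space are
bounded by an integrable function of time. -/
lemma locallyIntegrableOn_of_lintegral_le {f : ℝ → ℝ → ℝ} {N : ℝ → ℝ≥0∞}
    (hf : AEStronglyMeasurable (fun z : ℝ × ℝ => f z.1 z.2) (volume.restrict (spaceTime T)))
    (hN : ∀ a b, Icc a b ⊆ openTime T → ∫⁻ t in Icc a b, N t ≠ ∞)
    (hfN : ∀ R : ℝ, ∃ C : ℝ≥0, ∀ t, ∫⁻ r in Real.exp '' Icc (-R) R, ‖f t r‖ₑ ≤ C * N t) :
    LocallyIntegrableOn (fun z : ℝ × ℝ => f z.1 z.2) (spaceTime T) := by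
  have hopen : IsOpen (spaceTime T) := spaceTime_eq T ▸ (isOpen_openTime T).prod isOpen_Ioi
  rw [locallyIntegrableOn_iff hopen.isLocallyClosed]
  intro k hk hkc
  rcases k.eq_empty_or_nonempty with rfl | hne
  · simp
  have hk1 : IsCompact (Prod.fst '' k) := hkc.image continuous_fst
  have hk2 : IsCompact (Real.log '' (Prod.snd '' k)) :=
    (hkc.image continuous_snd).image_of_continuousOn
      (Real.continuousOn_log.mono fun r ⟨z, hz, hzr⟩ => by
        rw [← hzr]; exact (hk hz).2.2.ne')
  obtain ⟨R, hR⟩ := hk2.isBounded.subset_closedBall 0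
  rw [Real.closedBall_eq_Icc, zero_sub, zero_add] at hR
  obtain ⟨z₁, hz₁, h₁⟩ := hkc.exists_isMinOn hne continuous_fst.continuousOn
  obtain ⟨z₂, hz₂, h₂⟩ := hkc.exists_isMaxOn hne continuous_fst.continuousOn
  have hI : Icc z₁.1 z₂.1 ⊆ openTime T :=
    (ordConnected_openTime T).out ⟨(hk hz₁).1, (hk hz₁).2.1⟩ ⟨(hk hz₂).1, (hk hz₂).2.1⟩
  have hE : Real.exp '' Icc (-R) R ⊆ Ioi 0 := by rintro _ ⟨x, -, rfl⟩; exact Real.exp_pos x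
  have hsub : k ⊆ Icc z₁.1 z₂.1 ×ˢ (Real.exp '' Icc (-R) R) := fun z hz =>
    ⟨⟨h₁ hz, h₂ hz⟩, Real.log z.2, hR ⟨_, ⟨z, hz, rfl⟩, rfl⟩, Real.exp_log (hk hz).2.2⟩
  have hsub2 : Icc z₁.1 z₂.1 ×ˢ (Real.exp '' Icc (-R) R) ⊆ spaceTime T :=
    spaceTime_eq T ▸ prod_mono hI hE
  obtain ⟨C, hC⟩ := hfN R
  refine IntegrableOn.mono_set ⟨hf.mono_set hsub2, ?_⟩ hsub
  rw [HasFiniteIntegral]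
  have hm := (hf.mono_set hsub2).enorm
  rw [Measure.volume_eq_prod, ← Measure.prod_restrict] at hm ⊢
  rw [lintegral_prod _ hm]
  calc _ ≤ ∫⁻ t in Icc z₁.1 z₂.1, C * N t := lintegral_mono fun t => hC t
    _ = C * ∫⁻ t in Icc z₁.1 z₂.1, N t := lintegral_const_mul' _ _ ENNReal.coe_ne_top
    _ < ∞ := ENNReal.mul_lt_top ENNReal.coe_lt_top (lt_top_iff_ne_top.2 (hN _ _ hI))

end LocalIntegrability

end HarmonicMapFlow

/-! ### Time averages of the forcing as elements of L² and of L² × L². -/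

namespace HarmonicMapFlow

section Averages

lemma IsTest.zero : IsTest (fun _ => 0) := ⟨contDiff_const, HasCompactSupport.zero⟩

/-- The space of test functions. -/
def testSpace : Submodule ℝ (ℝ → ℝ) where
  carrier := {φ | IsTest φ}
  add_mem' h h' := h.add h'
  zero_mem' := IsTest.zero
  smul_mem' c _ h := h.const_mul c

/-- The inclusion of the test functions in `L²`. -/
noncomputable def testToL2 : testSpace →ₗ[ℝ] L2 where
  toFun φ := toL2 φ.1
  map_add' φ ψ := toL2_add (IsTest.memLp φ.2 2) (IsTest.memLp ψ.2 2)
  map_smul' c φ := toL2_const_mul (IsTest.memLp φ.2 2) c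

/-- The inclusion of pairs of test functions in `L² × L²`. -/
noncomputable def testToPair : testSpace × testSpace →ₗ[ℝ] L2Pair where
  toFun p := toPair p.1.1 p.2.1
  map_add' p q := by
    have h1 := testToL2.map_add p.1 q.1
    have h2 := testToL2.map_add p.2 q.2
    exact congrArg (WithLp.toLp 2) (Prod.ext h1 h2)
  map_smul' c p := by
    have h1 := testToL2.map_smul c p.1
    have h2 := testToL2.map_smul c p.2
    exact congrArg (WithLp.toLp 2) (Prod.ext h1 h2)

/-- Slice norms may be infinite, and ∞ · 0 = 0: a bound by such a product still has to hold when the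
class of φ vanishes. -/
lemma IsTest.eq_zero_of_toL2 {φ : ℝ → ℝ} (hφ : IsTest φ) (h : toL2 φ = 0) : φ = fun _ => 0 := by
  have h1 := coeFn_toL2 (hφ.memLp 2)
  rw [h] at h1
  exact (Continuous.ae_eq_iff_eq volume hφ.continuous continuous_const).1
    (h1.symm.trans (Lp.coeFn_zero ℝ 2 volume))

lemma enorm_integral_mul_le {w φ : ℝ → ℝ} (hw : AEStronglyMeasurable w volume)
    (hφ : MemLp φ 2 volume) : ‖∫ x, w x * φ x‖ₑ ≤ eLpNorm w 2 volume * ‖toL2 φ‖ₑ := by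
  refine (enorm_integral_le_lintegral_enorm _).trans ?_
  have h1 := ENNReal.lintegral_mul_le_Lp_mul_Lq volume
    Real.HolderConjugate.two_two hw.enorm hφ.1.enorm
  rw [enorm_toL2 hφ, eLpNorm_eq_lintegral_rpow_enorm_toReal (by norm_num) (by norm_num),
    eLpNorm_eq_lintegral_rpow_enorm_toReal (by norm_num) (by norm_num)]
  simpa [enorm_mul] using h1

variable {m : ℕ} {T : ℝ≥0∞}

/-- The weighted time average of a locally integrable function which is bounded in `L²`. -/
lemma exists_average_L2 {f : ℝ → ℝ → ℝ}
    (hf : LocallyIntegrableOn (fun z : ℝ × ℝ => f z.1 z.2) (spaceTime T)) {a b : ℝ} (hab : a < b)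
    (hI : Icc a b ⊆ openTime T) {c : ℝ → ℝ → ℝ}
    (hc : ContinuousOn (fun z : ℝ × ℝ => c z.1 z.2) (Icc a b ×ˢ univ)) (N : ℝ → ℝ≥0∞)
    (hN : ∀ τ ∈ Ioc a b, ∀ φ, IsTest φ →
      ‖∫ x, f τ (Real.exp x) * (c τ x * φ x)‖ₑ ≤ N τ * ‖toL2 φ‖ₑ)
    (hfin : ∫⁻ τ in Ioc a b, N τ ≠ ∞) :
    ∃ e : L2, ‖e‖ ≤ (b - a)⁻¹ * (∫⁻ τ in Ioc a b, N τ).toReal ∧ ∀ φ, IsTest φ →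
      ∫ x, e x * φ x
        = (b - a)⁻¹ * ∫ τ in Ioc a b, ∫ x, f τ (Real.exp x) * (c τ x * φ x) := by
  have key : ∀ φ : testSpace, _ := fun φ => integrable_pairing hf
    (M := fun τ x => c τ x * φ.1 x) (a := a) (b := b)
    (hc.mul ((IsTest.continuous φ.2).comp continuous_snd).continuousOn)
    (IsTest.compact φ.2).isCompact (fun t x hx => by
      rw [image_eq_zero_of_notMem_tsupport hx, mul_zero]) hI
  obtain ⟨e, h1, h2⟩ := exists_inner_eq_average testToL2
    (fun τ φ => ∫ x, f τ (Real.exp x) * (c τ x * φ.1 x)) N hab (fun φ => (key φ).1)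
    (fun φ ψ => by
      filter_upwards [(key φ).2, (key ψ).2] with τ i1 i2
      rw [← integral_add i1 i2]
      refine integral_congr_ae (ae_of_all _ fun x => ?_)
      simp only [Submodule.coe_add, Pi.add_apply]; ring)
    (fun r φ => ae_of_all _ fun τ => by
      rw [← integral_const_mul]
      refine integral_congr_ae (ae_of_all _ fun x => ?_)
      simp only [Submodule.coe_smul, Pi.smul_apply, smul_eq_mul]; ring)
    (fun τ hτ φ => hN τ hτ φ.1 φ.2) hfin
  refine ⟨e, h1, fun φ hφ => ?_⟩
  rw [← inner_toL2 e (hφ.memLp 2)]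
  exact h2 ⟨φ, hφ⟩

/-- The time average of a locally integrable function which is bounded in `X²`. -/
lemma exists_average_pair {f : ℝ → ℝ → ℝ} {κ : ℝ}
    (hf : LocallyIntegrableOn (fun z : ℝ × ℝ => f z.1 z.2) (spaceTime T)) {a b : ℝ} (hab : a < b)
    (hI : Icc a b ⊆ openTime T) (N : ℝ → ℝ≥0∞)
    (hN : ∀ τ ∈ Ioc a b, ∀ α β, IsTest α → IsTest β →
      ‖∫ x, f τ (Real.exp x) * (κ * β x - deriv α x)‖ₑ ≤ N τ * ‖toPair α β‖ₑ)
    (hfin : ∫⁻ τ in Ioc a b, N τ ≠ ∞) :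
    ∃ P : L2Pair, IsWeakPair κ P ∧ ‖P‖ ≤ (b - a)⁻¹ * (∫⁻ τ in Ioc a b, N τ).toReal ∧
      ∀ φ, IsTest φ → ∫ x, P.snd x * φ x
        = κ * ((b - a)⁻¹ * ∫ τ in Ioc a b, ∫ x, f τ (Real.exp x) * φ x) := by
  -- Integrating κβ - α' against a slice is the pairing of (u', κu) with (α, β) after moving the
  -- derivative onto α. The weak derivative of the slices, of which no joint measurability is known,
  -- does not enter.
  have key : ∀ p : testSpace × testSpace, _ := fun p => integrable_pairing hf
    (M := fun _ x => κ * p.2.1 x - deriv p.1.1 x) (a := a) (b := b)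
    (((((IsTest.const_mul p.2.2 κ).continuous).sub
      (IsTest.deriv p.1.2).continuous).comp continuous_snd).continuousOn)
    ((IsTest.compact p.2.2).isCompact.union (IsTest.compact p.1.2).isCompact) (fun t x hx => by
      rw [mem_union, not_or] at hx
      have h2 : deriv p.1.1 x = 0 :=
        image_eq_zero_of_notMem_tsupport fun h => hx.2 (tsupport_deriv_subset h)
      rw [image_eq_zero_of_notMem_tsupport hx.1, h2, mul_zero, sub_zero]) hI
  obtain ⟨P, h1, h2⟩ := exists_inner_eq_average testToPair
    (fun τ p => ∫ x, f τ (Real.exp x) * (κ * p.2.1 x - deriv p.1.1 x)) N hab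
    (fun φ => (key φ).1)
    (fun p q => by
      filter_upwards [(key p).2, (key q).2] with τ i1 i2
      rw [← integral_add i1 i2]
      refine integral_congr_ae (ae_of_all _ fun x => ?_)
      have := deriv_add (IsTest.differentiable p.1.2 x) (IsTest.differentiable q.1.2 x)
      simp only [Prod.fst_add, Prod.snd_add, Submodule.coe_add, Pi.add_apply, this]; ring)
    (fun r p => ae_of_all _ fun τ => by
      rw [← integral_const_mul]
      refine integral_congr_ae (ae_of_all _ fun x => ?_)
      have : deriv (r • p.1.1) x = r * deriv p.1.1 x :=
        deriv_const_mul r (IsTest.differentiable p.1.2 x)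
      simp only [Prod.smul_fst, Prod.smul_snd, Submodule.coe_smul, Pi.smul_apply, smul_eq_mul,
        this]; ring)
    (fun τ hτ p => hN τ hτ p.1.1 p.2.1 p.1.2 p.2.2) hfin
  refine ⟨P, fun φ hφ => ?_, h1, fun φ hφ => ?_⟩
  -- On the pair (κφ, φ') the functional vanishes identically, since κφ' - (κφ)' = 0; so the
  -- representing vector is a weak pair.
  · have h3 := h2 (⟨_, hφ.const_mul κ⟩, ⟨_, hφ.deriv⟩)
    have h4 : ∀ x, κ * deriv φ x - deriv (fun x => κ * φ x) x = 0 := fun x => by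
      rw [deriv_const_mul κ (hφ.differentiable x), sub_self]
    simp only [h4, mul_zero, integral_zero] at h3
    exact h3
  · have h3 := h2 (⟨_, IsTest.zero⟩, ⟨_, hφ⟩)
    have h4 : inner ℝ P (toPair (fun _ => 0) φ) = ∫ x, P.snd x * φ x := by
      rw [inner_toPair P (IsTest.zero.memLp 2) (hφ.memLp 2)]
      simp
    rw [← h4]
    refine h3.trans ?_
    simp only [deriv_const, sub_zero]
    have h5 : ∀ τ, ∫ x, f τ (Real.exp x) * (κ * φ x) = κ * ∫ x, f τ (Real.exp x) * φ x := fun τ => by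
      rw [← integral_const_mul]
      exact integral_congr_ae (ae_of_all _ fun x => by simp only; ring)
    simp only [h5]
    rw [integral_const_mul, mul_left_comm]

end Averages

section LogPair

variable {m : ℕ} {u g : ℝ → ℝ} {κ : ℝ}

lemma enorm_pair_sq (P : L2Pair) : ‖P‖ₑ ^ 2 = ‖P.fst‖ₑ ^ 2 + ‖P.snd‖ₑ ^ 2 := by
  simp only [← ofReal_norm, ← ENNReal.ofReal_pow (norm_nonneg _)]
  rw [← ENNReal.ofReal_add (by positivity) (by positivity), WithLp.prod_norm_sq_eq_of_L2]

lemma xNorm_two_sq (m : ℕ) (h : HasWeakDeriv u g) :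
    xNorm m 2 u ^ 2 = eLpNorm (fun x => Real.exp x * g (Real.exp x)) 2 volume ^ 2
      + (m : ℝ≥0∞) ^ 2 * eLpNorm (fun x => u (Real.exp x)) 2 volume ^ 2 := by
  rw [xNorm_two_eq m h, ← ENNReal.rpow_two, ← ENNReal.rpow_mul]
  norm_num

lemma HasWeakDeriv.memLp (hm : 1 ≤ m) (h : HasWeakDeriv u g) (hx : xNorm m 2 u < ∞) :
    MemLp (fun x => u (Real.exp x)) 2 volume ∧
    MemLp (fun x => Real.exp x * g (Real.exp x)) 2 volume := by
  have h1 := ENNReal.pow_lt_top (n := 2) hx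
  rw [xNorm_two_sq m h, ENNReal.add_lt_top] at h1
  obtain ⟨l0, l1⟩ := h.locallyIntegrable_log
  have hm0 : (m : ℝ≥0∞) ^ 2 ≠ 0 := pow_ne_zero 2 (by exact_mod_cast (by omega : m ≠ 0))
  refine ⟨⟨l0.aestronglyMeasurable, ?_⟩, ⟨l1.aestronglyMeasurable, ?_⟩⟩
  · exact (ENNReal.pow_lt_top_iff.1 (ENNReal.lt_top_of_mul_ne_top_right h1.2.ne hm0)).resolve_right
      two_ne_zero
  · exact (ENNReal.pow_lt_top_iff.1 h1.1).resolve_right two_ne_zero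

/-- A function and its weak derivative in the logarithmic variable, as a pair in `L²`. -/
noncomputable def logPair (κ : ℝ) (u g : ℝ → ℝ) : L2Pair :=
  toPair (fun x => Real.exp x * g (Real.exp x)) (fun x => κ * u (Real.exp x))

lemma enorm_logPair_sq (hκ : 0 ≤ κ) (h0 : MemLp (fun x => u (Real.exp x)) 2 volume)
    (h1 : MemLp (fun x => Real.exp x * g (Real.exp x)) 2 volume) :
    ‖logPair κ u g‖ₑ ^ 2 = eLpNorm (fun x => Real.exp x * g (Real.exp x)) 2 volume ^ 2
      + ENNReal.ofReal κ ^ 2 * eLpNorm (fun x => u (Real.exp x)) 2 volume ^ 2 := by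
  rw [enorm_pair_sq, logPair, toPair]
  simp only [WithLp.toLp_fst, WithLp.toLp_snd]
  rw [enorm_toL2 h1, enorm_toL2 (h0.const_mul κ), ← mul_pow]
  congr 2
  exact (eLpNorm_const_smul κ _ 2 volume).trans (by rw [Real.enorm_of_nonneg hκ])

lemma xNorm_le_enorm_logPair (hm : 1 ≤ m) (hκ : (m : ℝ) ≤ κ) (h : HasWeakDeriv u g)
    (hx : xNorm m 2 u < ∞) : xNorm m 2 u ≤ ‖logPair κ u g‖ₑ := by
  obtain ⟨h0, h1⟩ := h.memLp hm hx
  rw [← ENNReal.pow_le_pow_left_iff two_ne_zero, xNorm_two_sq m h,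
    enorm_logPair_sq ((Nat.cast_nonneg m).trans hκ) h0 h1]
  gcongr
  rw [← ENNReal.ofReal_natCast]
  exact ENNReal.ofReal_le_ofReal hκ

lemma enorm_logPair_le (hm : 1 ≤ m) (hκ : (m : ℝ) ≤ κ) (h : HasWeakDeriv u g)
    (hx : xNorm m 2 u < ∞) : ‖logPair κ u g‖ₑ ≤ ENNReal.ofReal κ * xNorm m 2 u := by
  obtain ⟨h0, h1⟩ := h.memLp hm hx
  have hm1 : (1 : ℝ) ≤ m := by exact_mod_cast hm
  rw [← ENNReal.pow_le_pow_left_iff two_ne_zero, mul_pow, xNorm_two_sq m h,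
    enorm_logPair_sq (by linarith) h0 h1, mul_add]
  gcongr
  · refine le_mul_of_one_le_left' (one_le_pow₀ ?_)
    rw [← ENNReal.ofReal_one]
    exact ENNReal.ofReal_le_ofReal (hm1.trans hκ)
  · refine le_mul_of_one_le_left' (one_le_pow₀ ?_)
    exact_mod_cast hm

lemma isWeakPair_logPair (hm : 1 ≤ m) (h : HasWeakDeriv u g) (hx : xNorm m 2 u < ∞) :
    IsWeakPair κ (logPair κ u g) :=
  isWeakPair_toPair (h.memLp hm hx).1 (h.memLp hm hx).2 fun _ hφ => h.weak_log hφ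

lemma inner_logPair (hm : 1 ≤ m) (h : HasWeakDeriv u g) (hx : xNorm m 2 u < ∞) {a b : ℝ → ℝ}
    (ha : MemLp a 2 volume) (hb : MemLp b 2 volume) :
    inner ℝ (logPair κ u g) (toPair a b) = (∫ x, Real.exp x * g (Real.exp x) * a x)
      + κ * ∫ x, u (Real.exp x) * b x := by
  obtain ⟨h0, h1⟩ := h.memLp hm hx
  rw [inner_toPair _ ha hb, ← integral_const_mul]
  congr 1 <;> refine integral_congr_ae ?_
  · filter_upwards [coeFn_toL2 h1] with x hx
    simp only [logPair, toPair, WithLp.toLp_fst, hx]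
  · filter_upwards [coeFn_toL2 (h0.const_mul κ)] with x hx
    simp only [logPair, toPair, WithLp.toLp_snd, hx]; ring

/-- The pairing with a test pair is bounded by the norm of `X²`. -/
lemma enorm_integral_pair_le (hm : 1 ≤ m) (hκ : (m : ℝ) ≤ κ) (u : ℝ → ℝ) {α β : ℝ → ℝ}
    (hα : IsTest α) (hβ : IsTest β) :
    ‖∫ x, u (Real.exp x) * (κ * β x - deriv α x)‖ₑ
      ≤ ENNReal.ofReal κ * xNorm m 2 u * ‖toPair α β‖ₑ := by
  have hκ0 : 0 < κ := lt_of_lt_of_le (by exact_mod_cast hm) hκ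
  by_cases hx : xNorm m 2 u = ∞
  · by_cases hz : toPair α β = 0
    · have e1 := hα.eq_zero_of_toL2 (congrArg WithLp.fst hz)
      have e2 := hβ.eq_zero_of_toL2 (congrArg WithLp.snd hz)
      simp [e1, e2]
    · rw [hx, ENNReal.mul_top (by positivity), ENNReal.top_mul (by simpa using hz)]
      exact le_top
  replace hx := lt_top_iff_ne_top.2 hx
  obtain ⟨g, hg⟩ := exists_hasWeakDeriv_of_xNorm_lt_top hx
  have l0 := hg.locallyIntegrable_log.1
  have e : ∫ x, u (Real.exp x) * (κ * β x - deriv α x)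
      = inner ℝ (logPair κ u g) (toPair α β) := by
    rw [inner_logPair hm hg hx (hα.memLp 2) (hβ.memLp 2)]
    have i1 := hβ.locallyIntegrable_mul l0
    have i2 := hα.deriv.locallyIntegrable_mul l0
    have e1 : ∀ x, u (Real.exp x) * (κ * β x - deriv α x)
        = κ * (u (Real.exp x) * β x) - u (Real.exp x) * deriv α x := fun x => by ring
    simp only [e1]
    rw [integral_sub (i1.const_mul κ) i2, integral_const_mul, hg.weak_log hα]
    ring
  rw [e]
  calc ‖inner ℝ (logPair κ u g) (toPair α β)‖ₑ ≤ ‖logPair κ u g‖ₑ * ‖toPair α β‖ₑ := by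
        simp only [← ofReal_norm]
        rw [← ENNReal.ofReal_mul (norm_nonneg _)]
        exact ENNReal.ofReal_le_ofReal (norm_inner_le_norm _ _)
    _ ≤ _ := by gcongr; exact enorm_logPair_le hm hκ hg hx

/-- The pairing with a test function is bounded by the norm of `X¹`. -/
lemma enorm_integral_exp_mul_le (hm : 1 ≤ m) (u : ℝ → ℝ) {φ : ℝ → ℝ} (hφ : IsTest φ) :
    ‖∫ x, u (Real.exp x) * (Real.exp x * φ x)‖ₑ ≤ xNorm m 1 u * ‖toL2 φ‖ₑ := by
  by_cases hx : xNorm m 1 u = ∞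
  · by_cases hz : toL2 φ = 0
    · simp [hφ.eq_zero_of_toL2 hz]
    · rw [hx, ENNReal.top_mul (by simpa using hz)]
      exact le_top
  obtain ⟨g, hg⟩ := exists_hasWeakDeriv_of_xNorm_lt_top (lt_top_iff_ne_top.2 hx)
  have hme := (locallyIntegrable_comp_exp hg.locInt Real.continuous_exp).aestronglyMeasurable
  have e : ∀ x, u (Real.exp x) * (Real.exp x * φ x) = Real.exp x * u (Real.exp x) * φ x :=
    fun x => by ring
  simp only [e]
  exact (enorm_integral_mul_le hme (hφ.memLp 2)).trans
    (by gcongr; exact eLpNorm_exp_mul_le_xNorm_one hm u)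

end LogPair

end HarmonicMapFlow

/-! ### Dependence on the scale; solutions as continuous curves of pairs. -/

namespace HarmonicMapFlow

section ScaleDependence

variable {m : ℝ}

lemma sech_le_exp_abs_mul (a b : ℝ) : sech a ≤ Real.exp |a - b| * sech b := by
  have h1 : Real.cosh b ≤ Real.exp |a - b| * Real.cosh a := by
    rw [Real.cosh_eq, Real.cosh_eq, mul_div_assoc', mul_add, ← Real.exp_add, ← Real.exp_add]
    have h2 := le_abs_self (a - b)
    have h3 := neg_abs_le (a - b)
    gcongr <;> linarith
  rw [sech, sech, ← div_eq_mul_inv, le_div_iff₀ (Real.cosh_pos b), inv_mul_le_iff₀ (Real.cosh_pos a)]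
  linarith

lemma abs_tanh_le_one (x : ℝ) : |Real.tanh x| ≤ 1 := by
  rw [← sq_le_one_iff_abs_le_one]
  have := sech_sq x
  nlinarith [sq_nonneg (sech x)]

lemma hasDerivAt_sech_sub (m x σ : ℝ) : HasDerivAt (fun σ => sech (m * (x - σ)))
    (m * Real.tanh (m * (x - σ)) * sech (m * (x - σ))) σ := by
  have h1 : HasDerivAt (fun σ => m * (x - σ)) (-m) σ := by
    simpa using ((hasDerivAt_id σ).const_sub x).const_mul m
  refine ((hasDerivAt_sech _).comp σ h1).congr_deriv ?_
  ring

/-- Mean value inequality in σ: the derivative is a bounded multiple of e^{-x} sech²(m(x - σ)),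
which is at most 2e^{-σ} ≤ 2e^A. This measures the error of freezing the potential. -/
lemma abs_exp_neg_mul_sech_sq_sub_le (hm : 1 ≤ m) {A σ σ' : ℝ} (hσ : |σ| ≤ A) (hσ' : |σ'| ≤ A)
    (x : ℝ) : |(sech (m * (x - σ')) ^ 2 - sech (m * (x - σ)) ^ 2) * Real.exp (-x)|
      ≤ 4 * m * Real.exp A * |σ' - σ| := by
  have h1 := Convex.norm_image_sub_le_of_norm_hasDerivWithin_le (𝕜 := ℝ)
    (f := fun σ => sech (m * (x - σ)) ^ 2 * Real.exp (-x))
    (f' := fun σ => 2 * m * Real.tanh (m * (x - σ)) * (Real.exp (-x) * sech (m * (x - σ)) ^ 2))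
    (s := Icc (-A) A) (C := 4 * m * Real.exp A) (x := σ) (y := σ')
    (fun σ _ => ((((hasDerivAt_sech_sub m x σ).pow 2).mul_const (Real.exp (-x))).congr_deriv
      (by norm_num; ring)).hasDerivWithinAt)
    (fun τ hτ => ?_) (convex_Icc _ _) (abs_le.1 hσ) (abs_le.1 hσ')
  · simpa only [sub_mul, Real.norm_eq_abs] using h1
  · have h2 := exp_neg_mul_sech_sq_sub_le hm τ x
    have h3 : Real.exp (-τ) ≤ Real.exp A := Real.exp_le_exp.2 (by linarith [hτ.1])
    have h4 : 0 ≤ Real.exp (-x) * sech (m * (x - τ)) ^ 2 := by positivity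
    rw [Real.norm_eq_abs, abs_mul, abs_of_nonneg h4, abs_mul, abs_of_pos (by linarith : 0 < 2 * m)]
    calc 2 * m * |Real.tanh (m * (x - τ))| * (Real.exp (-x) * sech (m * (x - τ)) ^ 2)
        ≤ 2 * m * 1 * (2 * Real.exp A) := by
          refine mul_le_mul ?_ (h2.trans (by linarith)) h4 (by linarith)
          gcongr
          exact abs_tanh_le_one _
      _ = _ := by ring

/-- The logarithmic derivative of sech(m(x - σ)) in σ is at most m, so the difference is small
relative to the profile itself. The relative form keeps the decay needed against the weight e^{2x}.
-/
lemma abs_sech_sub_le (hm : 0 ≤ m) {σ σ' : ℝ} (h : |σ' - σ| ≤ 1) (x : ℝ) :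
    |sech (m * (x - σ)) - sech (m * (x - σ'))|
      ≤ m * Real.exp m * |σ' - σ| * sech (m * (x - σ)) := by
  have h1 := Convex.norm_image_sub_le_of_norm_hasDerivWithin_le (𝕜 := ℝ)
    (f := fun σ => sech (m * (x - σ)))
    (f' := fun σ => m * Real.tanh (m * (x - σ)) * sech (m * (x - σ)))
    (s := Metric.closedBall σ 1) (C := m * (Real.exp m * sech (m * (x - σ)))) (x := σ) (y := σ')
    (fun σ _ => (hasDerivAt_sech_sub m x σ).hasDerivWithinAt)
    (fun τ hτ => ?_) (convex_closedBall _ _) (Metric.mem_closedBall_self zero_le_one)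
    (by rwa [Metric.mem_closedBall, Real.dist_eq])
  · rw [abs_sub_comm, ← Real.norm_eq_abs]
    refine h1.trans (le_of_eq ?_)
    rw [Real.norm_eq_abs]; ring
  · rw [Metric.mem_closedBall, Real.dist_eq] at hτ
    have h2 : sech (m * (x - τ)) ≤ Real.exp m * sech (m * (x - σ)) := by
      refine (sech_le_exp_abs_mul _ (m * (x - σ))).trans ?_
      have := sech_pos (m * (x - σ))
      gcongr
      rw [← mul_sub, abs_mul, abs_of_nonneg hm, show x - τ - (x - σ) = -(τ - σ) by ring, abs_neg]
      exact mul_le_of_le_one_right hm hτ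
    rw [Real.norm_eq_abs, abs_mul, abs_of_pos (sech_pos _), abs_mul, abs_of_nonneg hm]
    calc m * |Real.tanh (m * (x - τ))| * sech (m * (x - τ))
        ≤ m * 1 * (Real.exp m * sech (m * (x - σ))) := by
          gcongr
          · exact (sech_pos _).le
          · exact abs_tanh_le_one _
      _ = _ := by ring

lemma memLp_exp_two_sech (hm : 4 ≤ m) (σ : ℝ) :
    MemLp (fun x => Real.exp (2 * x) * sech (m * (x - σ))) 2 volume ∧
    ∫ x, (Real.exp (2 * x) * sech (m * (x - σ))) ^ 2
      = Real.exp (4 * σ) * ∫ x, Real.exp (4 * x) * sech (m * x) ^ 2 := by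
  have e : ∀ x, (Real.exp (2 * x) * sech (m * (x - σ))) ^ 2
      = Real.exp (4 * σ) * (Real.exp (4 * (x - σ)) * sech (m * (x - σ)) ^ 2) := fun x => by
    rw [← mul_assoc, ← Real.exp_add, mul_pow, ← Real.exp_nat_mul]
    congr 2; push_cast; ring
  have hi := integrable_exp_mul_sech_sq m (c := 4) (by rw [abs_of_pos] <;> linarith)
  refine ⟨(memLp_two_iff_integrable_sq (Continuous.aestronglyMeasurable (by fun_prop))).2 ?_, ?_⟩
  · simp only [e]
    exact (hi.comp_sub_right σ).const_mul _
  · simp only [e]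
    rw [integral_const_mul,
      integral_sub_right_eq_self (fun x => Real.exp (4 * x) * sech (m * x) ^ 2) σ]

/-- A function orthogonal to the profile at one scale is almost orthogonal to it at nearby
scales. -/
lemma abs_integral_mul_sech_le (hm : 4 ≤ m) {u : ℝ → ℝ} (hu : MemLp u 2 volume) {σ σ' S : ℝ}
    (hS : eLpNorm u 2 volume ≤ ENNReal.ofReal S) (hS0 : 0 ≤ S) (h : |σ' - σ| ≤ 1)
    (horth : ∫ x, u x * (Real.exp (2 * x) * sech (m * (x - σ'))) = 0) :
    |∫ x, u x * (Real.exp (2 * x) * sech (m * (x - σ)))| ≤ S * (m * Real.exp m * |σ' - σ|)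
      * (Real.exp (2 * σ) * √(∫ x, Real.exp (4 * x) * sech (m * x) ^ 2)) := by
  obtain ⟨hw, hwi⟩ := memLp_exp_two_sech hm σ
  obtain ⟨hw', -⟩ := memLp_exp_two_sech hm σ'
  have hm0 : 0 ≤ m := by linarith
  set c := m * Real.exp m * |σ' - σ| with hc
  have hc0 : 0 ≤ c := by positivity
  have hcs := abs_sech_sub_le hm0 h
  simp only [← hc] at hcs
  clear_value c
  have hd : MemLp (fun x => Real.exp (2 * x) * sech (m * (x - σ))
      - Real.exp (2 * x) * sech (m * (x - σ'))) 2 volume := hw.sub hw'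
  -- The vanishing integral at the scale σ' is subtracted, so that only the difference of the two
  -- profiles remains.
  have h1 : ∫ x, u x * (Real.exp (2 * x) * sech (m * (x - σ)))
      = ∫ x, u x * (Real.exp (2 * x) * sech (m * (x - σ))
        - Real.exp (2 * x) * sech (m * (x - σ'))) := by
    have e : ∀ x, u x * (Real.exp (2 * x) * sech (m * (x - σ))
        - Real.exp (2 * x) * sech (m * (x - σ'))) = u x * (Real.exp (2 * x) * sech (m * (x - σ)))
        - u x * (Real.exp (2 * x) * sech (m * (x - σ'))) := fun x => mul_sub _ _ _
    simp only [e]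
    rw [integral_sub (MemLp.integrable_mul_two hu hw) (MemLp.integrable_mul_two hu hw'), horth, sub_zero]
  have h2 : ∫ x, (Real.exp (2 * x) * sech (m * (x - σ))
      - Real.exp (2 * x) * sech (m * (x - σ'))) ^ 2
      ≤ ∫ x, c ^ 2 * (Real.exp (2 * x) * sech (m * (x - σ))) ^ 2 := by
    refine integral_mono hd.integrable_sq (hw.integrable_sq.const_mul _) fun x => ?_
    simp only
    rw [← mul_pow, ← mul_sub, sq_le_sq, abs_mul, abs_mul, Real.abs_exp, abs_mul, Real.abs_exp,
      abs_of_nonneg hc0, abs_of_pos (sech_pos _), mul_left_comm]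
    gcongr
    exact hcs x
  have h3 : ∫ x, u x ^ 2 ≤ S ^ 2 := by
    have h4 : ‖toL2 u‖ ≤ S := by
      have h5 := enorm_toL2 hu ▸ hS
      rw [← ofReal_norm] at h5
      exact (ENNReal.ofReal_le_ofReal_iff hS0).1 h5
    have h6 : ‖toL2 u‖ ^ 2 = ∫ x, u x ^ 2 := by
      rw [L2_norm_sq]
      refine integral_congr_ae ?_
      filter_upwards [coeFn_toL2 hu] with x hx
      rw [hx]
    rw [← h6]
    gcongr
  refine abs_le_of_sq_le_sq ?_ (by positivity)
  rw [h1]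
  refine (sq_integral_mul_le hu hd).trans ?_
  rw [integral_const_mul, hwi] at h2
  have hK : 0 ≤ ∫ x, Real.exp (4 * x) * sech (m * x) ^ 2 := integral_nonneg fun x => by positivity
  have e4 : Real.exp (4 * σ) = Real.exp (2 * σ) ^ 2 := by
    rw [← Real.exp_nat_mul]; congr 1; push_cast; ring
  calc _ ≤ S ^ 2 * (c ^ 2 * (Real.exp (4 * σ) * ∫ x, Real.exp (4 * x) * sech (m * x) ^ 2)) := by
        gcongr
    _ = _ := by rw [mul_pow, mul_pow, mul_pow, Real.sq_sqrt hK, e4]; ring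

end ScaleDependence

section Curve

variable {m : ℕ} {T : ℝ≥0∞} {s : ℝ → ℝ} {f : ℝ → ℝ → ℝ} {ξ₀ : ℝ → ℝ} {ξ : ℝ → ℝ → ℝ} {κ : ℝ}

lemma logPair_sub {u g u' g' : ℝ → ℝ} (h0 : MemLp (fun x => u (Real.exp x)) 2 volume)
    (h1 : MemLp (fun x => Real.exp x * g (Real.exp x)) 2 volume)
    (h0' : MemLp (fun x => u' (Real.exp x)) 2 volume)
    (h1' : MemLp (fun x => Real.exp x * g' (Real.exp x)) 2 volume) :
    logPair κ u g - logPair κ u' g' = logPair κ (fun r => u r - u' r) (fun r => g r - g' r) := by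
  have e1 := toL2_sub h1 h1'
  have e2 := toL2_sub (h0.const_mul κ) (h0'.const_mul κ)
  simp only [← mul_sub] at e1 e2
  exact congrArg (WithLp.toLp 2) (Prod.ext e1.symm e2.symm)

/-- A solution is a continuous curve in `L² × L²`. -/
lemma IsLinearizedSolution.exists_curve (hm : 1 ≤ m) (hκ : (m : ℝ) ≤ κ)
    (hsol : IsLinearizedSolution m T s f ξ₀ ξ) :
    ∃ g : ℝ → ℝ → ℝ, (∀ t ∈ timeInterval T, HasWeakDeriv (ξ t) (g t)) ∧
      ContinuousOn (fun t => logPair κ (ξ t) (g t)) (timeInterval T) := by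
  have h1 : ∀ t, ∃ g, t ∈ timeInterval T → HasWeakDeriv (ξ t) g := fun t => by
    by_cases ht : t ∈ timeInterval T
    · obtain ⟨g, hg⟩ := exists_hasWeakDeriv_of_xNorm_lt_top (hsol.memX t ht)
      exact ⟨g, fun _ => hg⟩
    · exact ⟨0, fun h => absurd h ht⟩
  choose g hg using h1
  refine ⟨g, hg, fun t₀ ht₀ => ?_⟩
  obtain ⟨a0, a1⟩ := (hg t₀ ht₀).memLp hm (hsol.memX t₀ ht₀)
  rw [ContinuousWithinAt, tendsto_iff_edist_tendsto_0]
  have h2 := ENNReal.Tendsto.const_mul (a := ENNReal.ofReal κ) (hsol.continuousX t₀ ht₀)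
    (Or.inr ENNReal.ofReal_ne_top)
  rw [mul_zero] at h2
  refine tendsto_of_tendsto_of_tendsto_of_le_of_le' tendsto_const_nhds h2
    (Eventually.of_forall fun _ => zero_le) ?_
  filter_upwards [(hsol.continuousX t₀ ht₀).eventually (gt_mem_nhds ENNReal.zero_lt_top),
    self_mem_nhdsWithin] with t hx ht
  obtain ⟨b0, b1⟩ := (hg t ht).memLp hm (hsol.memX t ht)
  rw [edist_eq_enorm_sub, logPair_sub b0 b1 a0 a1]
  exact enorm_logPair_le hm hκ ((hg t ht).sub (hg t₀ ht₀)) hx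

end Curve

end HarmonicMapFlow

/-! ### Steklov averages and the averaged equation. -/

namespace HarmonicMapFlow

section Steklov

variable {Ξ : ℝ → L2Pair} {a b : ℝ}

/-- The time average of a curve. -/
noncomputable def steklov (a b : ℝ) (Ξ : ℝ → L2Pair) : L2Pair := (b - a)⁻¹ • ∫ τ in a..b, Ξ τ

lemma inner_steklov (hab : a ≤ b) (hΞ : ContinuousOn Ξ (Icc a b)) (w : L2Pair) :
    inner ℝ (steklov a b Ξ) w = (b - a)⁻¹ * ∫ τ in Ioc a b, inner ℝ (Ξ τ) w := by
  have hi : IntervalIntegrable Ξ volume a b :=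
    ContinuousOn.intervalIntegrable (by rwa [uIcc_of_le hab])
  have h1 := (innerSL ℝ w).intervalIntegral_comp_comm hi
  simp only [innerSL_apply_apply, intervalIntegral.integral_of_le hab] at h1
  rw [steklov, real_inner_smul_left, intervalIntegral.integral_of_le hab, real_inner_comm, ← h1]
  simp only [real_inner_comm]

lemma isWeakPair_steklov {κ : ℝ} (hab : a ≤ b) (hΞ : ContinuousOn Ξ (Icc a b))
    (h : ∀ τ ∈ Icc a b, IsWeakPair κ (Ξ τ)) : IsWeakPair κ (steklov a b Ξ) := fun φ hφ => by
  rw [inner_steklov hab hΞ, setIntegral_congr_fun measurableSet_Ioc fun τ hτ =>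
    h τ (Ioc_subset_Icc_self hτ) φ hφ]
  simp

end Steklov

section AveragedEquation

variable {m : ℕ} {T : ℝ≥0∞} {s : ℝ → ℝ} {f f₁ f₂ : ℝ → ℝ → ℝ} {ξ₀ : ℝ → ℝ} {ξ : ℝ → ℝ → ℝ} {κ : ℝ}
  {g : ℝ → ℝ → ℝ} {a b : ℝ}

/-- The equation integrated over a time interval, with the potential frozen at the initial time. -/
lemma IsLinearizedSolution.averaged_equation (hsol : IsLinearizedSolution m T s f ξ₀ ξ)
    (hm : 1 ≤ m) (hκ : 0 < κ)
    (hs : ∀ t ∈ timeInterval T, 0 < s t) (hsc : ContinuousOn s (timeInterval T))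
    (hg : ∀ t ∈ timeInterval T, HasWeakDeriv (ξ t) (g t))
    (hΞ : ContinuousOn (fun t => logPair κ (ξ t) (g t)) (timeInterval T))
    (hf₁ : LocallyIntegrableOn (fun z : ℝ × ℝ => f₁ z.1 z.2) (spaceTime T))
    (hf₂ : LocallyIntegrableOn (fun z : ℝ × ℝ => f₂ z.1 z.2) (spaceTime T))
    (hf : ∀ᵐ z : ℝ × ℝ ∂(volume.restrict (spaceTime T)), f z.1 z.2 = f₁ z.1 z.2 + f₂ z.1 z.2)
    (hab : a ≤ b) (hI : Icc a b ⊆ openTime T) {φ : ℝ → ℝ} (hφ : IsTest φ) :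
    (∫ x, ξ b (Real.exp x) * (Real.exp (2 * x) * φ x))
      - ∫ x, ξ a (Real.exp x) * (Real.exp (2 * x) * φ x)
      = (∫ τ in Ioc a b, ∫ x, f₁ τ (Real.exp x) * (Real.exp (2 * x) * φ x))
        + (∫ τ in Ioc a b, ∫ x, f₂ τ (Real.exp x) * (Real.exp x * (Real.exp x * φ x)))
        - (∫ τ in Ioc a b, ∫ x, ξ τ (Real.exp x) * (-deriv (deriv φ) x + m ^ 2 * φ x
          - 2 * m ^ 2 * sech (m * (x - Real.log (s a))) ^ 2 * φ x))
        + ∫ τ in Ioc a b, ∫ x, ξ τ (Real.exp x) * (2 * m ^ 2 *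
          ((sech (m * (x - Real.log (s τ))) ^ 2 - sech (m * (x - Real.log (s a))) ^ 2)
            * Real.exp (-x)) * (Real.exp x * φ x)) := by
  have hψ : IsTest fun x => Real.exp (2 * x) * φ x := hφ.contDiff_mul (by fun_prop)
  have hF : ContinuousOn (fun t => ∫ x, ξ t (Real.exp x) * (Real.exp (2 * x) * φ x))
      (openTime T) := by
    have h1 : ContinuousOn (fun t => κ⁻¹ * inner ℝ (logPair κ (ξ t) (g t))
        (toPair (fun _ => 0) fun x => Real.exp (2 * x) * φ x)) (openTime T) :=
      continuousOn_const.mul ((hΞ.mono (openTime_subset T)).inner continuousOn_const)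
    refine h1.congr fun t ht => ?_
    beta_reduce
    rw [inner_logPair hm (hg t (openTime_subset T ht)) (hsol.memX t (openTime_subset T ht))
      (IsTest.zero.memLp 2) (hψ.memLp 2)]
    simp only [mul_zero, integral_zero, zero_add]
    rw [inv_mul_cancel_left₀ hκ.ne']
  obtain ⟨-, h1⟩ := hsol.time_equation hs hsc hφ hF a (hI ⟨le_rfl, hab⟩) b (hI ⟨hab, le_rfl⟩)
  have hlog : ContinuousOn (fun z : ℝ × ℝ => Real.log (s z.1)) (Icc a b ×ˢ (univ : Set ℝ)) :=
    ((hsc.mono (hI.trans (openTime_subset T))).log fun t ht =>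
      (hs t (openTime_subset T (hI ht))).ne').comp continuousOn_fst fun z hz => hz.1
  have hφc : Continuous φ := hφ.continuous
  have hφ2c : Continuous (deriv (deriv φ)) := hφ.deriv.deriv.continuous
  have hz : ∀ x ∉ tsupport φ, φ x = 0 ∧ deriv (deriv φ) x = 0 := fun x hx =>
    ⟨image_eq_zero_of_notMem_tsupport hx, image_eq_zero_of_notMem_tsupport fun h =>
      hx (tsupport_deriv_subset (tsupport_deriv_subset h))⟩
  have hK := hφ.compact.isCompact
  obtain ⟨i1, j1⟩ := integrable_pairing hf₁ (a := a) (b := b)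
    (M := fun _ x => Real.exp (2 * x) * φ x) (Continuous.continuousOn (by fun_prop)) hK
    (fun t x hx => by simp [hz x hx]) hI
  obtain ⟨i2, j2⟩ := integrable_pairing hf₂ (a := a) (b := b)
    (M := fun _ x => Real.exp x * (Real.exp x * φ x)) (Continuous.continuousOn (by fun_prop)) hK
    (fun t x hx => by simp [hz x hx]) hI
  have hsech : Continuous sech := continuous_sech
  obtain ⟨i3, j3⟩ := integrable_pairing hsol.locInt (a := a) (b := b)
    (M := fun _ x => -deriv (deriv φ) x + m ^ 2 * φ x
      - 2 * m ^ 2 * sech (m * (x - Real.log (s a))) ^ 2 * φ x)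
    (Continuous.continuousOn (by fun_prop)) hK (fun t x hx => by simp [hz x hx]) hI
  -- The error of freezing the potential at time a. The factor e^{-x} e^x = 1 is split so that a
  -- bounded multiplier acts on u and the test function becomes e^x φ, as for a forcing term in L²(r
  -- dr).
  obtain ⟨i4, j4⟩ := integrable_pairing hsol.locInt (a := a) (b := b)
    (M := fun τ x => 2 * m ^ 2 * ((sech (m * (x - Real.log (s τ))) ^ 2
      - sech (m * (x - Real.log (s a))) ^ 2) * Real.exp (-x)) * (Real.exp x * φ x))
    (by
      have h2 : ContinuousOn (fun z : ℝ × ℝ => sech (m * (z.2 - Real.log (s z.1))))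
          (Icc a b ×ˢ (univ : Set ℝ)) :=
        hsech.comp_continuousOn (continuousOn_const.mul (continuousOn_snd.sub hlog))
      refine ContinuousOn.mul (continuousOn_const.mul ((ContinuousOn.sub (h2.pow 2) ?_).mul ?_)) ?_
      all_goals exact Continuous.continuousOn (by fun_prop)) hK
    (fun t x hx => by simp [hz x hx]) hI
  have hfae : ∀ᵐ τ ∂volume.restrict (Ioc a b), ∀ᵐ x,
      f τ (Real.exp x) = f₁ τ (Real.exp x) + f₂ τ (Real.exp x) := by
    rw [spaceTime_eq, Measure.volume_eq_prod, ← Measure.prod_restrict] at hf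
    have h2 := ae_restrict_of_ae_restrict_of_subset
      (Ioc_subset_Icc_self.trans hI) (Measure.ae_ae_of_ae_prod hf)
    filter_upwards [h2] with τ hτ
    have h3 : ∀ᵐ r ∂rdr, f τ r = f₁ τ r + f₂ τ r :=
      (withDensity_absolutelyContinuous _ _).ae_le hτ
    exact ae_rdr_iff.1 h3
  rw [h1, intervalIntegral.integral_of_le hab, ← integral_add i1 i2, ← integral_sub, ← integral_add]
  · refine integral_congr_ae ?_
    filter_upwards [hfae, j1, j2, j3, j4] with τ hτ k1 k2 k3 k4
    rw [← integral_add k1 k2, sub_add, ← integral_sub k3 k4]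
    congr 1
    · refine integral_congr_ae ?_
      filter_upwards [hτ] with x hx
      rw [hx, exp_two_mul]; ring
    · refine integral_congr_ae (ae_of_all _ fun x => ?_)
      have : Real.exp (-x) * Real.exp x = 1 := by rw [← Real.exp_add]; simp
      simp only
      linear_combination (ξ τ (Real.exp x) * 2 * m ^ 2 * φ x *
        (sech (m * (x - Real.log (s τ))) ^ 2 - sech (m * (x - Real.log (s a))) ^ 2)) * this
  · exact (i1.add i2).sub i3
  · exact i4
  · exact i1.add i2
  · exact i3

end AveragedEquation

end HarmonicMapFlow

/-! ### Defects of the averages: commutator and orthogonality. -/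

namespace HarmonicMapFlow

section AveragedInequality

variable {m : ℕ} {T : ℝ≥0∞} {s : ℝ → ℝ} {f f₁ f₂ : ℝ → ℝ → ℝ} {ξ₀ : ℝ → ℝ} {ξ : ℝ → ℝ → ℝ} {κ : ℝ}
  {g : ℝ → ℝ → ℝ} {a b : ℝ} {u g₀ : ℝ → ℝ}

lemma inner_toPair_zero (P : L2Pair) {ψ : ℝ → ℝ} (hψ : MemLp ψ 2 volume) :
    inner ℝ P (toPair (fun _ => 0) ψ) = ∫ x, P.snd x * ψ x := by
  rw [inner_toPair P (IsTest.zero.memLp 2) hψ]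
  simp

lemma inner_logPair_zero (hm : 1 ≤ m) (h : HasWeakDeriv u g₀) (hx : xNorm m 2 u < ∞) {ψ : ℝ → ℝ}
    (hψ : MemLp ψ 2 volume) : inner ℝ (logPair κ u g₀) (toPair (fun _ => 0) ψ)
      = κ * ∫ x, u (Real.exp x) * ψ x := by
  rw [inner_logPair hm h hx (IsTest.zero.memLp 2) hψ]
  simp

lemma eLpNorm_le_of_norm_logPair_le (hm : 1 ≤ m) (hκ : 1 ≤ κ) (h : HasWeakDeriv u g₀)
    (hx : xNorm m 2 u < ∞) {S : ℝ} (hS : ‖logPair κ u g₀‖ ≤ S) :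
    eLpNorm (fun x => u (Real.exp x)) 2 volume ≤ ENNReal.ofReal S := by
  obtain ⟨h0, h1⟩ := h.memLp hm hx
  have h2 := enorm_logPair_sq (κ := κ) (by linarith) h0 h1
  have h3 : eLpNorm (fun x => u (Real.exp x)) 2 volume ≤ ‖logPair κ u g₀‖ₑ := by
    rw [← ENNReal.pow_le_pow_left_iff two_ne_zero, h2]
    refine le_add_left (le_mul_of_one_le_left' (one_le_pow₀ ?_))
    rw [← ENNReal.ofReal_one]
    exact ENNReal.ofReal_le_ofReal hκ
  refine h3.trans ?_
  rw [← ofReal_norm]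
  exact ENNReal.ofReal_le_ofReal hS

/-- The commutator is multiplication by a function bounded by 2m² · 4m e^A ω = 8m³ e^A ω, where ω
bounds the change of log s. -/
lemma enorm_integral_commutator_le (hm : 1 ≤ m)
    (hu : MemLp (fun x => u (Real.exp x)) 2 volume) {S A ω σ σ' : ℝ}
    (hS : eLpNorm (fun x => u (Real.exp x)) 2 volume ≤ ENNReal.ofReal S)
    (hσ : |σ| ≤ A) (hσ' : |σ'| ≤ A) (hω : |σ' - σ| ≤ ω) {φ : ℝ → ℝ} (hφ : IsTest φ) :
    ‖∫ x, u (Real.exp x) * (2 * m ^ 2 * ((sech (m * (x - σ')) ^ 2 - sech (m * (x - σ)) ^ 2)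
      * Real.exp (-x)) * φ x)‖ₑ
      ≤ ENNReal.ofReal (8 * m ^ 3 * Real.exp A * ω * S) * ‖toL2 φ‖ₑ := by
  have hm1 : (1 : ℝ) ≤ m := by exact_mod_cast hm
  have hω0 : 0 ≤ ω := (abs_nonneg _).trans hω
  have hsech : Continuous sech := continuous_sech
  set c : ℝ → ℝ := fun x => 2 * m ^ 2 * ((sech (m * (x - σ')) ^ 2 - sech (m * (x - σ)) ^ 2)
      * Real.exp (-x)) with hc
  have hcc : Continuous c := by fun_prop
  have hcb : ∀ x, |c x| ≤ 8 * m ^ 3 * Real.exp A * ω := fun x => by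
    simp only [hc]
    rw [abs_mul, abs_of_nonneg (by positivity)]
    calc _ ≤ 2 * (m : ℝ) ^ 2 * (4 * m * Real.exp A * ω) := by
          gcongr
          exact (abs_exp_neg_mul_sech_sq_sub_le hm1 hσ hσ' x).trans (by gcongr)
      _ = _ := by ring
  have e : ∀ x, u (Real.exp x) * (c x * φ x) = c x * u (Real.exp x) * φ x := fun x => by ring
  have h1 : ‖∫ x, c x * u (Real.exp x) * φ x‖ₑ
      ≤ eLpNorm (fun x => c x * u (Real.exp x)) 2 volume * ‖toL2 φ‖ₑ :=
    enorm_integral_mul_le (hcc.aestronglyMeasurable.mul hu.1) (hφ.memLp 2)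
  change ‖∫ x, u (Real.exp x) * (c x * φ x)‖ₑ ≤ _
  simp only [e]
  refine h1.trans ?_
  gcongr
  rw [ENNReal.ofReal_mul (by positivity)]
  refine (eLpNorm_le_mul_eLpNorm_of_ae_le_mul (g := fun x => u (Real.exp x))
    (c := 8 * m ^ 3 * Real.exp A * ω) (ae_of_all _ fun x => ?_) 2).trans (by gcongr)
  rw [norm_mul]
  gcongr
  exact hcb x

/-- The orthogonality condition is almost satisfied by the time average. -/
lemma abs_integral_steklov_le (hm : 4 ≤ m) (hκ : 1 ≤ κ)
    (hs : ∀ t ∈ Icc a b, 0 < s t) (hab : a < b)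
    (hg : ∀ t ∈ Icc a b, HasWeakDeriv (ξ t) (g t)) (hx : ∀ t ∈ Icc a b, xNorm m 2 (ξ t) < ∞)
    (hΞ : ContinuousOn (fun t => logPair κ (ξ t) (g t)) (Icc a b))
    (horth : ∀ t ∈ Icc a b, ∫ r, ξ t r * h m (r / s t) ∂rdr = 0)
    {S ω : ℝ} (hS : ∀ τ ∈ Icc a b, ‖logPair κ (ξ τ) (g τ)‖ ≤ S)
    (hω : ∀ τ ∈ Icc a b, |Real.log (s τ) - Real.log (s a)| ≤ ω) (hω1 : ω ≤ 1) :
    |∫ x, (steklov a b fun t => logPair κ (ξ t) (g t)).snd x *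
        (Real.exp (2 * x) * sech (m * (x - Real.log (s a))))|
      ≤ κ * (S * (m * Real.exp m * ω)
      * (Real.exp (2 * Real.log (s a)) * √(∫ x, Real.exp (4 * x) * sech (m * x) ^ 2))) := by
  have hm4 : (4 : ℝ) ≤ m := by exact_mod_cast hm
  have hS0 : 0 ≤ S := (norm_nonneg _).trans (hS a ⟨le_rfl, hab.le⟩)
  obtain ⟨hw, -⟩ := memLp_exp_two_sech hm4 (Real.log (s a))
  have hba : 0 < b - a := sub_pos.2 hab
  rw [← inner_toPair_zero _ hw, inner_steklov hab.le hΞ, abs_mul, abs_of_pos (inv_pos.2 hba),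
    inv_mul_le_iff₀ hba, ← Real.norm_eq_abs]
  have h1 := norm_setIntegral_le_of_norm_le_const (μ := volume) (s := Ioc a b)
    (f := fun τ => inner ℝ (logPair κ (ξ τ) (g τ)) (toPair (fun _ => 0)
      fun x => Real.exp (2 * x) * sech (m * (x - Real.log (s a)))))
    (C := κ * (S * (m * Real.exp m * ω)
      * (Real.exp (2 * Real.log (s a)) * √(∫ x, Real.exp (4 * x) * sech (m * x) ^ 2))))
    (by simp) fun τ hτ' => ?_
  · refine h1.trans (le_of_eq ?_)
    rw [Real.volume_real_Ioc_of_le hab.le, mul_comm]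
  · have hτ := Ioc_subset_Icc_self hτ'
    have hu := ((hg τ hτ).memLp (by omega) (hx τ hτ)).1
    rw [inner_logPair_zero (by omega) (hg τ hτ) (hx τ hτ) hw, norm_mul,
      Real.norm_of_nonneg (by linarith)]
    gcongr
    have h2 := horth τ hτ
    rw [integral_rdr] at h2
    simp only [h_exp_div m (hs τ hτ)] at h2
    -- Each slice is orthogonal to the profile at its own scale s(τ), hence almost orthogonal at the
    -- scale s(a), with a bound that survives averaging.
    refine (abs_integral_mul_sech_le hm4 hu
      (eLpNorm_le_of_norm_logPair_le (by omega) hκ (hg τ hτ) (hx τ hτ) (hS τ hτ)) hS0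
      ((hω τ hτ).trans hω1) ?_).trans ?_
    · rw [← h2]
      refine integral_congr_ae (ae_of_all _ fun x => ?_)
      simp only; ring
    · gcongr
      exact hω τ hτ

end AveragedInequality

end HarmonicMapFlow

/-! ### The differential inequality for the averages. -/

namespace HarmonicMapFlow

section KeyInequality

variable {m : ℕ} {T : ℝ≥0∞} {s : ℝ → ℝ} {f f₁ f₂ : ℝ → ℝ → ℝ} {ξ₀ : ℝ → ℝ} {ξ : ℝ → ℝ → ℝ} {κ : ℝ}
  {g : ℝ → ℝ → ℝ} {a b : ℝ}

/-- The energy estimate for pairs in `L² × L²`. -/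
lemma energy_estimate_pair (hm : 4 ≤ m) (hκ0 : 0 < κ) (hκ : κ ^ 2 = m ^ 2 + 56 * m ^ 4) (σ : ℝ)
    {U V : L2Pair} {e : L2} (hU : IsWeakPair κ U) (hV : IsWeakPair κ V)
    (hweak : ∀ φ : ℝ → ℝ, IsTest φ → ∫ x, U.snd x * (-deriv (deriv φ) x + m ^ 2 * φ x
          - 2 * m ^ 2 * sech (m * (x - σ)) ^ 2 * φ x)
        = (∫ x, V.snd x * (Real.exp (2 * x) * φ x)) + κ * ∫ x, e x * (Real.exp x * φ x)) :
    ∃ W : ℝ, 0 ≤ W ∧ (∀ᵐ x, (Real.exp (-x) * (κ⁻¹ * U.snd x)) ^ 2 ≤ (3 * m ^ 4 + 7) * W) ∧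
      (∀ᵐ x, (Real.exp (-x) * U.fst x) ^ 2 ≤ (3 * m ^ 4 + 7) * W) ∧
      W / 2 ≤ inner ℝ U V + (1 + 196 * m ^ 4) * ‖e‖ ^ 2 + 512 * m ^ 5 * (Real.exp (-3 * σ)
          * (κ⁻¹ * ∫ x, U.snd x * (Real.exp (2 * x) * sech (m * (x - σ))))) ^ 2 := by
  have hm4 : (4 : ℝ) ≤ m := by exact_mod_cast hm
  obtain ⟨u, u₁, hu, hu1, hu0⟩ := hU.exists_isH1 hκ0.ne'
  obtain ⟨v, v₁, hv, hv1, hv0⟩ := hV.exists_isH1 hκ0.ne'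
  have he : MemLp e 2 volume := Lp.memLp e
  have hsech : Continuous sech := continuous_sech
  have e0 : ∀ w : ℝ → ℝ, ∫ x, U.snd x * w x = κ * ∫ x, u x * w x := fun w => by
    rw [← integral_const_mul]
    refine integral_congr_ae ?_
    filter_upwards [hu0] with x hx
    rw [hx]; ring
  obtain ⟨W, h0, h1, h2, h3⟩ := energy_estimate hm4 σ hu hv he fun φ hφ => by
    have hc : Continuous φ := hφ.continuous
    have i1 : Integrable fun x => u₁ x * deriv φ x :=
      MemLp.integrable_mul_two hu.memLp_deriv (hφ.deriv.memLp 2)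
    have i2 : Integrable fun x => u x * φ x := MemLp.integrable_mul_two hu.memLp (hφ.memLp 2)
    have i3 : Integrable fun x => u x * deriv (deriv φ) x :=
      MemLp.integrable_mul_two hu.memLp (hφ.deriv.deriv.memLp 2)
    have i4 : Integrable fun x => u x * (sech (m * (x - σ)) ^ 2 * φ x) :=
      MemLp.integrable_mul_two hu.memLp (hφ.memLp_mul (by fun_prop) 2)
    have i5 : Integrable fun x => v x * (Real.exp (2 * x) * φ x) :=
      MemLp.integrable_mul_two hv.memLp (hφ.memLp_mul (by fun_prop) 2)
    have i6 : Integrable fun x => e x * (Real.exp x * φ x) :=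
      MemLp.integrable_mul_two he (hφ.memLp_mul (by fun_prop) 2)
    have j1 := hweak φ hφ
    have j2 := hU _ hφ.deriv
    rw [inner_toPair U ((hφ.deriv.memLp 2).const_mul κ) (hφ.deriv.deriv.memLp 2), e0] at j2
    have j3 : ∫ x, U.fst x * (κ * deriv φ x) = κ * ∫ x, u₁ x * deriv φ x := by
      rw [← integral_const_mul]
      refine integral_congr_ae ?_
      filter_upwards [hu1] with x hx
      rw [hx]; ring
    have j4 : ∫ x, V.snd x * (Real.exp (2 * x) * φ x)
        = κ * ∫ x, v x * (Real.exp (2 * x) * φ x) := by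
      rw [← integral_const_mul]
      refine integral_congr_ae ?_
      filter_upwards [hv0] with x hx
      rw [hx]; ring
    have j5 : ∫ x, u x * (-deriv (deriv φ) x + m ^ 2 * φ x
          - 2 * m ^ 2 * sech (m * (x - σ)) ^ 2 * φ x) = -(∫ x, u x * deriv (deriv φ) x)
          + m ^ 2 * (∫ x, u x * φ x) - 2 * m ^ 2 * ∫ x, u x * (sech (m * (x - σ)) ^ 2 * φ x) := by
      have i7 : Integrable fun x => -(u x * deriv (deriv φ) x) := i3.neg
      have i8 : Integrable fun x => -(u x * deriv (deriv φ) x) + m ^ 2 * (u x * φ x) :=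
        i7.add (i2.const_mul _)
      rw [← integral_neg, ← integral_const_mul, ← integral_const_mul,
        ← integral_add i7 (i2.const_mul _), ← integral_sub i8 (i4.const_mul _)]
      refine integral_congr_ae (ae_of_all _ fun x => ?_)
      simp only; ring
    have j6 : ∫ x, (u₁ x * deriv φ x + m ^ 2 * (u x * φ x))
        = (∫ x, u₁ x * deriv φ x) + m ^ 2 * ∫ x, u x * φ x := by
      rw [integral_add i1 (i2.const_mul _), integral_const_mul]
    have j7 : ∫ x, (Real.exp (2 * x) * v x + Real.exp x * e x
        + 2 * m ^ 2 * sech (m * (x - σ)) ^ 2 * u x) * φ x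
        = (∫ x, v x * (Real.exp (2 * x) * φ x)) + (∫ x, e x * (Real.exp x * φ x))
          + 2 * m ^ 2 * ∫ x, u x * (sech (m * (x - σ)) ^ 2 * φ x) := by
      have i7 : Integrable fun x => v x * (Real.exp (2 * x) * φ x) + e x * (Real.exp x * φ x) :=
        i5.add i6
      rw [← integral_const_mul, ← integral_add i5 i6, ← integral_add i7 (i4.const_mul _)]
      refine integral_congr_ae (ae_of_all _ fun x => ?_)
      simp only; ring
    rw [e0, j5, j4] at j1
    rw [j3] at j2
    rw [j6, j7]
    have j8 : (∫ x, u₁ x * deriv φ x) + ∫ x, u x * deriv (deriv φ) x = 0 := by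
      have := mul_eq_zero.1 ((mul_add _ _ _).trans j2)
      exact this.resolve_left hκ0.ne'
    have j9 := mul_left_cancel₀ hκ0.ne' (j1.trans (mul_add _ _ _).symm)
    linarith
  refine ⟨W, h0, ?_, ?_, h3.trans (le_of_eq ?_)⟩
  · filter_upwards [h1, hu0] with x hx hx0
    rwa [hx0, inv_mul_cancel_left₀ hκ0.ne']
  · filter_upwards [h2, hu1] with x hx hx1
    rwa [hx1]
  · rw [e0, inv_mul_cancel_left₀ hκ0.ne', L2_norm_sq, WithLp.prod_inner_apply]
    change _ = inner ℝ U.fst V.fst + inner ℝ U.snd V.snd + _ + _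
    rw [inner_L2, inner_L2]
    have k1 : ∫ x, U.fst x * V.fst x = ∫ x, u₁ x * v₁ x := by
      refine integral_congr_ae ?_
      filter_upwards [hu1, hv1] with x hx hx'
      rw [hx, hx']
    have k2 : ∫ x, U.snd x * V.snd x = κ ^ 2 * ∫ x, v x * u x := by
      rw [← integral_const_mul]
      refine integral_congr_ae ?_
      filter_upwards [hu0, hv0] with x hx hx'
      rw [hx, hx']; ring
    have k3 : ∫ x, (u₁ x * v₁ x + m ^ 2 * (u x * v x))
        = (∫ x, u₁ x * v₁ x) + m ^ 2 * ∫ x, v x * u x := by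
      rw [← integral_const_mul, ← integral_add
        (MemLp.integrable_mul_two hu.memLp_deriv hv.memLp_deriv)
        ((MemLp.integrable_mul_two hv.memLp hu.memLp).const_mul _)]
      refine integral_congr_ae (ae_of_all _ fun x => ?_)
      simp only; ring
    -- Here the choice of κ enters: the inner product of pairs is the X² pairing plus 56 m⁴ times
    -- the L² pairing, the combination of multipliers in `energy_estimate`.
    rw [k1, k2, k3, hκ]
    ring

/-- The differential inequality for the time averages of a solution. -/
theorem IsLinearizedSolution.averaged_inequality (hsol : IsLinearizedSolution m T s f ξ₀ ξ)
    (hm : 4 ≤ m) (hκ0 : 0 < κ) (hκ : κ ^ 2 = m ^ 2 + 56 * m ^ 4)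
    (hs : ∀ t ∈ timeInterval T, 0 < s t) (hsc : ContinuousOn s (timeInterval T))
    (hg : ∀ t ∈ timeInterval T, HasWeakDeriv (ξ t) (g t))
    (hΞ : ContinuousOn (fun t => logPair κ (ξ t) (g t)) (timeInterval T))
    (horth : ∀ t ∈ timeInterval T, ∫ r, ξ t r * h m (r / s t) ∂rdr = 0)
    (hf₁ : LocallyIntegrableOn (fun z : ℝ × ℝ => f₁ z.1 z.2) (spaceTime T))
    (hf₂ : LocallyIntegrableOn (fun z : ℝ × ℝ => f₂ z.1 z.2) (spaceTime T))
    (hf : ∀ᵐ z : ℝ × ℝ ∂(volume.restrict (spaceTime T)), f z.1 z.2 = f₁ z.1 z.2 + f₂ z.1 z.2)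
    (hab : a < b) (hI : Icc a b ⊆ openTime T) {S A ω : ℝ}
    (hS : ∀ τ ∈ Icc a b, ‖logPair κ (ξ τ) (g τ)‖ ≤ S)
    (hA : ∀ τ ∈ Icc a b, |Real.log (s τ)| ≤ A)
    (hω : ∀ τ ∈ Icc a b, |Real.log (s τ) - Real.log (s a)| ≤ ω) (hω1 : ω ≤ 1)
    (hN₁ : ∫⁻ τ in Ioc a b, xNorm m 2 (f₁ τ) ≠ ∞)
    (hN₂ : ∫⁻ τ in Ioc a b, xNorm m 1 (f₂ τ) ^ 2 ≠ ∞) :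
    ∃ W : ℝ, 0 ≤ W ∧
      (∀ᵐ x, (Real.exp (-x) * (κ⁻¹ * (steklov a b fun t => logPair κ (ξ t) (g t)).snd x)) ^ 2
        ≤ (3 * m ^ 4 + 7) * W) ∧
      (∀ᵐ x, (Real.exp (-x) * (steklov a b fun t => logPair κ (ξ t) (g t)).fst x) ^ 2
        ≤ (3 * m ^ 4 + 7) * W) ∧
      W + 2 * inner ℝ (steklov a b fun t => logPair κ (ξ t) (g t))
          ((b - a)⁻¹ • (logPair κ (ξ b) (g b) - logPair κ (ξ a) (g a)))
        ≤ 2 * κ * ‖steklov a b fun t => logPair κ (ξ t) (g t)‖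
            * ((b - a)⁻¹ * (∫⁻ τ in Ioc a b, xNorm m 2 (f₁ τ)).toReal)
          + 4 * (1 + 196 * m ^ 4) * ((b - a)⁻¹ * (∫⁻ τ in Ioc a b, xNorm m 1 (f₂ τ) ^ 2).toReal)
          + (4 * (1 + 196 * m ^ 4) * (8 * m ^ 3 * Real.exp A * S) ^ 2 + 1024 * m ^ 5
            * (S * (m * Real.exp m) * (Real.exp A * √(∫ x, Real.exp (4 * x) * sech (m * x) ^ 2)))
            ^ 2) * ω ^ 2 := by
  have hm4 : (4 : ℝ) ≤ m := by exact_mod_cast hm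
  have hm1 : 1 ≤ m := by omega
  have hκm : (m : ℝ) ≤ κ := by
    refine le_of_sq_le_sq ?_ hκ0.le
    rw [hκ]
    have : (0 : ℝ) ≤ 56 * m ^ 4 := by positivity
    linarith
  have hκ1 : 1 ≤ κ := by linarith
  have hba : 0 < b - a := sub_pos.2 hab
  have hba' : 0 < (b - a)⁻¹ := inv_pos.2 hba
  have haI : a ∈ Icc a b := ⟨le_rfl, hab.le⟩
  have hbI : b ∈ Icc a b := ⟨hab.le, le_rfl⟩
  have hIT : Icc a b ⊆ timeInterval T := hI.trans (openTime_subset T)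
  have hS0 : 0 ≤ S := (norm_nonneg _).trans (hS a haI)
  have hω0 : 0 ≤ ω := (abs_nonneg _).trans (hω a haI)
  have hΞI := hΞ.mono hIT
  have hsech : Continuous sech := continuous_sech
  obtain ⟨P, hP, hPn, hPi⟩ := exists_average_pair (κ := κ) hf₁ hab hI
    (fun τ => ENNReal.ofReal κ * xNorm m 2 (f₁ τ))
    (fun τ _ α β hα hβ => enorm_integral_pair_le hm1 hκm (f₁ τ) hα hβ)
    (by rw [lintegral_const_mul' _ _ ENNReal.ofReal_ne_top]
        exact ENNReal.mul_ne_top ENNReal.ofReal_ne_top hN₁)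
  have hsq := sq_lintegral_le (fun τ => xNorm m 1 (f₂ τ)) (a := a) (b := b)
  have hN₂' : ∫⁻ τ in Ioc a b, xNorm m 1 (f₂ τ) ≠ ∞ := fun h => by
    rw [h] at hsq
    exact ENNReal.mul_ne_top ENNReal.ofReal_ne_top hN₂ (by simpa using hsq)
  obtain ⟨e₂, he₂, he₂i⟩ := exists_average_L2 hf₂ hab hI (c := fun _ x => Real.exp x)
    (Continuous.continuousOn (by fun_prop)) (fun τ => xNorm m 1 (f₂ τ))
    (fun τ _ φ hφ => enorm_integral_exp_mul_le hm1 (f₂ τ) hφ) hN₂'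
  have hlog : ContinuousOn (fun z : ℝ × ℝ => Real.log (s z.1)) (Icc a b ×ˢ (univ : Set ℝ)) :=
    ((hsc.mono hIT).log fun t ht => (hs t (hIT ht)).ne').comp continuousOn_fst fun z hz => hz.1
  -- The average of the commutator with the frozen potential, treated as a third forcing term; it is
  -- O(ω) in L².
  obtain ⟨e₃, he₃, he₃i⟩ := exists_average_L2 hsol.locInt hab hI
    (c := fun τ x => 2 * m ^ 2 * ((sech (m * (x - Real.log (s τ))) ^ 2
      - sech (m * (x - Real.log (s a))) ^ 2) * Real.exp (-x)))
    (by
      have h2 : ContinuousOn (fun z : ℝ × ℝ => sech (m * (z.2 - Real.log (s z.1))))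
          (Icc a b ×ˢ (univ : Set ℝ)) :=
        hsech.comp_continuousOn (continuousOn_const.mul (continuousOn_snd.sub hlog))
      refine continuousOn_const.mul ((ContinuousOn.sub (h2.pow 2) ?_).mul ?_)
      all_goals exact Continuous.continuousOn (by fun_prop))
    (fun _ => ENNReal.ofReal (8 * m ^ 3 * Real.exp A * ω * S))
    (fun τ hτ' φ hφ => by
      have hτ := Ioc_subset_Icc_self hτ'
      exact enorm_integral_commutator_le hm1
        ((hg τ (hIT hτ)).memLp hm1 (hsol.memX τ (hIT hτ))).1
        (eLpNorm_le_of_norm_logPair_le hm1 hκ1 (hg τ (hIT hτ)) (hsol.memX τ (hIT hτ)) (hS τ hτ))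
        (hA a haI) (hA τ hτ) (hω τ hτ) hφ)
    (by rw [lintegral_const]; simp [ENNReal.mul_ne_top])
  set Ξ := fun t => logPair κ (ξ t) (g t) with hΞd
  set U := steklov a b Ξ with hU
  have hUw : IsWeakPair κ U := isWeakPair_steklov hab.le hΞI fun τ hτ =>
    isWeakPair_logPair hm1 (hg τ (hIT hτ)) (hsol.memX τ (hIT hτ))
  have hΞw : ∀ τ ∈ Icc a b, IsWeakPair κ (Ξ τ) := fun τ hτ =>
    isWeakPair_logPair hm1 (hg τ (hIT hτ)) (hsol.memX τ (hIT hτ))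
  -- This is the time derivative of the average. In the energy estimate V = P - U' plays the role of
  -- f₁ - u_t, and the inner product of U with U' is half the derivative of ‖U‖².
  set U' := (b - a)⁻¹ • (Ξ b - Ξ a) with hU'
  have hVw : IsWeakPair κ (P - U') := hP.sub (((hΞw b hbI).sub (hΞw a haI)).smul _)
  have hΞψ : ∀ τ ∈ Icc a b, ∀ {ψ : ℝ → ℝ}, MemLp ψ 2 volume →
      inner ℝ (Ξ τ) (toPair (fun _ => 0) ψ) = κ * ∫ x, ξ τ (Real.exp x) * ψ x :=
    fun τ hτ ψ hψ => inner_logPair_zero hm1 (hg τ (hIT hτ)) (hsol.memX τ (hIT hτ)) hψ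
  obtain ⟨W, hW0, hW1, hW2, hW⟩ := energy_estimate_pair hm hκ0 hκ (Real.log (s a)) hUw hVw
    (e := e₂ + e₃) fun φ hφ => by
      have hc : Continuous φ := hφ.continuous
      have hψ : IsTest fun x => Real.exp (2 * x) * φ x := hφ.contDiff_mul (by fun_prop)
      have hψ' : IsTest fun x => Real.exp x * φ x := hφ.contDiff_mul (by fun_prop)
      have hχ : MemLp (fun x => -deriv (deriv φ) x + m ^ 2 * φ x
          - 2 * m ^ 2 * sech (m * (x - Real.log (s a))) ^ 2 * φ x) 2 volume :=
        ((hφ.deriv.deriv.memLp 2).neg.add ((hφ.memLp 2).const_mul _)).sub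
          (hφ.memLp_mul (by fun_prop) 2)
      have h1 := hsol.averaged_equation hm1 hκ0 hs hsc hg hΞ hf₁ hf₂ hf hab.le hI hφ
      have h2 : ∫ x, U.snd x * (-deriv (deriv φ) x + m ^ 2 * φ x
          - 2 * m ^ 2 * sech (m * (x - Real.log (s a))) ^ 2 * φ x)
          = κ * ((b - a)⁻¹ * ∫ τ in Ioc a b, ∫ x, ξ τ (Real.exp x) * (-deriv (deriv φ) x
            + m ^ 2 * φ x - 2 * m ^ 2 * sech (m * (x - Real.log (s a))) ^ 2 * φ x)) := by
        rw [← inner_toPair_zero U hχ, hU, inner_steklov hab.le hΞI,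
          setIntegral_congr_fun measurableSet_Ioc fun τ hτ => hΞψ τ (Ioc_subset_Icc_self hτ) hχ,
          integral_const_mul]
        ring
      have h3 : ∫ x, (P - U').snd x * (Real.exp (2 * x) * φ x)
          = (∫ x, P.snd x * (Real.exp (2 * x) * φ x)) - κ * ((b - a)⁻¹ *
            ((∫ x, ξ b (Real.exp x) * (Real.exp (2 * x) * φ x))
            - ∫ x, ξ a (Real.exp x) * (Real.exp (2 * x) * φ x))) := by
        rw [← inner_toPair_zero _ (hψ.memLp 2), ← inner_toPair_zero _ (hψ.memLp 2),
          inner_sub_left, hU', real_inner_smul_left, inner_sub_left, hΞψ b hbI (hψ.memLp 2),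
          hΞψ a haI (hψ.memLp 2)]
        ring
      have h4 : ∫ x, (e₂ + e₃) x * (Real.exp x * φ x)
          = (∫ x, e₂ x * (Real.exp x * φ x)) + ∫ x, e₃ x * (Real.exp x * φ x) := by
        rw [← inner_toL2 _ (hψ'.memLp 2), ← inner_toL2 _ (hψ'.memLp 2),
          ← inner_toL2 _ (hψ'.memLp 2), inner_add_left]
      rw [h2, h3, h4, hPi _ hψ, he₂i _ hψ', he₃i _ hψ', h1]
      ring
  refine ⟨W, hW0, hW1, hW2, ?_⟩
  have k1 := abs_integral_steklov_le (by omega) hκ1 (fun t ht => hs t (hIT ht)) hab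
    (fun t ht => hg t (hIT ht)) (fun t ht => hsol.memX t (hIT ht)) hΞI
    (fun t ht => horth t (hIT ht)) hS hω hω1
  set d := (b - a)⁻¹ with hd
  set σ := Real.log (s a) with hσ
  set K := √(∫ x, Real.exp (4 * x) * sech (m * x) ^ 2) with hK
  have hK0 : 0 ≤ K := Real.sqrt_nonneg _
  rw [lintegral_const_mul' _ _ ENNReal.ofReal_ne_top, ENNReal.toReal_mul,
    ENNReal.toReal_ofReal hκ0.le] at hPn
  have k2 : ‖e₂‖ ^ 2 ≤ d * (∫⁻ τ in Ioc a b, xNorm m 1 (f₂ τ) ^ 2).toReal := by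
    -- Cauchy–Schwarz in time bounds the square of the averaged X¹ norm by the average of its
    -- square, matching the L² norm in time of f₂.
    have h1 := ENNReal.toReal_mono (ENNReal.mul_ne_top ENNReal.ofReal_ne_top hN₂) hsq
    rw [ENNReal.toReal_pow, ENNReal.toReal_mul, ENNReal.toReal_ofReal hba.le] at h1
    calc ‖e₂‖ ^ 2 ≤ (d * (∫⁻ τ in Ioc a b, xNorm m 1 (f₂ τ)).toReal) ^ 2 := by gcongr
      _ = d ^ 2 * (∫⁻ τ in Ioc a b, xNorm m 1 (f₂ τ)).toReal ^ 2 := by ring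
      _ ≤ d ^ 2 * ((b - a) * (∫⁻ τ in Ioc a b, xNorm m 1 (f₂ τ) ^ 2).toReal) := by gcongr
      _ = _ := by rw [hd]; field_simp
  have k3 : ‖e₃‖ ≤ 8 * m ^ 3 * Real.exp A * ω * S := by
    rw [lintegral_const, ENNReal.toReal_mul, ENNReal.toReal_ofReal (by positivity)] at he₃
    simp only [Measure.restrict_apply_univ, Real.volume_Ioc, ENNReal.toReal_ofReal hba.le] at he₃
    refine he₃.trans (le_of_eq ?_)
    rw [hd]; field_simp
  have k4 : ‖e₂ + e₃‖ ^ 2 ≤ 2 * ‖e₂‖ ^ 2 + 2 * ‖e₃‖ ^ 2 := by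
    have h1 := norm_add_le e₂ e₃
    have h2 : ‖e₂ + e₃‖ ^ 2 ≤ (‖e₂‖ + ‖e₃‖) ^ 2 := by gcongr
    nlinarith [sq_nonneg (‖e₂‖ - ‖e₃‖)]
  have k5 : (Real.exp (-3 * σ) * (κ⁻¹ * ∫ x, U.snd x * (Real.exp (2 * x)
      * sech (m * (x - σ))))) ^ 2 ≤ (S * (m * Real.exp m) * (Real.exp A * K)) ^ 2 * ω ^ 2 := by
    rw [← mul_pow, sq_le_sq, abs_mul, abs_mul, Real.abs_exp, abs_of_pos (inv_pos.2 hκ0)]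
    refine le_trans ?_ (le_abs_self _)
    have h1 : Real.exp (-3 * σ) * Real.exp (2 * σ) ≤ Real.exp A := by
      rw [← Real.exp_add]
      exact Real.exp_le_exp.2 (by have := neg_abs_le σ; have := hA a haI; linarith)
    calc _ ≤ Real.exp (-3 * σ) * (κ⁻¹ * (κ * (S * (m * Real.exp m * ω)
          * (Real.exp (2 * σ) * K)))) := by gcongr
      _ = S * (m * Real.exp m) * ((Real.exp (-3 * σ) * Real.exp (2 * σ)) * K) * ω := by
          field_simp
      _ ≤ _ := by gcongr
  have k6 : inner ℝ U P ≤ ‖U‖ * (d * (κ * (∫⁻ τ in Ioc a b, xNorm m 2 (f₁ τ)).toReal)) :=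
    (real_inner_le_norm U P).trans (by gcongr)
  have k7 : ‖e₃‖ ^ 2 ≤ (8 * m ^ 3 * Real.exp A * S) ^ 2 * ω ^ 2 := by
    rw [← mul_pow]
    exact pow_le_pow_left₀ (norm_nonneg _) (k3.trans (le_of_eq (by ring))) 2
  rw [inner_sub_right] at hW
  have k8 : (1 + 196 * (m : ℝ) ^ 4) * ‖e₂ + e₃‖ ^ 2 ≤ (1 + 196 * (m : ℝ) ^ 4)
      * (2 * (d * (∫⁻ τ in Ioc a b, xNorm m 1 (f₂ τ) ^ 2).toReal)
        + 2 * ((8 * m ^ 3 * Real.exp A * S) ^ 2 * ω ^ 2)) := by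
    gcongr
    linarith
  have k9 : 512 * (m : ℝ) ^ 5 * (Real.exp (-3 * σ) * (κ⁻¹ * ∫ x, U.snd x * (Real.exp (2 * x)
      * sech (m * (x - σ))))) ^ 2
      ≤ 512 * (m : ℝ) ^ 5 * ((S * (m * Real.exp m) * (Real.exp A * K)) ^ 2 * ω ^ 2) := by
    gcongr
  linarith

end KeyInequality

end HarmonicMapFlow

/-! ### Integration in time of the averaged inequality. -/

namespace HarmonicMapFlow

section TimeIntegration

/-- The averages of a possibly non-measurable density have at most its total mass. -/
lemma integral_average_lintegral_le {N : ℝ → ℝ≥0∞} {p q δ : ℝ} (hδ : 0 < δ) (hpq : p ≤ q)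
    (hfin : ∫⁻ τ in Ioc p (q + δ), N τ ≠ ∞) :
    IntervalIntegrable (fun t => δ⁻¹ * (∫⁻ τ in Ioc t (t + δ), N τ).toReal) volume p q ∧
      ∫ t in p..q, δ⁻¹ * (∫⁻ τ in Ioc t (t + δ), N τ).toReal
        ≤ (∫⁻ τ in Ioc p (q + δ), N τ).toReal := by
  -- Without measurability of N, Tonelli is replaced by the monotone primitive M: the window
  -- integral is M(t + δ) - M(t). Truncating at q + δ keeps M finite and monotone on the whole line.
  set M : ℝ → ℝ := fun t => (∫⁻ τ in Ioc p (min t (q + δ)), N τ).toReal with hM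
  have hfin' : ∀ t, ∫⁻ τ in Ioc p (min t (q + δ)), N τ ≠ ∞ := fun t =>
    ne_top_of_le_ne_top hfin (lintegral_mono_set (Ioc_subset_Ioc_right (min_le_right _ _)))
  have hmono : Monotone M := fun t t' htt => ENNReal.toReal_mono (hfin' t')
    (lintegral_mono_set (Ioc_subset_Ioc_right (min_le_min_right _ htt)))
  have hM0 : ∀ t, 0 ≤ M t := fun t => ENNReal.toReal_nonneg
  have hdiff : ∀ t ∈ Icc p q, (∫⁻ τ in Ioc t (t + δ), N τ).toReal = M (t + δ) - M t := by
    intro t ht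
    have h1 : min (t + δ) (q + δ) = t + δ := min_eq_left (by linarith [ht.2])
    have h2 : min t (q + δ) = t := min_eq_left (by linarith [ht.2])
    have h3 := hfin' t
    have h4 : ∫⁻ τ in Ioc t (t + δ), N τ ≠ ∞ := ne_top_of_le_ne_top hfin
      (lintegral_mono_set (Ioc_subset_Ioc ht.1 (by linarith [ht.2])))
    simp only [hM, h1, h2] at h3 ⊢
    rw [← Ioc_union_Ioc_eq_Ioc ht.1 (show t ≤ t + δ by linarith),
      lintegral_union measurableSet_Ioc (Ioc_disjoint_Ioc_of_le le_rfl), ENNReal.toReal_add h3 h4]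
    ring
  have hi : ∀ c d, IntervalIntegrable M volume c d := fun c d => hmono.intervalIntegrable
  have hi' : IntervalIntegrable (fun t => M (t + δ)) volume p q :=
    Monotone.intervalIntegrable fun t t' h => hmono (by linarith)
  have hcongr : EqOn (fun t => δ⁻¹ * (∫⁻ τ in Ioc t (t + δ), N τ).toReal)
      (fun t => δ⁻¹ * (M (t + δ) - M t)) (uIcc p q) := fun t ht => by
    rw [uIcc_of_le hpq] at ht
    simp only [hdiff t ht]
  refine ⟨((hi'.sub (hi p q)).const_mul δ⁻¹).congr fun t ht =>
    (hcongr (uIoc_subset_uIcc ht)).symm, ?_⟩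
  rw [intervalIntegral.integral_congr hcongr, intervalIntegral.integral_const_mul,
    intervalIntegral.integral_sub hi' (hi p q), intervalIntegral.integral_comp_add_right,
    intervalIntegral.integral_interval_sub_interval_comm (hi _ _) (hi _ _) (hi _ _),
    inv_mul_le_iff₀ hδ]
  have h1 : 0 ≤ ∫ t in p..p + δ, M t :=
    intervalIntegral.integral_nonneg (by linarith) fun t _ => hM0 t
  have h2 : ∫ t in q..q + δ, M t ≤ ∫ _ in q..q + δ, M (q + δ) :=
    intervalIntegral.integral_mono_on (by linarith) (hi _ _) intervalIntegrable_const
      fun t ht => hmono ht.2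
  have h3 : M (q + δ) = (∫⁻ τ in Ioc p (q + δ), N τ).toReal := by simp [hM]
  rw [intervalIntegral.integral_const, add_sub_cancel_left, smul_eq_mul, h3] at h2
  have h4 : ∫ t in p + δ..p, M t = -∫ t in p..p + δ, M t := intervalIntegral.integral_symm _ _
  have h5 : ∫ t in q + δ..q, M t = -∫ t in q..q + δ, M t := intervalIntegral.integral_symm _ _
  linarith

variable {H : Type*} [NormedAddCommGroup H] [InnerProductSpace ℝ H]

/-- Integration of a differential inequality for the square of the norm of a curve. -/
lemma integrate_inequality {U U' : ℝ → H} {N₁ N₂ W : ℝ → ℝ} {p q α B₁ B₂ : ℝ} (hpq : p ≤ q)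
    (hα : 0 ≤ α)
    (hU : ∀ t ∈ Icc p q, HasDerivAt U (U' t) t) (hU' : ContinuousOn U' (Icc p q))
    (hN₁ : IntervalIntegrable N₁ volume p q) (hN₂ : IntervalIntegrable N₂ volume p q)
    (hN₁0 : ∀ t, 0 ≤ N₁ t) (hN₂0 : ∀ t, 0 ≤ N₂ t)
    (hB₁' : ∫ t in p..q, N₁ t ≤ B₁) (hB₂ : ∫ t in p..q, N₂ t ≤ B₂)
    (hW0 : ∀ t ∈ Icc p q, 0 ≤ W t)
    (hW : ∀ t ∈ Icc p q, W t + 2 * inner ℝ (U t) (U' t) ≤ α * ‖U t‖ * N₁ t + N₂ t) :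
    (∀ t ∈ Icc p q, ‖U t‖ ^ 2 ≤ 2 * ‖U p‖ ^ 2 + α ^ 2 * B₁ ^ 2 + 2 * B₂) ∧
    ∃ D : ℝ → ℝ, IntegrableOn D (Icc p q) ∧ (∀ t ∈ Icc p q, W t ≤ D t) ∧
      ∫ t in Icc p q, D t ≤ 2 * ‖U p‖ ^ 2 + α ^ 2 * B₁ ^ 2 + 2 * B₂ := by
  have hUc : ContinuousOn U (Icc p q) := fun t ht => (hU t ht).continuousAt.continuousWithinAt
  obtain ⟨t₀, ht₀, hmax⟩ := isCompact_Icc.exists_isMaxOn (nonempty_Icc.2 hpq) hUc.norm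
  set R := ‖U t₀‖ with hR
  have hR0 : 0 ≤ R := norm_nonneg _
  have hUR : ∀ t ∈ Icc p q, ‖U t‖ ≤ R := fun t ht => hmax ht
  -- W is only given pointwise in time and may fail to be measurable, so it is replaced by this
  -- integrable majorant.
  set D : ℝ → ℝ := fun t => α * ‖U t‖ * N₁ t + N₂ t - 2 * inner ℝ (U t) (U' t) with hD
  have hWD : ∀ t ∈ Icc p q, W t ≤ D t := fun t ht => by have := hW t ht; simp only [hD]; linarith
  have hD0 : ∀ t ∈ Icc p q, 0 ≤ D t := fun t ht => (hW0 t ht).trans (hWD t ht)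
  have hd : ∀ t ∈ Icc p q, IntervalIntegrable D volume p t ∧
      ‖U t‖ ^ 2 + ∫ τ in p..t, D τ ≤ ‖U p‖ ^ 2 + α * R * B₁ + B₂ := by
    intro t ht
    have hsub : uIcc p t ⊆ Icc p q := by
      rw [uIcc_of_le ht.1]; exact Icc_subset_Icc_right ht.2
    have hsub' : uIcc p t ⊆ uIcc p q := by rw [uIcc_of_le hpq]; exact hsub
    have i1 : IntervalIntegrable (fun τ => 2 * inner ℝ (U τ) (U' τ)) volume p t :=
      ContinuousOn.intervalIntegrable (continuousOn_const.mul
        ((hUc.mono hsub).inner (hU'.mono hsub)))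
    have i2 : IntervalIntegrable (fun τ => α * ‖U τ‖ * N₁ τ) volume p t :=
      (hN₁.mono_set hsub').continuousOn_mul (continuousOn_const.mul (hUc.mono hsub).norm)
    have i3 := hN₂.mono_set hsub'
    have h1 : ∫ τ in p..t, 2 * inner ℝ (U τ) (U' τ) = ‖U t‖ ^ 2 - ‖U p‖ ^ 2 :=
      intervalIntegral.integral_eq_sub_of_hasDerivAt (f := fun τ => ‖U τ‖ ^ 2)
        (fun τ hτ => (hU τ (hsub hτ)).norm_sq) i1
    have i4 : IntervalIntegrable (fun τ => α * ‖U τ‖ * N₁ τ + N₂ τ) volume p t := i2.add i3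
    refine ⟨i4.sub i1, ?_⟩
    have h2 : ∫ τ in p..t, D τ = (∫ τ in p..t, α * ‖U τ‖ * N₁ τ) + (∫ τ in p..t, N₂ τ)
        - (‖U t‖ ^ 2 - ‖U p‖ ^ 2) := by
      rw [← h1, ← intervalIntegral.integral_add i2 i3, ← intervalIntegral.integral_sub i4 i1]
    have h3 : ∫ τ in p..t, α * ‖U τ‖ * N₁ τ ≤ α * R * B₁ := by
      have h4 : ∫ τ in p..t, α * ‖U τ‖ * N₁ τ ≤ ∫ τ in p..t, α * R * N₁ τ :=
        intervalIntegral.integral_mono_on ht.1 i2 ((hN₁.mono_set hsub').const_mul _) fun τ hτ => by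
          have := hUR τ (hsub (by rwa [uIcc_of_le ht.1]))
          have := hN₁0 τ
          gcongr
      rw [intervalIntegral.integral_const_mul] at h4
      have h5 : ∫ τ in p..t, N₁ τ ≤ ∫ τ in p..q, N₁ τ :=
        intervalIntegral.integral_mono_interval le_rfl ht.1 ht.2 (ae_of_all _ hN₁0) hN₁
      have : 0 ≤ α * R := by positivity
      nlinarith
    have h6 : ∫ τ in p..t, N₂ τ ≤ ∫ τ in p..q, N₂ τ :=
      intervalIntegral.integral_mono_interval le_rfl ht.1 ht.2 (ae_of_all _ hN₂0) hN₂
    linarith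
  -- R is the maximum of ‖U‖, so half of R² can be absorbed on the left at the time where it is
  -- attained. This allows forcing that is only L¹ in time.
  have hyoung : α * R * B₁ ≤ R ^ 2 / 2 + α ^ 2 * B₁ ^ 2 / 2 := by nlinarith [sq_nonneg (R - α * B₁)]
  have hRb : R ^ 2 ≤ 2 * ‖U p‖ ^ 2 + α ^ 2 * B₁ ^ 2 + 2 * B₂ := by
    have h1 := (hd t₀ ht₀).2
    have h2 : 0 ≤ ∫ τ in p..t₀, D τ := intervalIntegral.integral_nonneg ht₀.1 fun τ hτ =>
      hD0 τ ⟨hτ.1, hτ.2.trans ht₀.2⟩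
    linarith
  refine ⟨fun t ht => le_trans (by have := hUR t ht; gcongr) hRb, D, ?_, hWD, ?_⟩
  · rw [integrableOn_Icc_iff_integrableOn_Ioc]
    exact (intervalIntegrable_iff_integrableOn_Ioc_of_le hpq).1 (hd q ⟨hpq, le_rfl⟩).1
  · rw [integral_Icc_eq_integral_Ioc, ← intervalIntegral.integral_of_le hpq]
    have h1 := (hd q ⟨hpq, le_rfl⟩).2
    have h2 := sq_nonneg ‖U q‖
    linarith

end TimeIntegration

section Averages

variable {Ξ : ℝ → L2Pair} {I : Set ℝ}

lemma hasDerivAt_steklov (hI : IsOpen I) (hI' : OrdConnected I) (hΞ : ContinuousOn Ξ I) {t δ : ℝ}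
    (ht : t ∈ I) (htδ : t + δ ∈ I) :
    HasDerivAt (fun t => steklov t (t + δ) Ξ) ((t + δ - t)⁻¹ • (Ξ (t + δ) - Ξ t)) t := by
  have hi : ∀ a ∈ I, ∀ b ∈ I, IntervalIntegrable Ξ volume a b := fun a ha b hb =>
    (hΞ.mono (hI'.uIcc_subset ha hb)).intervalIntegrable
  have hm : ∀ x ∈ I, StronglyMeasurableAtFilter Ξ (𝓝 x) volume := fun x hx =>
    hΞ.stronglyMeasurableAtFilter hI x hx
  have h1 : ∀ x ∈ I, HasDerivAt (fun y => ∫ τ in t..y, Ξ τ) (Ξ x) x := fun x hx =>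
    intervalIntegral.integral_hasDerivAt_right (hi t ht x hx) (hm x hx)
      (hΞ.continuousAt (hI.mem_nhds hx))
  have h2 : HasDerivAt (fun y => ∫ τ in t..y + δ, Ξ τ) (Ξ (t + δ)) t :=
    (h1 (t + δ) htδ).comp_add_const t δ
  have h3 := ((h2.sub (h1 t ht)).const_smul δ⁻¹)
  rw [add_sub_cancel_left]
  refine h3.congr_of_eventuallyEq ?_
  have h4 : ∀ᶠ y in 𝓝 t, y ∈ I := hI.mem_nhds ht
  have h5 : ∀ᶠ y in 𝓝 t, y + δ ∈ I :=
    (continuous_add_const δ).continuousAt.preimage_mem_nhds (hI.mem_nhds htδ)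
  filter_upwards [h4, h5] with y hy hy'
  rw [steklov, add_sub_cancel_left]
  simp only [Pi.smul_apply, Pi.sub_apply]
  rw [intervalIntegral.integral_interval_sub_left (hi t ht _ hy') (hi t ht _ hy)]

lemma tendsto_steklov (hI : IsOpen I) (hI' : OrdConnected I) (hΞ : ContinuousOn Ξ I) {t : ℝ}
    (ht : t ∈ I) {δ : ℕ → ℝ} (hδ : Tendsto δ atTop (𝓝[>] 0)) :
    Tendsto (fun n => steklov t (t + δ n) Ξ) atTop (𝓝 (Ξ t)) := by
  have hi : ∀ a ∈ I, ∀ b ∈ I, IntervalIntegrable Ξ volume a b := fun a ha b hb =>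
    (hΞ.mono (hI'.uIcc_subset ha hb)).intervalIntegrable
  have h1 : HasDerivAt (fun y => ∫ τ in t..y, Ξ τ) (Ξ t) t :=
    intervalIntegral.integral_hasDerivAt_right (hi t ht t ht)
      (hΞ.stronglyMeasurableAtFilter hI t ht) (hΞ.continuousAt (hI.mem_nhds ht))
  have h2 := h1.tendsto_slope_zero_right.comp hδ
  refine h2.congr fun n => ?_
  simp [steklov]

end Averages

end HarmonicMapFlow

/-! ### Weighted pointwise bounds on pairs and the bound for averages. -/

namespace HarmonicMapFlow

section BoundedPairs

/-- A convergent sequence in L² has a subsequence that converges almost everywhere, along which the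
pointwise bound persists. -/
lemma isClosed_weighted_bound (w : ℝ → ℝ) (c : ℝ) :
    IsClosed {F : L2 | ∀ᵐ x, (w x * F x) ^ 2 ≤ c} := by
  refine IsSeqClosed.isClosed fun F G hF hG => ?_
  obtain ⟨ns, -, hae⟩ := (tendstoInMeasure_of_tendsto_Lp hG).exists_seq_tendsto_ae
  have h1 : ∀ᵐ x, ∀ n, (w x * F n x) ^ 2 ≤ c := ae_all_iff.2 hF
  show ∀ᵐ x, (w x * G x) ^ 2 ≤ c
  filter_upwards [h1, hae] with x hx hx'
  exact le_of_tendsto ((hx'.const_mul (w x)).pow 2) (Eventually.of_forall fun n => hx (ns n))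

/-- The pairs whose weighted components are bounded. -/
def boundedPairs (κ c : ℝ) : Set L2Pair :=
  {P | (∀ᵐ x, (Real.exp (-x) * (κ⁻¹ * P.snd x)) ^ 2 ≤ c) ∧
    ∀ᵐ x, (Real.exp (-x) * P.fst x) ^ 2 ≤ c}

lemma isClosed_boundedPairs (κ c : ℝ) : IsClosed (boundedPairs κ c) := by
  have h1 := (isClosed_weighted_bound (fun x => Real.exp (-x) * κ⁻¹) c).preimage
    (WithLp.sndL 2 ℝ L2 L2).continuous
  have h2 := (isClosed_weighted_bound (fun x => Real.exp (-x)) c).preimage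
    (WithLp.fstL 2 ℝ L2 L2).continuous
  simp only [mul_assoc] at h1
  exact h1.inter h2

lemma boundedPairs_mono (κ : ℝ) {c c' : ℝ} (h : c ≤ c') : boundedPairs κ c ⊆ boundedPairs κ c' :=
  fun _ hP => ⟨hP.1.mono fun _ hx => hx.trans h, hP.2.mono fun _ hx => hx.trans h⟩

/-- Each of the two summands of the X^∞ norm is at most √c, which gives the factor 4 after squaring.
-/
lemma xNorm_top_sq_le {m : ℕ} (hm : 1 ≤ m) {κ : ℝ} (hκ : 0 < κ) {u g : ℝ → ℝ}
    (h : HasWeakDeriv u g) (hx : xNorm m 2 u < ∞) {c : ℝ} (hc : logPair κ u g ∈ boundedPairs κ c) :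
    xNorm m ∞ u ^ 2 ≤ 4 * ENNReal.ofReal c := by
  obtain ⟨h0, h1⟩ := h.memLp hm hx
  have hc0 : 0 ≤ c := by
    obtain ⟨x, hx⟩ := hc.1.exists
    exact (sq_nonneg _).trans hx
  have h2 : xNorm m ∞ u ≤ 2 * ENNReal.ofReal √c := by
    refine xNorm_top_le m h ?_ ?_
    · filter_upwards [hc.1, coeFn_toL2 (h0.const_mul κ)] with x hx hx'
      simp only [logPair, toPair, WithLp.toLp_snd, hx', inv_mul_cancel_left₀ hκ.ne'] at hx
      exact Real.abs_le_sqrt hx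
    · filter_upwards [hc.2, coeFn_toL2 h1] with x hx hx'
      simp only [logPair, toPair, WithLp.toLp_fst, hx'] at hx
      exact Real.abs_le_sqrt hx
  calc xNorm m ∞ u ^ 2 ≤ (2 * ENNReal.ofReal √c) ^ 2 := by gcongr
    _ = 4 * ENNReal.ofReal c := by
      rw [mul_pow, ← ENNReal.ofReal_pow (Real.sqrt_nonneg c), Real.sq_sqrt hc0]
      norm_num

end BoundedPairs

section Limit

variable {m : ℕ} {T : ℝ≥0∞} {s : ℝ → ℝ} {f f₁ f₂ : ℝ → ℝ → ℝ} {ξ₀ : ℝ → ℝ} {ξ : ℝ → ℝ → ℝ} {κ : ℝ}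
  {g : ℝ → ℝ → ℝ} {p q : ℝ}

/-- The energy bound for the time averages of a solution. -/
lemma IsLinearizedSolution.steklov_bound (hsol : IsLinearizedSolution m T s f ξ₀ ξ)
    (hm : 4 ≤ m) (hκ0 : 0 < κ) (hκ : κ ^ 2 = m ^ 2 + 56 * m ^ 4)
    (hs : ∀ t ∈ timeInterval T, 0 < s t) (hsc : ContinuousOn s (timeInterval T))
    (hg : ∀ t ∈ timeInterval T, HasWeakDeriv (ξ t) (g t))
    (hΞ : ContinuousOn (fun t => logPair κ (ξ t) (g t)) (timeInterval T))
    (horth : ∀ t ∈ timeInterval T, ∫ r, ξ t r * h m (r / s t) ∂rdr = 0)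
    (hf₁ : LocallyIntegrableOn (fun z : ℝ × ℝ => f₁ z.1 z.2) (spaceTime T))
    (hf₂ : LocallyIntegrableOn (fun z : ℝ × ℝ => f₂ z.1 z.2) (spaceTime T))
    (hf : ∀ᵐ z : ℝ × ℝ ∂(volume.restrict (spaceTime T)), f z.1 z.2 = f₁ z.1 z.2 + f₂ z.1 z.2)
    {δ : ℝ} (hδ : 0 < δ) (hpq : p ≤ q) (hI : Icc p (q + δ) ⊆ openTime T) {S A ω B₁ B₂ : ℝ}
    (hS : ∀ τ ∈ Icc p (q + δ), ‖logPair κ (ξ τ) (g τ)‖ ≤ S)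
    (hA : ∀ τ ∈ Icc p (q + δ), |Real.log (s τ)| ≤ A)
    (hω : ∀ t ∈ Icc p q, ∀ τ ∈ Icc t (t + δ), |Real.log (s τ) - Real.log (s t)| ≤ ω) (hω1 : ω ≤ 1)
    (hB₁ : 0 ≤ B₁) (hB₂ : 0 ≤ B₂)
    (hN₁ : ∫⁻ τ in openTime T, xNorm m 2 (f₁ τ) ≤ ENNReal.ofReal B₁)
    (hN₂ : ∫⁻ τ in openTime T, xNorm m 1 (f₂ τ) ^ 2 ≤ ENNReal.ofReal B₂) {C : ℝ}
    (hC : C = 4 * (1 + 196 * m ^ 4) * (8 * m ^ 3 * Real.exp A * S) ^ 2 + 1024 * m ^ 5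
            * (S * (m * Real.exp m) * (Real.exp A * √(∫ x, Real.exp (4 * x) * sech (m * x) ^ 2)))
            ^ 2) {E : ℝ}
    (hE : E = 2 * ‖steklov p (p + δ) fun t => logPair κ (ξ t) (g t)‖ ^ 2 + (2 * κ) ^ 2 * B₁ ^ 2
      + 2 * (4 * (1 + 196 * m ^ 4) * B₂ + C * ω ^ 2 * (q - p))) :
    (∀ t ∈ Icc p q, ‖steklov t (t + δ) fun t => logPair κ (ξ t) (g t)‖ ^ 2 ≤ E) ∧
    ∃ D : ℝ → ℝ, IntegrableOn D (Icc p q) ∧ (∀ t ∈ Icc p q, 0 ≤ D t ∧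
      (steklov t (t + δ) fun t => logPair κ (ξ t) (g t)) ∈ boundedPairs κ ((3 * m ^ 4 + 7) * D t)) ∧
      ∫ t in Icc p q, D t ≤ E := by
  set Ξ := fun t => logPair κ (ξ t) (g t) with hΞd
  have hIt : ∀ t ∈ Icc p q, Icc t (t + δ) ⊆ Icc p (q + δ) := fun t ht =>
    Icc_subset_Icc ht.1 (by linarith [ht.2])
  have hfin₁ : ∀ {a b}, Icc a b ⊆ Icc p (q + δ) → ∫⁻ τ in Ioc a b, xNorm m 2 (f₁ τ) ≠ ∞ :=
    fun hab => ne_top_of_le_ne_top ENNReal.ofReal_ne_top ((lintegral_mono_set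
      (Ioc_subset_Icc_self.trans (hab.trans hI))).trans hN₁)
  have hfin₂ : ∀ {a b}, Icc a b ⊆ Icc p (q + δ) → ∫⁻ τ in Ioc a b, xNorm m 1 (f₂ τ) ^ 2 ≠ ∞ :=
    fun hab => ne_top_of_le_ne_top ENNReal.ofReal_ne_top ((lintegral_mono_set
      (Ioc_subset_Icc_self.trans (hab.trans hI))).trans hN₂)
  have key : ∀ t, ∃ W : ℝ, t ∈ Icc p q → _ := fun t => by
    by_cases ht : t ∈ Icc p q
    · obtain ⟨W, hW⟩ := hsol.averaged_inequality hm hκ0 hκ hs hsc hg hΞ horth hf₁ hf₂ hf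
        (show t < t + δ by linarith) ((hIt t ht).trans hI) (fun τ hτ => hS τ (hIt t ht hτ))
        (fun τ hτ => hA τ (hIt t ht hτ)) (hω t ht) hω1 (hfin₁ (hIt t ht)) (hfin₂ (hIt t ht))
      exact ⟨W, fun _ => hW⟩
    · exact ⟨0, fun h => absurd h ht⟩
  choose W hW using key
  simp only [add_sub_cancel_left] at hW
  obtain ⟨i1, j1⟩ := integral_average_lintegral_le hδ hpq (hfin₁ Subset.rfl)
  obtain ⟨i2, j2⟩ := integral_average_lintegral_le hδ hpq (hfin₂ Subset.rfl)
  have hC0 : 0 ≤ C := by rw [hC]; positivity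
  have hb1 : (∫⁻ τ in Ioc p (q + δ), xNorm m 2 (f₁ τ)).toReal ≤ B₁ :=
    ENNReal.toReal_le_of_le_ofReal hB₁ ((lintegral_mono_set
      (Ioc_subset_Icc_self.trans hI)).trans hN₁)
  have hb2 : (∫⁻ τ in Ioc p (q + δ), xNorm m 1 (f₂ τ) ^ 2).toReal ≤ B₂ :=
    ENNReal.toReal_le_of_le_ofReal hB₂ ((lintegral_mono_set
      (Ioc_subset_Icc_self.trans hI)).trans hN₂)
  have hΞo := hΞ.mono (openTime_subset T)
  have hmem : ∀ t ∈ Icc p q, t ∈ openTime T ∧ t + δ ∈ openTime T := fun t ht =>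
    ⟨hI ⟨ht.1, by linarith [ht.2]⟩, hI ⟨by linarith [ht.1], by linarith [ht.2]⟩⟩
  have hres := integrate_inequality (U := fun t => steklov t (t + δ) Ξ)
    (U' := fun t => δ⁻¹ • (Ξ (t + δ) - Ξ t))
    (N₁ := fun t => δ⁻¹ * (∫⁻ τ in Ioc t (t + δ), xNorm m 2 (f₁ τ)).toReal)
    (N₂ := fun t => 4 * (1 + 196 * m ^ 4) * (δ⁻¹ * (∫⁻ τ in Ioc t (t + δ),
      xNorm m 1 (f₂ τ) ^ 2).toReal) + C * ω ^ 2) (W := W) (α := 2 * κ) (B₁ := B₁)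
    (B₂ := 4 * (1 + 196 * m ^ 4) * B₂ + C * ω ^ 2 * (q - p)) hpq (by linarith)
    (fun t ht => by
      have := hasDerivAt_steklov (isOpen_openTime T) (ordConnected_openTime T) hΞo
        (hmem t ht).1 (hmem t ht).2
      simpa only [add_sub_cancel_left] using this)
    (by
      have c1 : ContinuousOn (fun t => Ξ (t + δ)) (Icc p q) :=
        hΞo.comp (Continuous.continuousOn (by fun_prop)) fun t ht => (hmem t ht).2
      have c2 : ContinuousOn Ξ (Icc p q) := hΞo.mono fun t ht => (hmem t ht).1
      exact (c1.sub c2).const_smul δ⁻¹)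
    i1 ((i2.const_mul _).add intervalIntegrable_const) (fun t => by positivity)
    (fun t => by positivity) (j1.trans hb1)
    (by
      rw [intervalIntegral.integral_add (i2.const_mul _) intervalIntegrable_const,
        intervalIntegral.integral_const_mul, intervalIntegral.integral_const, smul_eq_mul,
        mul_comm (q - p)]
      gcongr
      exact j2.trans hb2)
    (fun t ht => (hW t ht).1)
    (fun t ht => by
      refine (hW t ht).2.2.2.trans (le_of_eq ?_)
      rw [hC]
      ring)
  rw [← hE] at hres
  obtain ⟨h1, D, h2, h3, h4⟩ := hres
  refine ⟨h1, D, h2, fun t ht => ⟨(hW t ht).1.trans (h3 t ht), ?_⟩, h4⟩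
  refine boundedPairs_mono κ ?_ ⟨(hW t ht).2.1, (hW t ht).2.2.1⟩
  have := h3 t ht
  gcongr

end Limit

end HarmonicMapFlow

/-! ### Removal of the time average on compact intervals. -/

namespace HarmonicMapFlow

section IntervalBound

variable {m : ℕ} {T : ℝ≥0∞} {s : ℝ → ℝ} {f f₁ f₂ : ℝ → ℝ → ℝ} {ξ₀ : ℝ → ℝ} {ξ : ℝ → ℝ → ℝ} {κ : ℝ}
  {g : ℝ → ℝ → ℝ} {p q : ℝ}

lemma exists_openTime_gt {t : ℝ} (ht : t ∈ openTime T) : ∃ t' ∈ openTime T, t < t' := by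
  obtain ⟨ε, hε, h⟩ := Metric.isOpen_iff.1 (isOpen_openTime T) t ht
  refine ⟨t + ε / 2, h ?_, by linarith⟩
  rw [Metric.mem_ball, Real.dist_eq, add_sub_cancel_left, abs_of_pos (by linarith)]
  linarith

/-- For every y above the lower limit, U n lies frequently in the bounded pairs of level c y. This
set is closed, so it contains the limit; then y decreases to the lower limit. -/
lemma xNorm_top_sq_le_liminf (hm : 1 ≤ m) (hκ : 0 < κ) {u g₀ : ℝ → ℝ}
    (h : HasWeakDeriv u g₀) (hx : xNorm m 2 u < ∞) {U : ℕ → L2Pair} {D : ℕ → ℝ} {c : ℝ}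
    (hc : 0 < c) (hD : ∀ n, 0 ≤ D n) (hU : ∀ n, U n ∈ boundedPairs κ (c * D n))
    (hlim : Tendsto U atTop (𝓝 (logPair κ u g₀))) :
    xNorm m ∞ u ^ 2 ≤ 4 * ENNReal.ofReal c * liminf (fun n => ENNReal.ofReal (D n)) atTop := by
  have hK0 : 4 * ENNReal.ofReal c ≠ 0 := by simpa using hc
  have hK1 : 4 * ENNReal.ofReal c ≠ ∞ := ENNReal.mul_ne_top (by simp) ENNReal.ofReal_ne_top
  rw [← ENNReal.div_le_iff' hK0 hK1]
  refine le_of_forall_gt_imp_ge_of_dense fun y hy => ?_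
  rcases eq_or_ne y ∞ with rfl | hy'
  · exact le_top
  rw [ENNReal.div_le_iff' hK0 hK1]
  have h1 : ∃ᶠ n in atTop, U n ∈ boundedPairs κ (c * y.toReal) := by
    refine (frequently_lt_of_liminf_lt (by isBoundedDefault) hy).mono fun n hn => ?_
    refine boundedPairs_mono κ ?_ (hU n)
    have := (ENNReal.ofReal_lt_iff_lt_toReal (hD n) hy').1 hn
    gcongr
  have h2 := xNorm_top_sq_le hm hκ h hx
    ((isClosed_boundedPairs κ (c * y.toReal)).mem_of_frequently_of_tendsto h1 hlim)
  rwa [ENNReal.ofReal_mul hc.le, ENNReal.ofReal_toReal hy', ← mul_assoc] at h2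

/-- The energy bound for a solution on a compact time interval. -/
lemma IsLinearizedSolution.interval_bound (hsol : IsLinearizedSolution m T s f ξ₀ ξ)
    (hm : 4 ≤ m) (hκ0 : 0 < κ) (hκ : κ ^ 2 = m ^ 2 + 56 * m ^ 4)
    (hs : ∀ t ∈ timeInterval T, 0 < s t) (hsc : ContinuousOn s (timeInterval T))
    (hg : ∀ t ∈ timeInterval T, HasWeakDeriv (ξ t) (g t))
    (hΞ : ContinuousOn (fun t => logPair κ (ξ t) (g t)) (timeInterval T))
    (horth : ∀ t ∈ timeInterval T, ∫ r, ξ t r * h m (r / s t) ∂rdr = 0)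
    (hf₁ : LocallyIntegrableOn (fun z : ℝ × ℝ => f₁ z.1 z.2) (spaceTime T))
    (hf₂ : LocallyIntegrableOn (fun z : ℝ × ℝ => f₂ z.1 z.2) (spaceTime T))
    (hf : ∀ᵐ z : ℝ × ℝ ∂(volume.restrict (spaceTime T)), f z.1 z.2 = f₁ z.1 z.2 + f₂ z.1 z.2)
    {B₁ B₂ : ℝ} (hB₁ : 0 ≤ B₁) (hB₂ : 0 ≤ B₂)
    (hN₁ : ∫⁻ τ in openTime T, xNorm m 2 (f₁ τ) ≤ ENNReal.ofReal B₁)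
    (hN₂ : ∫⁻ τ in openTime T, xNorm m 1 (f₂ τ) ^ 2 ≤ ENNReal.ofReal B₂)
    (hp : p ∈ openTime T) (hq : q ∈ openTime T) (hpq : p ≤ q) {E : ℝ}
    (hE : E = 2 * ‖logPair κ (ξ p) (g p)‖ ^ 2 + (2 * κ) ^ 2 * B₁ ^ 2
      + 2 * (4 * (1 + 196 * m ^ 4) * B₂)) :
    (∀ t ∈ Icc p q, ‖logPair κ (ξ t) (g t)‖ ^ 2 ≤ E) ∧
      ∫⁻ t in Icc p q, xNorm m ∞ (ξ t) ^ 2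
        ≤ 4 * ENNReal.ofReal (3 * m ^ 4 + 7) * ENNReal.ofReal E := by
  have hm1 : 1 ≤ m := by omega
  obtain ⟨q', hq', hqq'⟩ := exists_openTime_gt hq
  have hJ : Icc p q' ⊆ openTime T := (ordConnected_openTime T).out hp hq'
  have hJT := hJ.trans (openTime_subset T)
  have hlog : ContinuousOn (fun t => Real.log (s t)) (Icc p q') :=
    (hsc.mono hJT).log fun t ht => (hs t (hJT ht)).ne'
  obtain ⟨S, hS⟩ := isCompact_Icc.exists_bound_of_continuousOn (hΞ.mono hJT)
  obtain ⟨A, hA⟩ := isCompact_Icc.exists_bound_of_continuousOn hlog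
  have huc := Metric.uniformContinuousOn_iff.1
    (isCompact_Icc.uniformContinuousOn_of_continuous hlog)
  -- The windows stay inside [p, q'], and log s oscillates by at most 1/(n + 1) on each of them, by
  -- uniform continuity.
  have hchoose : ∀ n : ℕ, ∃ δ : ℝ, 0 < δ ∧ δ ≤ q' - q ∧ δ ≤ 1 / ((n : ℝ) + 1) ∧
      ∀ t ∈ Icc p q, ∀ τ ∈ Icc t (t + δ),
        |Real.log (s τ) - Real.log (s t)| ≤ 1 / ((n : ℝ) + 1) := by
    intro n
    have hn : (0 : ℝ) < 1 / ((n : ℝ) + 1) := by positivity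
    obtain ⟨ε, hε, h1⟩ := huc _ hn
    have hq0 : 0 < q' - q := sub_pos.2 hqq'
    refine ⟨min (ε / 2) (min (q' - q) (1 / ((n : ℝ) + 1))), by positivity,
      (min_le_right _ _).trans (min_le_left _ _), (min_le_right _ _).trans (min_le_right _ _),
      fun t ht τ hτ => ?_⟩
    have l1 := min_le_left (ε / 2) (min (q' - q) (1 / ((n : ℝ) + 1)))
    have l2 := (min_le_right (ε / 2) (min (q' - q) (1 / ((n : ℝ) + 1)))).trans (min_le_left _ _)
    have h2 : τ - t ≤ ε / 2 := by linarith [hτ.2]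
    have h3 : τ - t ≤ q' - q := by linarith [hτ.2]
    refine (h1 τ ⟨ht.1.trans hτ.1, by linarith [ht.2]⟩ t ⟨ht.1, ht.2.trans hqq'.le⟩ ?_).le
    rw [Real.dist_eq, abs_of_nonneg (by linarith [hτ.1])]
    linarith
  choose δ hδ0 hδq hδn hω using hchoose
  have hη : Tendsto (fun n : ℕ => 1 / ((n : ℝ) + 1)) atTop (𝓝 0) :=
    tendsto_one_div_add_atTop_nhds_zero_nat
  have hδ : Tendsto δ atTop (𝓝[>] 0) := tendsto_nhdsWithin_iff.2
    ⟨squeeze_zero (fun n => (hδ0 n).le) hδn hη, Eventually.of_forall hδ0⟩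
  set Ξ := fun t => logPair κ (ξ t) (g t) with hΞd
  obtain ⟨C, hC⟩ : ∃ C : ℝ, C = 4 * (1 + 196 * m ^ 4) * (8 * m ^ 3 * Real.exp A * S) ^ 2
      + 1024 * m ^ 5 * (S * (m * Real.exp m)
        * (Real.exp A * √(∫ x, Real.exp (4 * x) * sech (m * x) ^ 2))) ^ 2 := ⟨_, rfl⟩
  -- C depends on bounds for ξ and log s on [p, q'] but not on n, so the freezing error C ω² (q - p)
  -- tends to 0 and no trace of these bounds is left in E.
  set En : ℕ → ℝ := fun n => 2 * ‖steklov p (p + δ n) Ξ‖ ^ 2 + (2 * κ) ^ 2 * B₁ ^ 2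
      + 2 * (4 * (1 + 196 * m ^ 4) * B₂ + C * (1 / ((n : ℝ) + 1)) ^ 2 * (q - p)) with hEn
  have hsub : ∀ n, Icc p (q + δ n) ⊆ Icc p q' := fun n =>
    Icc_subset_Icc_right (by linarith [hδq n])
  have hst : ∀ n, _ := fun n => hsol.steklov_bound hm hκ0 hκ hs hsc hg hΞ horth hf₁ hf₂ hf (hδ0 n)
    hpq ((hsub n).trans hJ) (fun τ hτ => hS τ (hsub n hτ)) (fun τ hτ => hA τ (hsub n hτ)) (hω n)
    (by rw [div_le_one (by positivity)]; linarith [Nat.cast_nonneg (α := ℝ) n]) hB₁ hB₂ hN₁ hN₂ hC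
    (E := En n) rfl
  have hlim : ∀ t ∈ Icc p q, Tendsto (fun n => steklov t (t + δ n) Ξ) atTop (𝓝 (Ξ t)) :=
    fun t ht => tendsto_steklov (isOpen_openTime T) (ordConnected_openTime T)
      (hΞ.mono (openTime_subset T)) (hJ ⟨ht.1, ht.2.trans hqq'.le⟩) hδ
  have hElim : Tendsto En atTop (𝓝 E) := by
    have h1 := (((hlim p ⟨le_rfl, hpq⟩).norm.pow 2).const_mul 2).add_const ((2 * κ) ^ 2 * B₁ ^ 2)
    have h2 := ((((hη.pow 2).const_mul C).mul_const (q - p)).const_add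
      (4 * (1 + 196 * (m : ℝ) ^ 4) * B₂)).const_mul 2
    have h3 := h1.add h2
    refine h3.trans (le_of_eq ?_)
    rw [hE]
    congr 1
    ring
  choose h1 D h2 h3 h4 using hst
  refine ⟨fun t ht => le_of_tendsto_of_tendsto ((hlim t ht).norm.pow 2) hElim
    (Eventually.of_forall fun n => h1 n t ht), ?_⟩
  have hc : (0 : ℝ) < 3 * m ^ 4 + 7 := by positivity
  calc ∫⁻ t in Icc p q, xNorm m ∞ (ξ t) ^ 2
      ≤ ∫⁻ t in Icc p q, 4 * ENNReal.ofReal (3 * m ^ 4 + 7)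
          * liminf (fun n => ENNReal.ofReal (D n t)) atTop := by
        refine setLIntegral_mono' measurableSet_Icc fun t ht => ?_
        have htT := hJT ⟨ht.1, ht.2.trans hqq'.le⟩
        exact xNorm_top_sq_le_liminf hm1 hκ0 (hg t htT) (hsol.memX t htT) hc
          (fun n => (h3 n t ht).1) (fun n => (h3 n t ht).2) (hlim t ht)
    _ = 4 * ENNReal.ofReal (3 * m ^ 4 + 7)
          * ∫⁻ t in Icc p q, liminf (fun n => ENNReal.ofReal (D n t)) atTop :=
        lintegral_const_mul' _ _ (ENNReal.mul_ne_top (by simp) ENNReal.ofReal_ne_top)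
    _ ≤ 4 * ENNReal.ofReal (3 * m ^ 4 + 7)
          * liminf (fun n => ∫⁻ t in Icc p q, ENNReal.ofReal (D n t)) atTop := by
        gcongr
        exact lintegral_liminf_le' fun n => (h2 n).aestronglyMeasurable.aemeasurable.ennreal_ofReal
    _ ≤ 4 * ENNReal.ofReal (3 * m ^ 4 + 7) * liminf (fun n => ENNReal.ofReal (En n)) atTop := by
        gcongr
        refine liminf_le_liminf (Eventually.of_forall fun n => ?_)
        rw [← ofReal_integral_eq_lintegral_ofReal (h2 n)
          ((ae_restrict_iff' measurableSet_Icc).2 (ae_of_all _ fun t ht => (h3 n t ht).1))]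
        exact ENNReal.ofReal_le_ofReal (h4 n)
    _ = _ := by rw [(ENNReal.tendsto_ofReal hElim).liminf_eq]

end IntervalBound

end HarmonicMapFlow

/-! ### The whole time interval and the final estimate. -/

namespace HarmonicMapFlow

section GlobalBound

variable {m : ℕ} {T : ℝ≥0∞} {s : ℝ → ℝ} {f f₁ f₂ : ℝ → ℝ → ℝ} {ξ₀ : ℝ → ℝ} {ξ : ℝ → ℝ → ℝ} {κ : ℝ}
  {g : ℝ → ℝ → ℝ}

/-- N need not be measurable, but lower integrals are continuous along countable directed unions of
sets; the intervals with rational end points provide one. -/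
lemma setLIntegral_openTime_le {N : ℝ → ℝ≥0∞} {K : ℝ≥0∞}
    (h : ∀ p ∈ openTime T, ∀ q ∈ openTime T, p ≤ q → ∫⁻ t in Icc p q, N t ≤ K) :
    ∫⁻ t in openTime T, N t ≤ K := by
  let ι := {z : ℚ × ℚ // (z.1 : ℝ) ∈ openTime T ∧ (z.2 : ℝ) ∈ openTime T ∧ z.1 ≤ z.2}
  have hU : openTime T = ⋃ z : ι, Icc (z.1.1 : ℝ) z.1.2 := by
    refine Subset.antisymm (fun t ht => ?_) (iUnion_subset fun z =>
      (ordConnected_openTime T).out z.2.1 z.2.2.1)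
    obtain ⟨t', ht', htt'⟩ := exists_openTime_gt ht
    obtain ⟨a, ha0, hat⟩ := exists_rat_btwn ht.1
    obtain ⟨b, hbt, hbt'⟩ := exists_rat_btwn htt'
    have hb : (b : ℝ) ∈ openTime T := (ordConnected_openTime T).out ht ht' ⟨hbt.le, hbt'.le⟩
    have ha : (a : ℝ) ∈ openTime T :=
      ⟨ha0, (ENNReal.ofReal_le_ofReal hat.le).trans_lt ht.2⟩
    exact mem_iUnion.2 ⟨⟨(a, b), ha, hb, by exact_mod_cast (hat.trans hbt).le⟩, hat.le, hbt.le⟩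
  have hdir : Directed (· ⊆ ·) fun z : ι => Icc (z.1.1 : ℝ) z.1.2 := by
    rintro ⟨⟨a, b⟩, ha, hb, hab⟩ ⟨⟨a', b'⟩, ha', hb', hab'⟩
    refine ⟨⟨(min a a', max b b'), ?_, ?_, (min_le_left _ _).trans (hab.trans (le_max_left _ _))⟩,
      ?_, ?_⟩
    · rcases min_choice a a' with h | h <;> simp only [h] <;> assumption
    · rcases max_choice b b' with h | h <;> simp only [h] <;> assumption
    · exact Icc_subset_Icc (by exact_mod_cast min_le_left a a') (by exact_mod_cast le_max_left b b')
    · exact Icc_subset_Icc (by exact_mod_cast min_le_right a a')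
        (by exact_mod_cast le_max_right b b')
  rw [hU, setLIntegral_iUnion_of_directed _ hdir]
  exact iSup_le fun z => h _ z.2.1 _ z.2.2.1 (by exact_mod_cast z.2.2.2)

lemma timeInterval_ae_eq_openTime (T : ℝ≥0∞) : timeInterval T =ᵐ[volume] openTime T := by
  have h : ∀ᵐ t : ℝ, t ≠ 0 := by simp [ae_iff]
  filter_upwards [h] with t ht
  refine propext ⟨fun h => ⟨lt_of_le_of_ne h.1 (Ne.symm ht), h.2⟩, fun h => openTime_subset T h⟩

/-- The energy bound for a solution on the whole time interval. -/
lemma IsLinearizedSolution.global_bound (hsol : IsLinearizedSolution m T s f ξ₀ ξ)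
    (hm : 4 ≤ m) (hκ0 : 0 < κ) (hκ : κ ^ 2 = m ^ 2 + 56 * m ^ 4)
    (hs : ∀ t ∈ timeInterval T, 0 < s t) (hsc : ContinuousOn s (timeInterval T))
    (hg : ∀ t ∈ timeInterval T, HasWeakDeriv (ξ t) (g t))
    (hΞ : ContinuousOn (fun t => logPair κ (ξ t) (g t)) (timeInterval T))
    (horth : ∀ t ∈ timeInterval T, ∫ r, ξ t r * h m (r / s t) ∂rdr = 0)
    (hf₁ : LocallyIntegrableOn (fun z : ℝ × ℝ => f₁ z.1 z.2) (spaceTime T))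
    (hf₂ : LocallyIntegrableOn (fun z : ℝ × ℝ => f₂ z.1 z.2) (spaceTime T))
    (hf : ∀ᵐ z : ℝ × ℝ ∂(volume.restrict (spaceTime T)), f z.1 z.2 = f₁ z.1 z.2 + f₂ z.1 z.2)
    {B₁ B₂ : ℝ} (hB₁ : 0 ≤ B₁) (hB₂ : 0 ≤ B₂)
    (hN₁ : ∫⁻ τ in openTime T, xNorm m 2 (f₁ τ) ≤ ENNReal.ofReal B₁)
    (hN₂ : ∫⁻ τ in openTime T, xNorm m 1 (f₂ τ) ^ 2 ≤ ENNReal.ofReal B₂) {E : ℝ}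
    (hE : E = 2 * ‖logPair κ (ξ 0) (g 0)‖ ^ 2 + (2 * κ) ^ 2 * B₁ ^ 2
      + 2 * (4 * (1 + 196 * m ^ 4) * B₂)) :
    (∀ t ∈ timeInterval T, ‖logPair κ (ξ t) (g t)‖ ^ 2 ≤ E) ∧
      ∫⁻ t in timeInterval T, xNorm m ∞ (ξ t) ^ 2
        ≤ 4 * ENNReal.ofReal (3 * m ^ 4 + 7) * ENNReal.ofReal (3 * E) := by
  have hb : ∀ p ∈ openTime T, ∀ q ∈ openTime T, p ≤ q → _ := fun p hp q hq hpq =>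
    hsol.interval_bound hm hκ0 hκ hs hsc hg hΞ horth hf₁ hf₂ hf hB₁ hB₂ hN₁ hN₂ hp hq hpq rfl
  have hr0 : 0 ≤ (2 * κ) ^ 2 * B₁ ^ 2 + 2 * (4 * (1 + 196 * (m : ℝ) ^ 4) * B₂) := by positivity
  have h1 : ∀ t ∈ timeInterval T, ‖logPair κ (ξ t) (g t)‖ ^ 2 ≤ E := by
    intro t ht
    rcases ht.1.eq_or_lt with rfl | h0
    · have := sq_nonneg ‖logPair κ (ξ 0) (g 0)‖
      linarith
    have hto : t ∈ openTime T := ⟨h0, ht.2⟩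
    have hsub : Ioc 0 t ⊆ openTime T := fun p hp =>
      ⟨hp.1, (ENNReal.ofReal_le_ofReal hp.2).trans_lt ht.2⟩
    have hmem : Ioc 0 t ∈ 𝓝[>] (0 : ℝ) := Ioc_mem_nhdsGT h0
    have h00 : (0 : ℝ) ∈ timeInterval T :=
      ⟨le_rfl, (ENNReal.ofReal_le_ofReal ht.1).trans_lt ht.2⟩
    -- The interval bounds start at p > 0; continuity of ξ at 0 in X² replaces p by the initial
    -- time.
    have hlim : Tendsto (fun p => logPair κ (ξ p) (g p)) (𝓝[>] 0) (𝓝 (logPair κ (ξ 0) (g 0))) :=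
      (hΞ 0 h00).mono_left (nhdsWithin_le_of_mem
        (mem_of_superset hmem (hsub.trans (openTime_subset T))))
    have hlim2 := ((((hlim.norm.pow 2).const_mul 2).add_const ((2 * κ) ^ 2 * B₁ ^ 2)).add_const
      (2 * (4 * (1 + 196 * (m : ℝ) ^ 4) * B₂)))
    rw [hE]
    refine ge_of_tendsto hlim2 (mem_of_superset hmem fun p hp => ?_)
    exact (hb p (hsub hp) t hto hp.2).1 t ⟨hp.2, le_rfl⟩
  refine ⟨h1, ?_⟩
  rw [setLIntegral_congr (timeInterval_ae_eq_openTime T)]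
  refine setLIntegral_openTime_le fun p hp q hq hpq => (hb p hp q hq hpq).2.trans ?_
  gcongr
  -- The bound on [p, q] contains 2‖Ξ(p)‖² ≤ 2E, where Ξ(p) is the pair at time p, and forcing terms
  -- at most E; hence the factor 3.
  have h2 := h1 p (openTime_subset T hp)
  have h3 := sq_nonneg ‖logPair κ (ξ 0) (g 0)‖
  linarith

lemma xNorm_congr_ae {u v : ℝ → ℝ} {p : ℝ≥0∞} (h : ∀ᵐ r ∂rdr, u r = v r) :
    xNorm m p u ≤ xNorm m p v := by
  have h' : ∀ᵐ r ∂volume.restrict (Ioi (0 : ℝ)), u r = v r := by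
    refine (withDensity_absolutelyContinuous' (f := fun r => ENNReal.ofReal r) (by fun_prop)
      ((ae_restrict_iff' measurableSet_Ioi).2 (ae_of_all _ fun r hr => ?_))).ae_le h
    exact (ENNReal.ofReal_pos.2 hr).ne'
  refine le_iInf₂ fun g hg => ?_
  have hu : HasWeakDeriv u g := by
    refine ⟨?_, hg.locInt_deriv, fun φ h1 h2 h3 => ?_⟩
    · rw [locallyIntegrableOn_iff isOpen_Ioi.isLocallyClosed]
      intro k hk hkc
      exact (hg.locInt.integrableOn_compact_subset hk hkc).congr
        ((ae_restrict_of_ae_restrict_of_subset hk h').mono fun r hr => hr.symm)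
    · rw [← hg.byParts φ h1 h2 h3]
      refine integral_congr_ae ?_
      filter_upwards [h'] with r hr
      rw [hr]
  refine (iInf₂_le g hu).trans (le_of_eq ?_)
  have e : ∀ p, eLpNorm (fun r => u r / r) p rdr = eLpNorm (fun r => v r / r) p rdr := fun p =>
    eLpNorm_congr_ae (h.mono fun r hr => by simp only [hr])
  simp only [e]

lemma mixedNorm_one (m : ℕ) (T p : ℝ≥0∞) (u : ℝ → ℝ → ℝ) :
    mixedNorm m 1 p T u = ∫⁻ t in timeInterval T, xNorm m p (u t) := by
  rw [mixedNorm, eLpNorm_one_eq_lintegral_enorm]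
  rfl

lemma mixedNorm_two (m : ℕ) (T p : ℝ≥0∞) (u : ℝ → ℝ → ℝ) :
    mixedNorm m 2 p T u = (∫⁻ t in timeInterval T, xNorm m p (u t) ^ 2) ^ (1 / 2 : ℝ) := by
  rw [mixedNorm, eLpNorm_eq_lintegral_rpow_enorm_toReal (by norm_num) (by norm_num)]
  simp

end GlobalBound

/-- The a priori bound for a given decomposition of the forcing term. -/
lemma exists_bound_of_decomposition (m : ℕ) (hm : 4 ≤ m) :
    ∃ C : ℝ≥0, C ≠ 0 ∧ ∀ (T : ℝ≥0∞) (s : ℝ → ℝ) (f f₁ f₂ : ℝ → ℝ → ℝ) (ξ₀ : ℝ → ℝ)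
      (ξ : ℝ → ℝ → ℝ), (∀ t ∈ timeInterval T, 0 < s t) → ContinuousOn s (timeInterval T) →
      IsLinearizedSolution m T s f ξ₀ ξ →
      (∀ t ∈ timeInterval T, ∫ r, ξ t r * h m (r / s t) ∂rdr = 0) →
      AEStronglyMeasurable (fun z : ℝ × ℝ => f₁ z.1 z.2) (volume.restrict (spaceTime T)) →
      AEStronglyMeasurable (fun z : ℝ × ℝ => f₂ z.1 z.2) (volume.restrict (spaceTime T)) →
      (∀ᵐ z : ℝ × ℝ ∂(volume.restrict (spaceTime T)), f z.1 z.2 = f₁ z.1 z.2 + f₂ z.1 z.2) →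
      mixedNorm m ∞ 2 T ξ + mixedNorm m 2 ∞ T ξ
        ≤ C * (xNorm m 2 ξ₀ + (mixedNorm m 1 2 T f₁ + mixedNorm m 2 1 T f₂)) := by
  have hm1 : 1 ≤ m := by omega
  have hmR : (4 : ℝ) ≤ m := by exact_mod_cast hm
  set κ : ℝ := √((m : ℝ) ^ 2 + 56 * m ^ 4) with hκd
  have hκ : κ ^ 2 = m ^ 2 + 56 * m ^ 4 := Real.sq_sqrt (by positivity)
  have hκ0 : 0 < κ := Real.sqrt_pos.2 (by positivity)
  have hκm : (m : ℝ) ≤ κ := by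
    refine le_of_sq_le_sq ?_ hκ0.le
    rw [hκ]
    have : (0 : ℝ) ≤ 56 * m ^ 4 := by positivity
    linarith
  have hκ1 : 1 ≤ κ := by linarith
  -- a² is the sum of the coefficients in the energy bound, and c² below is 4(3m⁴ + 7) · 3.
  set a : ℝ := √(2 + (2 * κ) ^ 2 + 8 * (1 + 196 * (m : ℝ) ^ 4)) with ha
  have ha2 : a ^ 2 = 2 + (2 * κ) ^ 2 + 8 * (1 + 196 * (m : ℝ) ^ 4) := Real.sq_sqrt (by positivity)
  have ha0 : 0 < a := Real.sqrt_pos.2 (by positivity)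
  set c : ℝ := √(12 * (3 * (m : ℝ) ^ 4 + 7)) with hc
  have hc2 : c ^ 2 = 12 * (3 * (m : ℝ) ^ 4 + 7) := Real.sq_sqrt (by positivity)
  have hc0 : 0 ≤ c := Real.sqrt_nonneg _
  have hC0 : 0 < (1 + c) * a * κ := by positivity
  refine ⟨((1 + c) * a * κ).toNNReal, (Real.toNNReal_pos.2 hC0).ne', ?_⟩
  intro T s f f₁ f₂ ξ₀ ξ hs hsc hsol horth hm₁ hm₂ hf
  change _ ≤ ENNReal.ofReal ((1 + c) * a * κ) * _
  rcases (timeInterval T).eq_empty_or_nonempty with hem | ⟨t₁, ht₁⟩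
  · simp [mixedNorm, hem]
  have h00 : (0 : ℝ) ∈ timeInterval T :=
    ⟨le_rfl, (ENNReal.ofReal_le_ofReal ht₁.1).trans_lt ht₁.2⟩
  by_cases hfin₁ : mixedNorm m 1 2 T f₁ = ∞
  · rw [hfin₁, top_add, add_top, ENNReal.mul_top (ENNReal.ofReal_pos.2 hC0).ne']
    exact le_top
  by_cases hfin₂ : mixedNorm m 2 1 T f₂ = ∞
  · rw [hfin₂, add_top, add_top, ENNReal.mul_top (ENNReal.ofReal_pos.2 hC0).ne']
    exact le_top
  have hsub := openTime_subset T
  have hN₁ : ∫⁻ τ in openTime T, xNorm m 2 (f₁ τ)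
      ≤ ENNReal.ofReal (mixedNorm m 1 2 T f₁).toReal := by
    rw [ENNReal.ofReal_toReal hfin₁, mixedNorm_one]
    exact lintegral_mono_set hsub
  have hN₂ : ∫⁻ τ in openTime T, xNorm m 1 (f₂ τ) ^ 2
      ≤ ENNReal.ofReal ((mixedNorm m 2 1 T f₂).toReal ^ 2) := by
    rw [ENNReal.ofReal_pow ENNReal.toReal_nonneg, ENNReal.ofReal_toReal hfin₂, mixedNorm_two,
      ← ENNReal.rpow_two, ← ENNReal.rpow_mul]
    norm_num
    exact lintegral_mono_set hsub
  have hl₁ : LocallyIntegrableOn (fun z : ℝ × ℝ => f₁ z.1 z.2) (spaceTime T) :=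
    locallyIntegrableOn_of_lintegral_le hm₁ (N := fun t => xNorm m 2 (f₁ t))
      (fun p q hpq => ne_top_of_le_ne_top ENNReal.ofReal_ne_top
        ((lintegral_mono_set hpq).trans hN₁))
      fun R => (exists_lintegral_le_xNorm_two hm1 R).imp fun C hC t => hC.2 (f₁ t)
  have hl₂ : LocallyIntegrableOn (fun z : ℝ × ℝ => f₂ z.1 z.2) (spaceTime T) :=
    locallyIntegrableOn_of_lintegral_le hm₂ (N := fun t => xNorm m 1 (f₂ t))
      (fun p q hpq h => by
        have h1 := sq_lintegral_le (fun t => xNorm m 1 (f₂ t)) (a := p) (b := q)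
        rw [setLIntegral_congr Ioc_ae_eq_Icc, h] at h1
        refine ENNReal.mul_ne_top ENNReal.ofReal_ne_top (ne_top_of_le_ne_top ENNReal.ofReal_ne_top
          ((lintegral_mono_set (Ioc_subset_Icc_self.trans hpq)).trans hN₂)) (?_ : ENNReal.ofReal
            (q - p) * ∫⁻ τ in Ioc p q, xNorm m 1 (f₂ τ) ^ 2 = ∞)
        simpa using h1)
      fun R => (exists_lintegral_le_xNorm_one hm1 R).imp fun C hC t => hC.2 (f₂ t)
  obtain ⟨g, hg, hΞ⟩ := hsol.exists_curve hm1 hκm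
  obtain ⟨hb1, hb2⟩ := hsol.global_bound hm hκ0 hκ hs hsc hg hΞ horth hl₁ hl₂ hf
    ENNReal.toReal_nonneg (sq_nonneg _) hN₁ hN₂ rfl
  set Y := ‖logPair κ (ξ 0) (g 0)‖ with hY
  set b₁ := (mixedNorm m 1 2 T f₁).toReal with hb₁
  set b₂ := (mixedNorm m 2 1 T f₂).toReal with hb₂
  have hY0 : 0 ≤ Y := norm_nonneg _
  have hb₁0 : 0 ≤ b₁ := ENNReal.toReal_nonneg
  have hb₂0 : 0 ≤ b₂ := ENNReal.toReal_nonneg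
  have hE : 2 * Y ^ 2 + (2 * κ) ^ 2 * b₁ ^ 2 + 2 * (4 * (1 + 196 * (m : ℝ) ^ 4) * b₂ ^ 2)
      ≤ (a * (Y + b₁ + b₂)) ^ 2 := by
    have e1 : Y ^ 2 ≤ (Y + b₁ + b₂) ^ 2 := by gcongr; linarith
    have e2 : b₁ ^ 2 ≤ (Y + b₁ + b₂) ^ 2 := by gcongr; linarith
    have e3 : b₂ ^ 2 ≤ (Y + b₁ + b₂) ^ 2 := by gcongr; linarith
    rw [mul_pow a, ha2]
    calc _ ≤ 2 * (Y + b₁ + b₂) ^ 2 + (2 * κ) ^ 2 * (Y + b₁ + b₂) ^ 2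
          + 2 * (4 * (1 + 196 * (m : ℝ) ^ 4) * (Y + b₁ + b₂) ^ 2) := by gcongr
      _ = _ := by ring
  set X := a * (Y + b₁ + b₂) with hX
  have hX0 : 0 ≤ X := by positivity
  have hmeas : MeasurableSet (timeInterval T) :=
    (measurableSet_Ici (a := (0 : ℝ))).inter
      (measurableSet_lt ENNReal.measurable_ofReal measurable_const)
  have k1 : mixedNorm m ∞ 2 T ξ ≤ ENNReal.ofReal X := by
    rw [mixedNorm, eLpNorm_exponent_top]
    refine eLpNormEssSup_le_of_ae_enorm_bound ((ae_restrict_iff' hmeas).2 (ae_of_all _ fun t ht => ?_))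
    refine (xNorm_le_enorm_logPair hm1 hκm (hg t ht) (hsol.memX t ht)).trans ?_
    rw [← ofReal_norm]
    exact ENNReal.ofReal_le_ofReal (le_of_sq_le_sq ((hb1 t ht).trans hE) hX0)
  have k2 : mixedNorm m 2 ∞ T ξ ≤ ENNReal.ofReal (c * X) := by
    rw [mixedNorm_two]
    have h1 : ∫⁻ t in timeInterval T, xNorm m ∞ (ξ t) ^ 2 ≤ ENNReal.ofReal (c * X) ^ 2 := by
      refine hb2.trans ?_
      rw [← ENNReal.ofReal_pow (by positivity), mul_pow c, hc2, show (4 : ℝ≥0∞) = ENNReal.ofReal 4 by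
        norm_num, ← ENNReal.ofReal_mul (by norm_num), ← ENNReal.ofReal_mul (by positivity)]
      refine ENNReal.ofReal_le_ofReal ?_
      calc _ ≤ 4 * (3 * (m : ℝ) ^ 4 + 7) * (3 * X ^ 2) := by gcongr
        _ = _ := by ring
    calc _ ≤ (ENNReal.ofReal (c * X) ^ 2) ^ (1 / 2 : ℝ) := by gcongr
      _ = _ := by rw [← ENNReal.rpow_two, ← ENNReal.rpow_mul]; norm_num
  have k3 : ENNReal.ofReal Y ≤ ENNReal.ofReal κ * xNorm m 2 ξ₀ := by
    rw [hY, ofReal_norm]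
    refine (enorm_logPair_le hm1 hκm (hg 0 h00) (hsol.memX 0 h00)).trans ?_
    gcongr
    exact xNorm_congr_ae hsol.initial
  calc mixedNorm m ∞ 2 T ξ + mixedNorm m 2 ∞ T ξ
      ≤ ENNReal.ofReal X + ENNReal.ofReal (c * X) := add_le_add k1 k2
    _ = ENNReal.ofReal ((1 + c) * a) * (ENNReal.ofReal Y
          + (mixedNorm m 1 2 T f₁ + mixedNorm m 2 1 T f₂)) := by
        rw [← ENNReal.ofReal_toReal hfin₁, ← ENNReal.ofReal_toReal hfin₂,
          ← ENNReal.ofReal_add hb₁0 hb₂0, ← ENNReal.ofReal_add hY0 (by positivity),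
          ← ENNReal.ofReal_add hX0 (by positivity), ← ENNReal.ofReal_mul (by positivity), hX]
        congr 1
        ring
    _ ≤ ENNReal.ofReal ((1 + c) * a) * (ENNReal.ofReal κ * xNorm m 2 ξ₀
          + ENNReal.ofReal κ * (mixedNorm m 1 2 T f₁ + mixedNorm m 2 1 T f₂)) := by
        gcongr
        refine le_mul_of_one_le_left' ?_
        rw [← ENNReal.ofReal_one]
        exact ENNReal.ofReal_le_ofReal hκ1
    _ = _ := by rw [← mul_add, ← mul_assoc, ← ENNReal.ofReal_mul (by positivity)]

end HarmonicMapFlow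

open HarmonicMapFlow

theorem mainTheorem9 (m : ℕ) (hm : 4 ≤ m) :
    ∃ C : ℝ≥0, ∀ (T : ℝ≥0∞) (s : ℝ → ℝ) (f : ℝ → ℝ → ℝ) (ξ₀ : ℝ → ℝ) (ξ : ℝ → ℝ → ℝ),
      (∀ t ∈ timeInterval T, 0 < s t) →
      DifferentiableOn ℝ s (timeInterval T) →
      IsLinearizedSolution m T s f ξ₀ ξ →
      (∀ t ∈ timeInterval T, ∫ r, ξ t r * h m (r / s t) ∂rdr = 0) →
      mixedNorm m ∞ 2 T ξ + mixedNorm m 2 ∞ T ξ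
        ≤ C * (xNorm m 2 ξ₀ + forcingNorm m T f
            + eLpNorm (deriv s) 2 (volume.restrict (timeInterval T))) := by
  obtain ⟨C, hC0, hC⟩ := exists_bound_of_decomposition m hm
  refine ⟨C, fun T s f ξ₀ ξ hs hd hsol horth => ?_⟩
  have hC0' : (C : ℝ≥0∞) ≠ 0 := by exact_mod_cast hC0
  have h1 : mixedNorm m ∞ 2 T ξ + mixedNorm m 2 ∞ T ξ
      ≤ C * (xNorm m 2 ξ₀ + forcingNorm m T f) := by
    -- The forcing norm is isolated on the right so that the infimum can be taken over
    -- decompositions; dividing by C requires C ≠ 0.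
    rw [← ENNReal.div_le_iff' hC0' ENNReal.coe_ne_top, ← tsub_le_iff_left]
    refine le_iInf fun f₁ => le_iInf fun f₂ => le_iInf fun h₁ => le_iInf fun h₂ =>
      le_iInf fun hf => ?_
    rw [tsub_le_iff_left, ENNReal.div_le_iff' hC0' ENNReal.coe_ne_top]
    exact hC T s f f₁ f₂ ξ₀ ξ hs hd.continuousOn hsol horth h₁ h₂ hf
  -- The energy does not depend on s, so the bound already holds without the norm of ṡ.
  exact h1.trans (mul_le_mul' le_rfl le_self_add)
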